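/- All Hilbert spaces are complex. $\mathcal L_b(\mathcal H,\mathcal G)$ denotes the bounded linear operators, $\mathcal S_1$ and $\mathcal S_2$ the trace-class and Hilbert–Schmidt operators, $\mathcal O(\mathcal H,\mathcal G)$ the linear operators $T$ from a linear subspace $\mathcal D(T)\subset\mathcal H$ into $\mathcal G$, and $x\otimes y$ the operator $z\mapsto\langle z,y\rangle x$. Let $(\Lambda,\mathcal A)$ be a measurable space, $(\Omega,\mathcal F,\mathbb P)$ a probability space, and $\mathcal H_0,\mathcal G_0$ separable Hilbert spaces. *Modules and Gramians.* A Gramian on an $\mathcal L_b(\mathcal G_0)$-module $X$ is a map $[\cdot,\cdot]:X\times X\to\mathcal S_1(\mathcal G_0)$ with $[x,x]\ge 0$, $[x,x]=0\iff x=0$, $[x+\mathrm T\bullet y,z]=[x,z]+\mathrm T[y,z]$ and $[y,x]=[x,y]^{\mathsf H}$; the associated norm is $\|x\|=\|[x,x]\|_1^{1/2}$. A Gramian-isometry is an $\mathcal L_b(\mathcal G_0)$-linear map that preserves Gramians. For a separable Hilbert space $\mathcal H$, let $\mathcal M(\Omega,\mathcal H)$ be the space of ($\mathbb P$-a.s.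 classes of) $\mathcal H$-valued random variables $X$ with $\mathbb E\|X\|^2<\infty$ and $\mathbb E X=0$, with module action $\mathrm T\bullet X=\mathrm TX$ ($\mathrm T\in\mathcal L_b(\mathcal H)$) and Gramian $[X,Y]=\operatorname{Cov}(X,Y)=\mathbb E[X\otimes Y]$. *Random c.a.g.o.s. measures.* An $\mathcal H_0$-valued random c.a.g.o.s. (countably additive Gramian-orthogonally scattered) measure is a countably additive map $W:\mathcal A\to\mathcal M(\Omega,\mathcal H_0)$ such that $[W(A),W(B)]=0$ whenever $A\cap B=\emptyset$. Its intensity operator measure is the trace-class positive operator valued measure $\nu_W(A)=[W(A),W(A)]$. Let $\mathcal H^{W,\mathcal G_0}$ be the closed linear span in $\mathcal M(\Omega,\mathcal G_0)$ of $\{\mathrm PW(A):\mathrm P\in\mathcal L_b(\mathcal H_0,\mathcal G_0),\ A\in\mathcal A\}$; it is a submodule. *The space $\mathsf L^2$.* Let $\nu$ be a trace-class positive operator valued measure on $(\Lambda,\mathcal A)$ acting on $\mathcal H_0$, $\|\nu\|_1$ its (finite) variation measure for the norm of $\mathcal S_1$, and $f=\mathrm d\nu/\mathrm d\|\nu\|_1$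 its positive $\mathcal S_1(\mathcal H_0)$-valued density. A function $\Phi:\Lambda\to\mathcal O(\mathcal H_0,\mathcal G_0)$ is $\mathcal O$-measurable if $\{\lambda:x\in\mathcal D(\Phi(\lambda))\}\in\mathcal A$ for all $x\in\mathcal H_0$ and there are $\Phi_n:\Lambda\to\mathcal L_b(\mathcal H_0,\mathcal G_0)$, with $\lambda\mapsto\Phi_n(\lambda)x$ measurable for all $n$ and $x$, such that $\Phi_n(\lambda)x\to\Phi(\lambda)x$ for all $\lambda\in\Lambda$ and $x\in\mathcal D(\Phi(\lambda))$. It is square $\nu$-integrable if moreover $\|\nu\|_1$-a.e. $\operatorname{Im}(f^{1/2})\subset\mathcal D(\Phi)$ and $\Phi f^{1/2}\in\mathcal S_2(\mathcal H_0,\mathcal G_0)$, and $(\Phi f^{1/2})(\Phi f^{1/2})^{\mathsf H}$ is Bochner $\|\nu\|_1$-integrable in $\mathcal S_1(\mathcal G_0)$. For square $\nu$-integrable $\Phi,\Psi$ set $[\Phi,\Psi]_\nu=\int(\Phi f^{1/2})(\Psi f^{1/2})^{\mathsf H}\,\mathrm d\|\nu\|_1$ and $\|\Phi\|_\nu=\|[\Phi,\Phi]_\nu\|_1^{1/2}$.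 Then $\mathsf L^2(\Lambda,\mathcal O(\mathcal H_0,\mathcal G_0),\nu)$ is the set of square $\nu$-integrable functions, where $\Phi$ and $\Psi$ are identified if $\|\Phi-\Psi\|_\nu=0$, with module action $(\mathrm T\bullet\Phi)(\lambda)=\mathrm T\Phi(\lambda)$ ($\mathrm T\in\mathcal L_b(\mathcal G_0)$) and Gramian $[\cdot,\cdot]_\nu$. **Theorem.** Let $W$ be an $\mathcal H_0$-valued random c.a.g.o.s. measure with intensity operator measure $\nu_W$. Then there exists a unique Gramian-isometry $$I_W^{\mathcal G_0}:\mathsf L^2(\Lambda,\mathcal O(\mathcal H_0,\mathcal G_0),\nu_W)\to\mathcal M(\Omega,\mathcal G_0)$$ such that $I_W^{\mathcal G_0}(\mathbb 1_A\mathrm P)=\mathrm PW(A)$ $\mathbb P$-a.s. for all $A\in\mathcal A$ and $\mathrm P\in\mathcal L_b(\mathcal H_0,\mathcal G_0)$. Moreover, $I_W^{\mathcal G_0}$ is a bijection onto $\mathcal H^{W,\mathcal G_0}$, so that $\mathsf L^2(\Lambda,\mathcal O(\mathcal H_0,\mathcal G_0),\nu_W)$ and $\mathcal H^{W,\mathcal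 G_0}$ are Gramian-isometrically isomorphic. -/

import Mathlib

open MeasureTheory Filter Topology
open scoped ENNReal InnerProductSpace ComplexOrder

set_option linter.unusedSectionVars false

noncomputable section

namespace GramianIntegral

/-! ### Schatten classes -/

section TraceClass

variable {H G I : Type*}
  [NormedAddCommGroup H] [InnerProductSpace ℂ H]
  [NormedAddCommGroup G] [InnerProductSpace ℂ G]
  [NormedAddCommGroup I] [InnerProductSpace ℂ I]

/-- The Schatten-1 norm, with values in `[0, ∞]`: the supremum of `∑ i, |⟪g i, T (e i)⟫|` over
all finite orthonormal families `e` and `g` of the same length. It is the sum of the singular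
values of `T` if `T` is compact with summable singular values, and `∞` otherwise. -/
def traceNorm (T : H →L[ℂ] G) : ℝ≥0∞ :=
  ⨆ (n : ℕ) (e : Fin n → H) (g : Fin n → G) (_ : Orthonormal ℂ e) (_ : Orthonormal ℂ g),
    ∑ i, ‖⟪g i, T (e i)⟫_ℂ‖ₑ

/-- The square of the Schatten-2 (Hilbert-Schmidt) norm, with values in `[0, ∞]`: the supremum of
`∑ i, ‖T (e i)‖ ^ 2` over all finite orthonormal families `e`, that is, the sum of
`‖T (b i)‖ ^ 2` over any Hilbert basis `b`. -/
def hsNormSq (T : H →L[ℂ] G) : ℝ≥0∞ :=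
  ⨆ (n : ℕ) (e : Fin n → H) (_ : Orthonormal ℂ e), ∑ i, ‖T (e i)‖ₑ ^ 2

/-- The Schatten-2 operators. -/
def IsHilbertSchmidt (T : H →L[ℂ] G) : Prop := hsNormSq T ≠ ∞

lemma traceNorm_le_iff {T : H →L[ℂ] G} {c : ℝ≥0∞} :
    traceNorm T ≤ c ↔ ∀ (n : ℕ) (e : Fin n → H) (g : Fin n → G), Orthonormal ℂ e →
      Orthonormal ℂ g → ∑ i, ‖⟪g i, T (e i)⟫_ℂ‖ₑ ≤ c := by
  simp only [traceNorm, iSup_le_iff]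

lemma hsNormSq_le_iff {T : H →L[ℂ] G} {c : ℝ≥0∞} :
    hsNormSq T ≤ c ↔ ∀ (n : ℕ) (e : Fin n → H), Orthonormal ℂ e →
      ∑ i, ‖T (e i)‖ₑ ^ 2 ≤ c := by
  simp only [hsNormSq, iSup_le_iff]

lemma sum_le_traceNorm (T : H →L[ℂ] G) {n : ℕ} {e : Fin n → H} {g : Fin n → G}
    (he : Orthonormal ℂ e) (hg : Orthonormal ℂ g) :
    ∑ i, ‖⟪g i, T (e i)⟫_ℂ‖ₑ ≤ traceNorm T :=
  traceNorm_le_iff.1 le_rfl n e g he hg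

lemma sum_le_hsNormSq (T : H →L[ℂ] G) {ι : Type*} {e : ι → H} (he : Orthonormal ℂ e)
    (s : Finset ι) : ∑ i ∈ s, ‖T (e i)‖ₑ ^ 2 ≤ hsNormSq T := by
  have h := hsNormSq_le_iff.1 (le_refl (hsNormSq T)) s.card (fun i => e (s.equivFin.symm i))
    (he.comp _ (Subtype.val_injective.comp s.equivFin.symm.injective))
  rw [← Finset.sum_coe_sort]
  rwa [← Equiv.sum_comp s.equivFin.symm]

lemma traceNorm_zero : traceNorm (0 : H →L[ℂ] G) = 0 := by
  simp [traceNorm]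

lemma traceNorm_add_le (S T : H →L[ℂ] G) : traceNorm (S + T) ≤ traceNorm S + traceNorm T := by
  refine traceNorm_le_iff.2 fun n e g he hg => ?_
  refine le_trans (Finset.sum_le_sum fun i _ => ?_) ((Finset.sum_add_distrib).le.trans
    (add_le_add (sum_le_traceNorm S he hg) (sum_le_traceNorm T he hg)))
  rw [add_apply, inner_add_right]
  exact enorm_add_le _ _

lemma traceNorm_smul_le (c : ℂ) (T : H →L[ℂ] G) :
    traceNorm (c • T) ≤ ‖c‖ₑ * traceNorm T := by
  refine traceNorm_le_iff.2 fun n e g he hg => ?_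
  simp only [smul_apply, inner_smul_right, enorm_mul]
  rw [← Finset.mul_sum]
  gcongr
  exact sum_le_traceNorm T he hg

lemma traceNorm_smul (c : ℂ) (T : H →L[ℂ] G) : traceNorm (c • T) = ‖c‖ₑ * traceNorm T := by
  refine le_antisymm (traceNorm_smul_le c T) ?_
  rcases eq_or_ne c 0 with rfl | hc
  · simp
  have h := traceNorm_smul_le c⁻¹ (c • T)
  rw [inv_smul_smul₀ hc, enorm_inv hc] at h
  calc ‖c‖ₑ * traceNorm T ≤ ‖c‖ₑ * (‖c‖ₑ⁻¹ * traceNorm (c • T)) := by gcongr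
    _ = traceNorm (c • T) := by
      rw [← mul_assoc, ENNReal.mul_inv_cancel (by simpa using hc) (by simp), one_mul]

lemma enorm_apply_le (T : H →L[ℂ] G) (x : H) : ‖T x‖ₑ ≤ traceNorm T * ‖x‖ₑ := by
  rcases eq_or_ne (T x) 0 with h0 | h0
  · simp [h0]
  have hx : x ≠ 0 := fun h => h0 (by simp [h])
  have hx' : ‖x‖ ≠ 0 := by simpa using hx
  have hT' : ‖T x‖ ≠ 0 := by simpa using h0
  have key := sum_le_traceNorm T (n := 1) (e := fun _ => ((‖x‖ : ℂ)⁻¹) • x)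
    (g := fun _ => ((‖T x‖ : ℂ)⁻¹) • T x)
    ⟨fun _ => by simp [norm_smul, hx'], fun i j hij => absurd (Subsingleton.elim i j) hij⟩
    ⟨fun _ => by simp [norm_smul, hT'], fun i j hij => absurd (Subsingleton.elim i j) hij⟩
  have hval : ‖⟪((‖T x‖ : ℂ)⁻¹) • T x, T (((‖x‖ : ℂ)⁻¹) • x)⟫_ℂ‖ = ‖T x‖ / ‖x‖ := by
    rw [map_smul, inner_smul_left, inner_smul_right, norm_mul, norm_mul,
      inner_self_eq_norm_sq_to_K]
    simp
    field_simp
  simp only [Finset.univ_unique, Finset.sum_singleton] at key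
  rw [← ofReal_norm, hval] at key
  calc ‖T x‖ₑ = ENNReal.ofReal (‖T x‖ / ‖x‖) * ‖x‖ₑ := by
        rw [← ofReal_norm, ← ofReal_norm,
          ← ENNReal.ofReal_mul (by positivity), div_mul_cancel₀ _ hx']
    _ ≤ _ := by gcongr

variable (H G) in
/-- The subspace of trace-class operators. -/
def traceClassSubmodule : Submodule ℂ (H →L[ℂ] G) where
  carrier := {T | traceNorm T ≠ ∞}
  zero_mem' := by simp [traceNorm_zero]
  add_mem' {S T} hS hT := ne_top_of_le_ne_top (ENNReal.add_ne_top.2 ⟨hS, hT⟩)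
    (traceNorm_add_le S T)
  smul_mem' c T hT := ne_top_of_le_ne_top (ENNReal.mul_ne_top (by simp) hT)
    (traceNorm_smul_le c T)

variable (H G) in
/-- The Schatten-1 class `𝒮₁(H, G)`, a Banach space for the Schatten-1 norm. -/
def TraceClass : Type _ := traceClassSubmodule H G

namespace TraceClass

/-- A bounded operator with finite Schatten-1 norm as an element of the Schatten-1 class. -/
def mk (T : H →L[ℂ] G) (h : traceNorm T ≠ ∞) : TraceClass H G :=
  (⟨T, h⟩ : traceClassSubmodule H G)

instance : AddCommGroup (TraceClass H G) := 
  (traceClassSubmodule H G).addCommGroup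

instance : Module ℂ (TraceClass H G) := (traceClassSubmodule H G).module

instance : Norm (TraceClass H G) := ⟨fun T => (traceNorm T.1).toReal⟩

lemma norm_def (T : TraceClass H G) : ‖T‖ = (traceNorm T.1).toReal := rfl

lemma norm_apply_le' (T : TraceClass H G) (x : H) : ‖T.1 x‖ ≤ ‖T‖ * ‖x‖ := by
  have h := ENNReal.toReal_mono (ENNReal.mul_ne_top T.2 (by simp)) (enorm_apply_le T.1 x)
  simpa [norm_def] using h

lemma core : NormedSpace.Core ℂ (TraceClass H G) where
  norm_nonneg T := ENNReal.toReal_nonneg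
  norm_smul c T := by
    change (traceNorm (c • T.1)).toReal = _
    rw [traceNorm_smul, ENNReal.toReal_mul, norm_def]
    simp
  norm_triangle S T := by
    change (traceNorm (S.1 + T.1)).toReal ≤ _
    rw [norm_def, norm_def, ← ENNReal.toReal_add S.2 T.2]
    exact ENNReal.toReal_mono (ENNReal.add_ne_top.2 ⟨S.2, T.2⟩) (traceNorm_add_le S.1 T.1)
  norm_eq_zero_iff T := by
    constructor
    · intro h
      refine Subtype.ext (ContinuousLinearMap.ext fun x => ?_)
      have := norm_apply_le' T x
      rw [h, zero_mul] at this
      exact norm_le_zero_iff.1 this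
    · rintro rfl
      change (traceNorm (0 : H →L[ℂ] G)).toReal = 0
      simp [traceNorm_zero]

instance : NormedAddCommGroup (TraceClass H G) := NormedAddCommGroup.ofCore core

instance : NormedSpace ℂ (TraceClass H G) := NormedSpace.ofCore core

/-- A trace-class operator as a bounded operator. -/
def toCLM (T : TraceClass H G) : H →L[ℂ] G := T.1

/-- The continuous inclusion of the trace-class operators in the bounded operators. -/
def toCLML : TraceClass H G →L[ℂ] (H →L[ℂ] G) :=
  LinearMap.mkContinuous
    { toFun := toCLM
      map_add' := fun _ _ => rfl
      map_smul' := fun _ _ => rfl } 1 fun T => by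
    rw [one_mul]
    exact ContinuousLinearMap.opNorm_le_bound _ (norm_nonneg _) (norm_apply_le' T)

lemma toCLML_apply (T : TraceClass H G) : toCLML T = T.toCLM := rfl

lemma toCLM_zero : (0 : TraceClass H G).toCLM = 0 := rfl

lemma toCLM_add (S T : TraceClass H G) : (S + T).toCLM = S.toCLM + T.toCLM := rfl

lemma toCLM_sub (S T : TraceClass H G) : (S - T).toCLM = S.toCLM - T.toCLM := rfl

lemma toCLM_injective : Function.Injective (toCLM : TraceClass H G → (H →L[ℂ] G)) :=
  Subtype.val_injective

lemma traceNorm_toCLM (T : TraceClass H G) : traceNorm T.toCLM = ‖T‖ₑ := by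
  rw [← ofReal_norm, norm_def, ENNReal.ofReal_toReal T.2]
  rfl

/-- A bounded operator as an element of the trace class (and `0` if it is not trace-class). -/
def ofCLM (T : H →L[ℂ] G) : TraceClass H G :=
  open Classical in if h : traceNorm T ≠ ∞ then mk T h else 0

lemma toCLM_ofCLM {T : H →L[ℂ] G} (h : traceNorm T ≠ ∞) : (ofCLM T).toCLM = T := by
  unfold ofCLM
  rw [dif_pos h]
  rfl

lemma ofCLM_toCLM (T : TraceClass H G) : ofCLM T.toCLM = T := by
  refine toCLM_injective (toCLM_ofCLM ?_)
  rw [traceNorm_toCLM]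
  simp

instance [CompleteSpace G] : CompleteSpace (TraceClass H G) := by
  refine Metric.complete_of_cauchySeq_tendsto fun u hu => ?_
  obtain ⟨T, hT⟩ := cauchySeq_tendsto_of_complete
    ((toCLML (H := H) (G := G)).uniformContinuous.comp_cauchySeq hu)
  have hlim : ∀ n (ε : ℝ), 0 ≤ ε → (∀ m ≥ n, ‖u m - u n‖ ≤ ε) →
      traceNorm (T - (u n).toCLM) ≤ ENNReal.ofReal ε := by
    intro n ε hε hm
    refine traceNorm_le_iff.2 fun k e g he hg => ?_
    have h1 : Tendsto (fun m => ∑ i, ‖⟪g i, ((u m).toCLM - (u n).toCLM) (e i)⟫_ℂ‖ₑ) atTop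
        (𝓝 (∑ i, ‖⟪g i, (T - (u n).toCLM) (e i)⟫_ℂ‖ₑ)) := by
      refine tendsto_finsetSum _ fun i _ => ?_
      refine (Continuous.tendsto continuous_enorm _).comp ?_
      refine Filter.Tendsto.inner tendsto_const_nhds ?_
      exact ((ContinuousLinearMap.apply ℂ G (e i)).continuous.tendsto _).comp
        (hT.sub tendsto_const_nhds)
    refine le_of_tendsto h1 ?_
    filter_upwards [eventually_ge_atTop n] with m hmn
    rw [← toCLM_sub]
    refine (sum_le_traceNorm _ he hg).trans ?_
    rw [traceNorm_toCLM, ← ofReal_norm]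
    exact ENNReal.ofReal_le_ofReal (hm m hmn)
  have hT' : traceNorm T ≠ ∞ := by
    obtain ⟨n, hn⟩ := Metric.cauchySeq_iff'.1 hu 1 one_pos
    have h1 := hlim n 1 zero_le_one fun m hm => by
      rw [← dist_eq_norm]; exact (hn m hm).le
    have h2 := traceNorm_add_le (T - (u n).toCLM) (u n).toCLM
    rw [sub_add_cancel] at h2
    refine ne_top_of_le_ne_top (ENNReal.add_ne_top.2 ⟨ne_top_of_le_ne_top (by simp) h1, ?_⟩) h2
    rw [traceNorm_toCLM]
    simp
  refine ⟨mk T hT', Metric.tendsto_atTop.2 fun ε hε => ?_⟩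
  obtain ⟨N, hN⟩ := Metric.cauchySeq_iff.1 hu (ε / 2) (half_pos hε)
  refine ⟨N, fun n hn => ?_⟩
  have h1 := hlim n (ε / 2) (half_pos hε).le fun m hm => by
    rw [← dist_eq_norm]; exact (hN m (hm.trans' hn) n hn).le
  rw [dist_comm, dist_eq_norm]
  have h2 : ‖mk T hT' - u n‖ ≤ ε / 2 := by
    rw [norm_def]
    exact ENNReal.toReal_le_of_le_ofReal (half_pos hε).le h1
  linarith

lemma traceNorm_rankOne_le (x : G) (y : H) :
    traceNorm (InnerProductSpace.rankOne ℂ x y) ≤ ENNReal.ofReal (‖x‖ * ‖y‖) := by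
  refine traceNorm_le_iff.2 fun n e g he hg => ?_
  have h : ∑ i, ‖⟪g i, (InnerProductSpace.rankOne ℂ x y) (e i)⟫_ℂ‖ ≤ ‖x‖ * ‖y‖ := by
    calc ∑ i, ‖⟪g i, (InnerProductSpace.rankOne ℂ x y) (e i)⟫_ℂ‖
        = ∑ i, ‖⟪g i, x⟫_ℂ‖ * ‖⟪e i, y⟫_ℂ‖ := by
          refine Finset.sum_congr rfl fun i _ => ?_
          rw [InnerProductSpace.rankOne_apply, inner_smul_right, norm_mul, norm_inner_symm y,
            mul_comm]
      _ ≤ √(∑ i, ‖⟪g i, x⟫_ℂ‖ ^ 2) * √(∑ i, ‖⟪e i, y⟫_ℂ‖ ^ 2) :=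
          Real.sum_mul_le_sqrt_mul_sqrt _ _ _
      _ ≤ ‖x‖ * ‖y‖ := by
          gcongr
          · exact Real.sqrt_le_iff.2 ⟨norm_nonneg _, hg.sum_inner_products_le x⟩
          · exact Real.sqrt_le_iff.2 ⟨norm_nonneg _, he.sum_inner_products_le y⟩
  simp only [← ofReal_norm]
  rw [← ENNReal.ofReal_sum_of_nonneg fun _ _ => norm_nonneg _]
  exact ENNReal.ofReal_le_ofReal h

/-- The rank-one operator `x ⊗ y : z ↦ ⟪y, z⟫ x` as a trace-class operator. -/
def rankOne (x : G) (y : H) : TraceClass H G :=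
  mk (InnerProductSpace.rankOne ℂ x y)
    (ne_top_of_le_ne_top ENNReal.ofReal_ne_top (traceNorm_rankOne_le x y))

lemma toCLM_rankOne (x : G) (y : H) :
    (rankOne x y).toCLM = InnerProductSpace.rankOne ℂ x y := rfl

lemma rankOne_add_left (x x' : G) (y : H) : rankOne (x + x') y = rankOne x y + rankOne x' y := by
  refine toCLM_injective ?_
  rw [toCLM_add]
  simp only [toCLM_rankOne, map_add, add_apply]

lemma rankOne_sub_left (x x' : G) (y : H) : rankOne (x - x') y = rankOne x y - rankOne x' y := by
  refine toCLM_injective ?_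
  rw [toCLM_sub]
  simp only [toCLM_rankOne, map_sub, sub_apply]

lemma rankOne_sub_right (x : G) (y y' : H) : rankOne x (y - y') = rankOne x y - rankOne x y' := by
  refine toCLM_injective ?_
  rw [toCLM_sub]
  simp only [toCLM_rankOne, map_sub]

lemma norm_rankOne_le (x : G) (y : H) : ‖rankOne x y‖ ≤ ‖x‖ * ‖y‖ :=
  ENNReal.toReal_le_of_le_ofReal (by positivity) (traceNorm_rankOne_le x y)

lemma continuous_rankOne : Continuous (Function.uncurry (rankOne : G → H → TraceClass H G)) := by
  refine continuous_iff_continuousAt.2 fun p => tendsto_iff_norm_sub_tendsto_zero.2 ?_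
  have h : Continuous fun q : G × H => ‖q.1 - p.1‖ * ‖q.2‖ + ‖p.1‖ * ‖q.2 - p.2‖ := by fun_prop
  refine squeeze_zero (fun _ => norm_nonneg _) (fun q => ?_) (by simpa using h.tendsto p)
  have h2 : rankOne q.1 q.2 - rankOne p.1 p.2 =
      rankOne (q.1 - p.1) q.2 + rankOne p.1 (q.2 - p.2) := by
    rw [rankOne_sub_left, rankOne_sub_right]
    abel
  simp only [Function.uncurry]
  rw [h2]
  exact (norm_add_le _ _).trans (add_le_add (norm_rankOne_le _ _) (norm_rankOne_le _ _))

lemma aestronglyMeasurable_rankOne {X : Type*} [MeasurableSpace X] {μ : Measure X} {f : X → G}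
    {g : X → H} (hf : AEStronglyMeasurable f μ) (hg : AEStronglyMeasurable g μ) :
    AEStronglyMeasurable (fun t => rankOne (f t) (g t)) μ :=
  Continuous.comp_aestronglyMeasurable₂ (g := rankOne) continuous_rankOne hf hg

end TraceClass

end TraceClass

/-! ### Products of Hilbert-Schmidt operators -/

section HilbertSchmidt

variable {H G I : Type*}
  [NormedAddCommGroup H] [InnerProductSpace ℂ H] [CompleteSpace H]
  [NormedAddCommGroup G] [InnerProductSpace ℂ G] [CompleteSpace G]
  [NormedAddCommGroup I] [InnerProductSpace ℂ I] [CompleteSpace I]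

open ContinuousLinearMap (adjoint)

lemma hsNormSq_zero : hsNormSq (0 : H →L[ℂ] G) = 0 := by
  simp [hsNormSq]

lemma hsNormSq_neg (T : H →L[ℂ] G) : hsNormSq (-T) = hsNormSq T := by
  simp [hsNormSq]

lemma hsNormSq_add_le (S T : H →L[ℂ] G) :
    hsNormSq (S + T) ≤ 2 * hsNormSq S + 2 * hsNormSq T := by
  refine hsNormSq_le_iff.2 fun n e he => ?_
  calc ∑ i, ‖(S + T) (e i)‖ₑ ^ 2
      ≤ ∑ i, (2 * ‖S (e i)‖ₑ ^ 2 + 2 * ‖T (e i)‖ₑ ^ 2) := by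
        refine Finset.sum_le_sum fun i _ => ?_
        have h : ‖(S + T) (e i)‖ ^ 2 ≤ 2 * ‖S (e i)‖ ^ 2 + 2 * ‖T (e i)‖ ^ 2 := by
          have h1 : ‖(S + T) (e i)‖ ≤ ‖S (e i)‖ + ‖T (e i)‖ := norm_add_le _ _
          nlinarith [norm_nonneg ((S + T) (e i)), sq_nonneg (‖S (e i)‖ - ‖T (e i)‖)]
        have h2 := ENNReal.ofReal_le_ofReal h
        rw [ENNReal.ofReal_add (by positivity) (by positivity), ENNReal.ofReal_mul (by norm_num),
          ENNReal.ofReal_mul (by norm_num), ENNReal.ofReal_pow (norm_nonneg _),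
          ENNReal.ofReal_pow (norm_nonneg _), ENNReal.ofReal_pow (norm_nonneg _)] at h2
        simpa [ofReal_norm] using h2
    _ = 2 * ∑ i, ‖S (e i)‖ₑ ^ 2 + 2 * ∑ i, ‖T (e i)‖ₑ ^ 2 := by
        rw [Finset.sum_add_distrib, Finset.mul_sum, Finset.mul_sum]
    _ ≤ _ := by
        gcongr
        · exact sum_le_hsNormSq S he _
        · exact sum_le_hsNormSq T he _

lemma hsNormSq_comp_le (P : G →L[ℂ] I) (T : H →L[ℂ] G) :
    hsNormSq (P ∘L T) ≤ ‖P‖ₑ ^ 2 * hsNormSq T := by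
  refine hsNormSq_le_iff.2 fun n e he => ?_
  calc ∑ i, ‖P (T (e i))‖ₑ ^ 2 ≤ ∑ i, ‖P‖ₑ ^ 2 * ‖T (e i)‖ₑ ^ 2 := by
        refine Finset.sum_le_sum fun i _ => ?_
        rw [← mul_pow]
        gcongr
        exact P.le_opENorm _
    _ ≤ _ := by
        rw [← Finset.mul_sum]
        gcongr
        exact sum_le_hsNormSq T he _

lemma hsNormSq_adjoint_le (T : H →L[ℂ] G) : hsNormSq (adjoint T) ≤ hsNormSq T := by
  refine hsNormSq_le_iff.2 fun n g hg => ?_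
  let V : Submodule ℂ H := Submodule.span ℂ (Set.range fun j => adjoint T (g j))
  have : FiniteDimensional ℂ V := FiniteDimensional.span_of_finite ℂ (Set.finite_range _)
  let b := stdOrthonormalBasis ℂ V
  have hb : Orthonormal ℂ fun i => (b i : H) :=
    b.orthonormal.comp_linearIsometry V.subtypeₗᵢ
  have h1 : ∀ j, ‖adjoint T (g j)‖ ^ 2 = ∑ i, ‖⟪g j, T (b i)⟫_ℂ‖ ^ 2 := by
    intro j
    have hmem : adjoint T (g j) ∈ V := Submodule.subset_span ⟨j, rfl⟩
    have h2 := b.sum_sq_norm_inner_right ⟨_, hmem⟩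
    rw [Submodule.coe_norm] at h2
    rw [← h2]
    refine Finset.sum_congr rfl fun i _ => ?_
    rw [Submodule.coe_inner, ContinuousLinearMap.adjoint_inner_right, norm_inner_symm]
  have h3 : ∑ j, ‖adjoint T (g j)‖ ^ 2 ≤ ∑ i, ‖T (b i)‖ ^ 2 := by
    simp only [h1]
    rw [Finset.sum_comm]
    exact Finset.sum_le_sum fun i _ => hg.sum_inner_products_le _
  refine le_trans ?_ (sum_le_hsNormSq T hb Finset.univ)
  have h4 := ENNReal.ofReal_le_ofReal h3
  rw [ENNReal.ofReal_sum_of_nonneg fun _ _ => by positivity,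
    ENNReal.ofReal_sum_of_nonneg fun _ _ => by positivity] at h4
  simpa only [ENNReal.ofReal_pow (norm_nonneg _), ofReal_norm] using h4

lemma traceNorm_comp_adjoint_le (T : H →L[ℂ] G) (S : H →L[ℂ] I) :
    traceNorm (T ∘L adjoint S) ≤ hsNormSq T + hsNormSq S := by
  refine traceNorm_le_iff.2 fun n e g he hg => ?_
  calc ∑ i, ‖⟪g i, (T ∘L adjoint S) (e i)⟫_ℂ‖ₑ
      ≤ ∑ i, (‖adjoint T (g i)‖ₑ ^ 2 + ‖adjoint S (e i)‖ₑ ^ 2) := by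
        refine Finset.sum_le_sum fun i _ => ?_
        rw [ContinuousLinearMap.comp_apply, ← ContinuousLinearMap.adjoint_inner_left]
        have h : ‖⟪adjoint T (g i), adjoint S (e i)⟫_ℂ‖ ≤
            ‖adjoint T (g i)‖ ^ 2 + ‖adjoint S (e i)‖ ^ 2 := by
          refine (norm_inner_le_norm _ _).trans ?_
          nlinarith [sq_nonneg (‖adjoint T (g i)‖ - ‖adjoint S (e i)‖),
            sq_nonneg (‖adjoint T (g i)‖ + ‖adjoint S (e i)‖)]
        have h2 := ENNReal.ofReal_le_ofReal h
        rwa [ENNReal.ofReal_add (by positivity) (by positivity), ENNReal.ofReal_pow (norm_nonneg _),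
          ENNReal.ofReal_pow (norm_nonneg _), ofReal_norm, ofReal_norm, ofReal_norm] at h2
    _ = ∑ i, ‖adjoint T (g i)‖ₑ ^ 2 + ∑ i, ‖adjoint S (e i)‖ₑ ^ 2 := Finset.sum_add_distrib
    _ ≤ _ := by
        gcongr
        · exact (sum_le_hsNormSq _ hg _).trans (hsNormSq_adjoint_le T)
        · exact (sum_le_hsNormSq _ he _).trans (hsNormSq_adjoint_le S)

lemma hsNormSq_le_traceNorm (T : H →L[ℂ] G) : hsNormSq T ≤ traceNorm (T ∘L adjoint T) := by
  have h0 := hsNormSq_adjoint_le (adjoint T)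
  rw [ContinuousLinearMap.adjoint_adjoint] at h0
  refine h0.trans (hsNormSq_le_iff.2 fun n e he => ?_)
  refine le_trans (le_of_eq ?_) (sum_le_traceNorm (T ∘L adjoint T) he he)
  refine Finset.sum_congr rfl fun i _ => ?_
  rw [ContinuousLinearMap.comp_apply, ← ContinuousLinearMap.adjoint_inner_left,
    inner_self_eq_norm_sq_to_K]
  simp [← ofReal_norm, ENNReal.ofReal_pow]

lemma traceNorm_comp_adjoint_ne_top {T : H →L[ℂ] G} {S : H →L[ℂ] I} (hT : IsHilbertSchmidt T)
    (hS : IsHilbertSchmidt S) : traceNorm (T ∘L adjoint S) ≠ ∞ :=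
  ne_top_of_le_ne_top (ENNReal.add_ne_top.2 ⟨hT, hS⟩) (traceNorm_comp_adjoint_le T S)

lemma IsHilbertSchmidt.summable {T : H →L[ℂ] G} (hT : IsHilbertSchmidt T) {ι : Type*}
    (b : HilbertBasis ι ℂ H) : Summable fun k => ‖T (b k)‖ ^ 2 := by
  refine summable_of_sum_le (fun _ => by positivity) (c := (hsNormSq T).toReal) fun s => ?_
  have h := ENNReal.toReal_mono hT (sum_le_hsNormSq T b.orthonormal s)
  rw [ENNReal.toReal_sum (by simp)] at h
  simpa using h

lemma IsHilbertSchmidt.hasSum_rankOne {T : H →L[ℂ] G} {S : H →L[ℂ] I} (hT : IsHilbertSchmidt T)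
    (hS : IsHilbertSchmidt S) {ι : Type*} (b : HilbertBasis ι ℂ H) :
    HasSum (fun k => TraceClass.rankOne (T (b k)) (S (b k)))
      (TraceClass.ofCLM (T ∘L adjoint S)) := by
  have hsum : Summable fun k => TraceClass.rankOne (T (b k)) (S (b k)) := by
    refine Summable.of_norm_bounded ((hT.summable b).add (hS.summable b)) fun k => ?_
    refine (TraceClass.norm_rankOne_le _ _).trans ?_
    nlinarith [sq_nonneg (‖T (b k)‖ - ‖S (b k)‖), sq_nonneg (‖T (b k)‖ + ‖S (b k)‖)]
  obtain ⟨R, hR⟩ := hsum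
  have hRT : R.toCLM = T ∘L adjoint S := by
    refine ContinuousLinearMap.ext fun y => ?_
    have h1 : HasSum (fun k => ⟪S (b k), y⟫_ℂ • T (b k)) (R.toCLM y) := by
      have := (hR.mapL TraceClass.toCLML).mapL (ContinuousLinearMap.apply ℂ G y)
      simpa [TraceClass.toCLML_apply, TraceClass.toCLM_rankOne] using this
    have h2 : HasSum (fun k => ⟪S (b k), y⟫_ℂ • T (b k)) (T (adjoint S y)) := by
      have := (b.hasSum_repr (adjoint S y)).mapL T
      simpa [HilbertBasis.repr_apply_apply, ContinuousLinearMap.adjoint_inner_right] using this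
    exact h1.unique h2
  rwa [← hRT, TraceClass.ofCLM_toCLM]

lemma exists_countable_hilbertBasis (H : Type*) [NormedAddCommGroup H] [InnerProductSpace ℂ H]
    [CompleteSpace H] [TopologicalSpace.SeparableSpace H] :
    ∃ (w : Set H) (_ : HilbertBasis w ℂ H), w.Countable := by
  obtain ⟨w, b, hb⟩ := exists_hilbertBasis ℂ H
  refine ⟨w, b, ?_⟩
  have hd : w.Pairwise fun x y => 1 ≤ dist x y := by
    intro x hx y hy hxy
    have h1 := b.orthonormal.1 ⟨x, hx⟩
    have h2 := b.orthonormal.1 ⟨y, hy⟩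
    have h3 := b.orthonormal.2 (i := ⟨x, hx⟩) (j := ⟨y, hy⟩) (by simpa using hxy)
    rw [hb] at h1 h2 h3
    simp only at h1 h2 h3
    rw [dist_eq_norm]
    have h4 := norm_sub_sq (𝕜 := ℂ) x y
    rw [h1, h2, h3] at h4
    simp at h4
    nlinarith [norm_nonneg (x - y)]
  refine Set.PairwiseDisjoint.countable_of_isOpen (s := fun x => Metric.ball x (1 / 2))
    (fun x hx y hy hxy => Metric.ball_disjoint_ball ?_) (fun _ _ => Metric.isOpen_ball)
    (fun x _ => ⟨x, Metric.mem_ball_self (by norm_num)⟩)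
  have := hd hx hy hxy
  norm_num
  exact this

end HilbertSchmidt

/-! ### Normal Hilbert modules -/

section Modules

open ContinuousLinearMap (adjoint)

variable {H G : Type*}
  [NormedAddCommGroup H] [InnerProductSpace ℂ H] [CompleteSpace H]
  [NormedAddCommGroup G] [InnerProductSpace ℂ G] [CompleteSpace G]

/-- The matrix coefficient `T ↦ ⟪x, T y⟫` of trace-class operators. -/
def TraceClass.coeff (x : G) (y : H) : TraceClass H G →L[ℂ] ℂ :=
  (innerSL ℂ x) ∘L (ContinuousLinearMap.apply ℂ G y) ∘L TraceClass.toCLML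

lemma TraceClass.coeff_apply (x : G) (y : H) (T : TraceClass H G) :
    TraceClass.coeff x y T = ⟪x, T.toCLM y⟫_ℂ := rfl

lemma TraceClass.ext_coeff {S T : TraceClass H G}
    (h : ∀ x y, TraceClass.coeff x y S = TraceClass.coeff x y T) : S = T :=
  TraceClass.toCLM_injective (ContinuousLinearMap.ext fun y =>
    ext_inner_left ℂ fun x => h x y)

lemma TraceClass.inner_integral {X : Type*} [MeasurableSpace X] {μ : Measure X}
    {F : X → TraceClass H G} (hF : Integrable F μ) (x : G) (y : H) :
    ⟪x, (∫ t, F t ∂μ).toCLM y⟫_ℂ = ∫ t, ⟪x, (F t).toCLM y⟫_ℂ ∂μ :=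
  ((TraceClass.coeff x y).integral_comp_comm hF).symm

lemma isPositive_of_inner (T : H →L[ℂ] H) (h : ∀ x, 0 ≤ ⟪x, T x⟫_ℂ) : T.IsPositive := by
  rw [ContinuousLinearMap.isPositive_iff_complex]
  intro x
  have h1 := h x
  have h2 : ⟪T x, x⟫_ℂ = ⟪x, T x⟫_ℂ := by
    rw [← inner_conj_symm, Complex.conj_eq_iff_im]
    exact (Complex.nonneg_iff.1 h1).2.symm
  rw [h2]
  exact ⟨Complex.ext rfl (Complex.nonneg_iff.1 h1).2, (Complex.nonneg_iff.1 h1).1⟩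

instance : IsBoundedSMul (H →L[ℂ] H) H :=
  IsBoundedSMul.of_norm_smul_le fun T x => T.le_opNorm x

instance : IsScalarTower ℂ (H →L[ℂ] H) H := ⟨fun _ _ _ => rfl⟩

/-- `gram` is a Gramian on the `ℒ_b(K)`-module `X`. -/
structure IsGramian {K X : Type*} [NormedAddCommGroup K] [InnerProductSpace ℂ K]
    [CompleteSpace K] [AddCommGroup X] [Module (K →L[ℂ] K) X]
    (gram : X → X → TraceClass K K) : Prop where
  self_isPositive : ∀ x, (gram x x).toCLM.IsPositive
  self_eq_zero : ∀ x, gram x x = 0 ↔ x = 0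
  add_smul_left : ∀ x y z (T : K →L[ℂ] K),
    (gram (x + T • y) z).toCLM = (gram x z).toCLM + T ∘L (gram y z).toCLM
  adjoint_eq : ∀ x y, (gram y x).toCLM = adjoint (gram x y).toCLM

/-- A normal pre-Hilbert `ℒ_b(K)`-module: a module over the ring `K →L[ℂ] K` of bounded operators
on `K`, endowed with a Gramian. -/
class NormalPreHilbertModule (K X : Type*) [NormedAddCommGroup K] [InnerProductSpace ℂ K]
    [CompleteSpace K] [AddCommGroup X] [Module (K →L[ℂ] K) X] where
  gram : X → X → TraceClass K K
  isGramian : IsGramian gram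

/-- An `ℒ_b(K)`-linear map between normal pre-Hilbert `ℒ_b(K)`-modules is Gramian-isometric if it
preserves the Gramian. -/
def IsGramianIsometric {K X Y : Type*} [NormedAddCommGroup K] [InnerProductSpace ℂ K]
    [CompleteSpace K] [AddCommGroup X] [Module (K →L[ℂ] K) X] [AddCommGroup Y]
    [Module (K →L[ℂ] K) Y] [NormalPreHilbertModule K X] [NormalPreHilbertModule K Y]
    (F : X →ₗ[K →L[ℂ] K] Y) : Prop :=
  ∀ x y, NormalPreHilbertModule.gram (K := K) (F x) (F y) = NormalPreHilbertModule.gram x y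

/-- A submodule of a normal pre-Hilbert module, with the restricted Gramian. -/
instance {K X : Type*} [NormedAddCommGroup K] [InnerProductSpace ℂ K] [CompleteSpace K]
    [AddCommGroup X] [Module (K →L[ℂ] K) X] [NormalPreHilbertModule K X]
    (V : Submodule (K →L[ℂ] K) X) : NormalPreHilbertModule K V where
  gram x y := NormalPreHilbertModule.gram (x : X) (y : X)
  isGramian :=
    have h := NormalPreHilbertModule.isGramian (K := K) (X := X)
    { self_isPositive := fun x => h.self_isPositive x
      self_eq_zero := fun x => by rw [h.self_eq_zero]; simp
      add_smul_left := fun x y z T => h.add_smul_left x y z T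
      adjoint_eq := fun x y => h.adjoint_eq x y }

end Modules

/-! ### Centered square-integrable random variables -/

section Centered

open ContinuousLinearMap (adjoint)

variable {Ω : Type*} [MeasurableSpace Ω] (P : Measure Ω) [IsProbabilityMeasure P]
  (H G : Type*)
  [NormedAddCommGroup H] [InnerProductSpace ℂ H] [CompleteSpace H]
  [NormedAddCommGroup G] [InnerProductSpace ℂ G] [CompleteSpace G]

/-- The space `ℳ(Ω, H)` of centered random variables in the Bochner space `L²(Ω, H)`, with the
module action `T • X = T X` of the bounded operators on `H`. -/
def Centered : Submodule (H →L[ℂ] H) (Lp H 2 P) where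
  carrier := {X | ∫ ω, X ω ∂P = 0}
  zero_mem' := by
    change ∫ ω, (0 : Lp H 2 P) ω ∂P = 0
    rw [integral_congr_ae (Lp.coeFn_zero H 2 P)]
    simp
  add_mem' {X Y} hX hY := by
    change ∫ ω, (X + Y) ω ∂P = 0
    rw [integral_congr_ae (Lp.coeFn_add X Y)]
    change ∫ ω, X ω + Y ω ∂P = 0
    rw [integral_add ((Lp.memLp X).integrable (by norm_num))
      ((Lp.memLp Y).integrable (by norm_num)), hX, hY, add_zero]
  smul_mem' T X hX := by
    change ∫ ω, (T • X) ω ∂P = 0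
    rw [integral_congr_ae (Lp.coeFn_smul T X)]
    change ∫ ω, T (X ω) ∂P = 0
    rw [T.integral_comp_comm ((Lp.memLp X).integrable (by norm_num)), hX, map_zero]

variable {P H G}

namespace Centered

/-- `T X` for `X` in `ℳ(Ω, H)` and `T` a bounded operator from `H` to `G`. -/
def map (T : H →L[ℂ] G) (X : Centered P H) : Centered P G :=
  ⟨T.compLp X.1, by
    change ∫ ω, (T.compLp X.1) ω ∂P = 0
    rw [integral_congr_ae (T.coeFn_compLp X.1)]
    have hX : ∫ ω, X.1 ω ∂P = 0 := X.2
    rw [T.integral_comp_comm ((Lp.memLp X.1).integrable (by norm_num)), hX, map_zero]⟩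

/-- The covariance operator `𝔼[X ⊗ Y]` of two centered random variables. -/
def cov (X Y : Centered P H) : TraceClass H H := ∫ ω, TraceClass.rankOne (X.1 ω) (Y.1 ω) ∂P

lemma memLp_rankOne (X Y : Lp H 2 P) :
    MemLp (fun ω => TraceClass.rankOne (X ω) (Y ω)) 1 P := by
  refine MemLp.of_bilin (p := 2) (q := 2) (fun x y => TraceClass.rankOne x y) 1 (Lp.memLp X)
    (Lp.memLp Y) ?_ ?_
  · exact TraceClass.aestronglyMeasurable_rankOne (Lp.aestronglyMeasurable X)
      (Lp.aestronglyMeasurable Y)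
  · filter_upwards with ω
    rw [one_mul]
    exact TraceClass.norm_rankOne_le _ _

lemma integrable_rankOne (X Y : Lp H 2 P) :
    Integrable (fun ω => TraceClass.rankOne (X ω) (Y ω)) P :=
  memLp_one_iff_integrable.1 (memLp_rankOne X Y)

/-- The covariance operator is characterized by
`⟪x, cov X Y y⟫ = 𝔼[⟪x, X⟫ * conj ⟪y, Y⟫]`. -/
lemma inner_cov (X Y : Centered P H) (x y : H) :
    ⟪x, (cov X Y).toCLM y⟫_ℂ = ∫ ω, ⟪x, X.1 ω⟫_ℂ * (starRingEnd ℂ) ⟪y, Y.1 ω⟫_ℂ ∂P := by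
  rw [cov, TraceClass.inner_integral (integrable_rankOne X.1 Y.1)]
  refine integral_congr_ae (Eventually.of_forall fun ω => ?_)
  simp only [TraceClass.toCLM_rankOne, InnerProductSpace.rankOne_apply, inner_smul_right,
    inner_conj_symm]
  ring

lemma inner_cov_self (X : Centered P H) (x : H) :
    ⟪x, (cov X X).toCLM x⟫_ℂ = ((∫ ω, ‖⟪x, X.1 ω⟫_ℂ‖ ^ 2 ∂P : ℝ) : ℂ) := by
  rw [inner_cov, ← integral_complex_ofReal]
  refine integral_congr_ae (Eventually.of_forall fun ω => ?_)
  simp only [RCLike.mul_conj]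
  norm_cast

lemma cov_add_left (X X' Y : Centered P H) : cov (X + X') Y = cov X Y + cov X' Y := by
  unfold cov
  rw [← integral_add (integrable_rankOne X.1 Y.1) (integrable_rankOne X'.1 Y.1)]
  refine integral_congr_ae ?_
  filter_upwards [Lp.coeFn_add X.1 X'.1] with ω hω
  have : (X + X').1 ω = X.1 ω + X'.1 ω := hω
  rw [this, TraceClass.rankOne_add_left]

lemma norm_cov_le (X Y : Centered P H) : ‖cov X Y‖ ≤ ‖Y‖ * ‖X‖ := by
  have h : ‖cov X Y‖ₑ ≤ ‖X‖ₑ * ‖Y‖ₑ := by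
    refine (enorm_integral_le_lintegral_enorm _).trans ?_
    rw [← eLpNorm_one_eq_lintegral_enorm]
    refine (eLpNorm_le_eLpNorm_mul_eLpNorm_of_nnnorm (p := 2) (q := 2)
      (Lp.aestronglyMeasurable X.1) (Lp.aestronglyMeasurable Y.1)
      (fun x y => TraceClass.rankOne x y) 1 ?_).trans ?_
    · filter_upwards with ω
      rw [one_mul]
      exact TraceClass.norm_rankOne_le _ _
    · rw [ENNReal.coe_one, one_mul, ← Lp.enorm_def, ← Lp.enorm_def]
      rfl
  have h2 := ENNReal.toReal_mono (ENNReal.mul_ne_top (by simp) (by simp)) h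
  rw [mul_comm]
  simpa using h2

lemma cov_smul_left (T : H →L[ℂ] H) (X Y : Centered P H) :
    (cov (T • X) Y).toCLM = T ∘L (cov X Y).toCLM := by
  refine ContinuousLinearMap.ext fun y => ext_inner_left ℂ fun x => ?_
  rw [ContinuousLinearMap.comp_apply, inner_cov, ← ContinuousLinearMap.adjoint_inner_left T,
    inner_cov]
  refine integral_congr_ae ?_
  filter_upwards [Lp.coeFn_smul T X.1] with ω hω
  have : (T • X).1 ω = T (X.1 ω) := hω
  rw [this, ContinuousLinearMap.adjoint_inner_left]

/-- Covariance against a fixed random variable, as a continuous additive map. -/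
def covLeft (Y : Centered P H) : Centered P H →+ TraceClass H H :=
  AddMonoidHom.mk' (fun X => cov X Y) fun X X' => cov_add_left X X' Y

lemma continuous_covLeft (Y : Centered P H) : Continuous (covLeft Y) :=
  AddMonoidHomClass.continuous_of_bound (covLeft Y) ‖Y‖ fun X => norm_cov_le X Y

lemma cov_adjoint (X Y : Centered P H) : (cov Y X).toCLM = adjoint (cov X Y).toCLM := by
  refine ContinuousLinearMap.ext fun y => ext_inner_left ℂ fun x => ?_
  rw [ContinuousLinearMap.adjoint_inner_right, inner_cov, ← inner_conj_symm, inner_cov,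
    ← integral_conj]
  refine integral_congr_ae (Eventually.of_forall fun ω => ?_)
  simp only [map_mul, Complex.conj_conj]
  ring

lemma isGramian_cov [TopologicalSpace.SeparableSpace H] :
    IsGramian (cov : Centered P H → Centered P H → TraceClass H H) where
  self_isPositive X := by
    refine isPositive_of_inner _ fun x => ?_
    rw [inner_cov_self]
    exact_mod_cast integral_nonneg fun _ => by positivity
  self_eq_zero X := by
    constructor
    · intro h
      have := UniformSpace.secondCountable_of_separable H
      refine Subtype.ext (Lp.eq_zero_iff_ae_eq_zero.2 ?_)
      refine ae_eq_zero_of_forall_inner (𝕜 := ℂ) fun x => ?_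
      have h1 := inner_cov_self X x
      rw [h, TraceClass.toCLM_zero, zero_apply, inner_zero_right] at h1
      have h2 : ∫ ω, ‖⟪x, X.1 ω⟫_ℂ‖ ^ 2 ∂P = 0 := by exact_mod_cast h1.symm
      rw [integral_eq_zero_iff_of_nonneg (fun _ => by positivity)
        ((Lp.memLp X.1).const_inner x).integrable_norm_pow'] at h2
      filter_upwards [h2] with ω hω
      simpa using hω
    · rintro rfl
      exact map_zero (covLeft (0 : Centered P H))
  add_smul_left X Y Z T := by
    rw [cov_add_left, TraceClass.toCLM_add, cov_smul_left]
  adjoint_eq := cov_adjoint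

/-- The Gramian of `ℳ(Ω, H)` is the covariance operator. -/
instance [TopologicalSpace.SeparableSpace H] : NormalPreHilbertModule H (Centered P H) where
  gram := cov
  isGramian := isGramian_cov

end Centered

end Centered

/-! ### Trace-class operator measures and c.a.g.o.s. measures -/

section Measures

open ContinuousLinearMap (adjoint)

variable {Λ Ω : Type*} [MeasurableSpace Λ] [MeasurableSpace Ω]

/-- A trace-class positive operator valued measure, as a measure with values in the Banach space
of trace-class operators (for positive operators, weak σ-additivity and σ-additivity in the
trace norm are the same). -/
structure TraceClassPOVM (Λ H : Type*) [MeasurableSpace Λ] [NormedAddCommGroup H]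
    [InnerProductSpace ℂ H] [CompleteSpace H] where
  toVectorMeasure : VectorMeasure Λ (TraceClass H H)
  isPositive : ∀ A, (toVectorMeasure A).toCLM.IsPositive

/-- An `H`-valued random countably additive Gramian-orthogonally scattered measure. -/
structure RandomCAGOS (Λ : Type*) [MeasurableSpace Λ] (P : Measure Ω) [IsProbabilityMeasure P]
    (H : Type*) [NormedAddCommGroup H] [InnerProductSpace ℂ H] [CompleteSpace H]
    [TopologicalSpace.SeparableSpace H] where
  toVectorMeasure : VectorMeasure Λ (Centered P H)
  gram_eq_zero : ∀ A B, MeasurableSet A → MeasurableSet B → Disjoint A B →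
    NormalPreHilbertModule.gram (K := H) (toVectorMeasure A) (toVectorMeasure B) = 0

variable {P : Measure Ω} [IsProbabilityMeasure P] {H G : Type*}
  [NormedAddCommGroup H] [InnerProductSpace ℂ H] [CompleteSpace H]
  [TopologicalSpace.SeparableSpace H]
  [NormedAddCommGroup G] [InnerProductSpace ℂ G] [CompleteSpace G]
  [TopologicalSpace.SeparableSpace G]

instance : CoeFun (RandomCAGOS Λ P H) fun _ => Set Λ → Centered P H :=
  ⟨fun W => W.toVectorMeasure⟩

lemma RandomCAGOS.cov_eq_of_subset (W : RandomCAGOS Λ P H) {A B : Set Λ} (hA : MeasurableSet A)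
    (hB : MeasurableSet B) (h : A ⊆ B) : Centered.cov (W A) (W B) = Centered.cov (W A) (W A) := by
  have h1 : W.toVectorMeasure B = W.toVectorMeasure A + W.toVectorMeasure (B \ A) := by
    rw [← VectorMeasure.of_union Set.disjoint_sdiff_right hA (hB.diff hA),
      Set.union_sdiff_cancel h]
  have h2 : Centered.cov (W (B \ A)) (W A) = 0 :=
    W.gram_eq_zero _ _ (hB.diff hA) hA Set.disjoint_sdiff_left
  refine TraceClass.toCLM_injective ?_
  rw [Centered.cov_adjoint, h1, Centered.cov_add_left, h2, add_zero, ← Centered.cov_adjoint]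

/-- The intensity operator measure `A ↦ [W A, W A]` of `W`. -/
def RandomCAGOS.intensity (W : RandomCAGOS Λ P H) : TraceClassPOVM Λ H where
  toVectorMeasure :=
    { measureOf' := fun A => NormalPreHilbertModule.gram (K := H) (W A) (W A)
      empty' := by
        rw [W.toVectorMeasure.empty]
        exact (NormalPreHilbertModule.isGramian.self_eq_zero _).2 rfl
      not_measurable' := fun A hA => by
        rw [W.toVectorMeasure.not_measurable hA]
        exact (NormalPreHilbertModule.isGramian.self_eq_zero _).2 rfl
      m_iUnion' := fun f hf hd => by
        have h1 := (W.toVectorMeasure.m_iUnion hf hd).map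
          (Centered.covLeft (W (⋃ i, f i))) (Centered.continuous_covLeft _)
        have h2 : (fun i => Centered.cov (W (f i)) (W (f i))) =
            Centered.covLeft (W (⋃ i, f i)) ∘ fun i => W (f i) :=
          funext fun i => (W.cov_eq_of_subset (hf i) (MeasurableSet.iUnion hf)
            (Set.subset_iUnion f i)).symm
        change HasSum (fun i => Centered.cov (W (f i)) (W (f i))) _
        rw [h2]
        exact h1 }
  isPositive A := NormalPreHilbertModule.isGramian.self_isPositive (W A)

/-- The closed linear span of `{T (W A)}` in `ℳ(Ω, G)`, where `A` ranges over the measurable sets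
and `T` over the bounded operators from `H` to `G`; it is a submodule of `ℳ(Ω, G)`. -/
def RandomCAGOS.range (W : RandomCAGOS Λ P H) (G : Type*) [NormedAddCommGroup G]
    [InnerProductSpace ℂ G] [CompleteSpace G] : Submodule (G →L[ℂ] G) (Centered P G) :=
  let V : Submodule ℂ (Centered P G) :=
    (Submodule.span ℂ {X | ∃ (T : H →L[ℂ] G) (A : Set Λ), MeasurableSet A ∧
      X = Centered.map T (W A)}).topologicalClosure
  { carrier := V
    zero_mem' := V.zero_mem
    add_mem' := V.add_mem
    smul_mem' := fun S X hX => by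
      refine map_mem_closure (f := fun Y : Centered P G => S • Y) (continuous_const_smul S) hX
        fun Y hY => ?_
      change S • Y ∈ Submodule.span ℂ _
      induction hY using Submodule.span_induction with
      | mem Y hY =>
        obtain ⟨T, A, hA, rfl⟩ := hY
        refine Submodule.subset_span ⟨S ∘L T, A, hA, ?_⟩
        refine Subtype.ext (Lp.ext ?_)
        have h1 := Lp.coeFn_smul S (T.compLp (W A).1)
        have h2 := T.coeFn_compLp (W A).1
        have h3 := (S ∘L T).coeFn_compLp (W A).1
        filter_upwards [h1, h2, h3] with ω h1 h2 h3
        refine h1.trans (Eq.trans ?_ h3.symm)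
        rw [Pi.smul_apply, h2]
        rfl
      | zero => rw [smul_zero]; exact Submodule.zero_mem _
      | add Y Z _ _ hY hZ => rw [smul_add]; exact Submodule.add_mem _ hY hZ
      | smul c Y _ hY =>
        have h : S • c • Y = c • S • Y := by
          refine Subtype.ext ?_
          exact smul_comm S c (Y : Lp G 2 P)
        rw [h]
        exact Submodule.smul_mem _ c hY }

namespace TraceClassPOVM

/-- The variation measure `‖ν‖₁` with respect to the trace norm. -/
def variation (ν : TraceClassPOVM Λ H) : Measure Λ := ν.toVectorMeasure.variation

/-- `f` is a (positive version of the) density of `ν` with respect to its variation measure. -/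
structure IsDensity (ν : TraceClassPOVM Λ H) (f : Λ → TraceClass H H) : Prop where
  integrable : Integrable f ν.variation
  isPositive : ∀ l, (f l).toCLM.IsPositive
  eq_integral : ∀ A, MeasurableSet A → ν.toVectorMeasure A = ∫ l in A, f l ∂ν.variation

/-- The density of `ν` with respect to its variation measure. -/
def density (ν : TraceClassPOVM Λ H) : Λ → TraceClass H H :=
  open Classical in if h : ∃ f, ν.IsDensity f then h.choose else 0

/-- The positive square root of the density of `ν`. -/
def sqrtDensity (ν : TraceClassPOVM Λ H) (l : Λ) : H →L[ℂ] H := CFC.sqrt (ν.density l).toCLM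

lemma integrable_density (ν : TraceClassPOVM Λ H) : Integrable ν.density ν.variation := by
  unfold density
  split_ifs with h
  · exact h.choose_spec.integrable
  · exact integrable_zero _ _ _

lemma density_isPositive (ν : TraceClassPOVM Λ H) (l : Λ) : (ν.density l).toCLM.IsPositive := by
  unfold density
  split_ifs with h
  · exact h.choose_spec.isPositive l
  · exact ContinuousLinearMap.isPositive_zero

lemma sqrtDensity_comp_adjoint (ν : TraceClassPOVM Λ H) (l : Λ) :
    ν.sqrtDensity l ∘L adjoint (ν.sqrtDensity l) = (ν.density l).toCLM := by
  have h0 : 0 ≤ (ν.density l).toCLM :=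
    (ContinuousLinearMap.nonneg_iff_isPositive _).2 (ν.density_isPositive l)
  have h1 : adjoint (ν.sqrtDensity l) = ν.sqrtDensity l :=
    (IsSelfAdjoint.of_nonneg (CFC.sqrt_nonneg _)).star_eq
  rw [h1]
  exact CFC.sqrt_mul_sqrt_self _ h0

lemma hsNormSq_sqrtDensity_le (ν : TraceClassPOVM Λ H) (l : Λ) :
    hsNormSq (ν.sqrtDensity l) ≤ ‖ν.density l‖ₑ := by
  refine (hsNormSq_le_traceNorm _).trans ?_
  rw [sqrtDensity_comp_adjoint, TraceClass.traceNorm_toCLM]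

lemma aestronglyMeasurable_sqrtDensity (ν : TraceClassPOVM Λ H) :
    AEStronglyMeasurable ν.sqrtDensity ν.variation := by
  have h1 : AEStronglyMeasurable (fun l => (ν.density l).toCLM) ν.variation :=
    TraceClass.toCLML.continuous.comp_aestronglyMeasurable ν.integrable_density.1
  have h2 : Continuous fun T : H →L[ℂ] H => CFC.sqrt (CFC.abs T) :=
    CFC.continuousOn_sqrt.comp_continuous CFC.continuous_abs fun T => CFC.abs_nonneg T
  refine (h2.comp_aestronglyMeasurable h1).congr (Eventually.of_forall fun l => ?_)
  have h0 : 0 ≤ (ν.density l).toCLM :=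
    (ContinuousLinearMap.nonneg_iff_isPositive _).2 (ν.density_isPositive l)
  simp only [sqrtDensity, CFC.abs_of_nonneg _ h0]

end TraceClassPOVM

end Measures

/-! ### Square-integrable functions valued in unbounded operators -/

section SquareIntegrable

open ContinuousLinearMap (adjoint)

variable {Λ : Type*} [MeasurableSpace Λ] {H G I : Type*}
  [NormedAddCommGroup H] [InnerProductSpace ℂ H] [CompleteSpace H]
  [TopologicalSpace.SeparableSpace H]
  [NormedAddCommGroup G] [InnerProductSpace ℂ G] [CompleteSpace G]
  [TopologicalSpace.SeparableSpace G]
  [NormedAddCommGroup I] [InnerProductSpace ℂ I] [CompleteSpace I]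
  [TopologicalSpace.SeparableSpace I]

/-- A function with values in the linear operators with a domain is `𝒪`-measurable if the sets
`{l | x ∈ 𝒟(Φ l)}` are measurable and `Φ` is the pointwise limit, on its domains, of a sequence of
simply measurable functions with values in the bounded operators. -/
structure OMeasurable (Φ : Λ → H →ₗ.[ℂ] G) : Prop where
  measurableSet_domain : ∀ x : H, MeasurableSet {l | x ∈ (Φ l).domain}
  exists_approx : ∃ Φn : ℕ → Λ → H →L[ℂ] G,
    (∀ n x, StronglyMeasurable fun l => Φn n l x) ∧
    ∀ l (x : (Φ l).domain), Tendsto (fun n => Φn n l x) atTop (𝓝 (Φ l x))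

/-- The bounded operator `T` is the product `A R`, where the range of `R` lies in the domain
of `A`. -/
def IsComp (A : H →ₗ.[ℂ] G) (R : H →L[ℂ] H) (T : H →L[ℂ] G) : Prop :=
  ∀ x, ∃ hx : R x ∈ A.domain, A ⟨R x, hx⟩ = T x

/-- The product `A R`, if it is an everywhere defined bounded operator (and `0` otherwise). -/
def comp (A : H →ₗ.[ℂ] G) (R : H →L[ℂ] H) : H →L[ℂ] G :=
  open Classical in if h : ∃ T, IsComp A R T then h.choose else 0

lemma IsComp.comp_eq {A : H →ₗ.[ℂ] G} {R : H →L[ℂ] H} {T : H →L[ℂ] G} (h : IsComp A R T) :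
    comp A R = T := by
  have h' : ∃ T, IsComp A R T := ⟨T, h⟩
  unfold comp
  rw [dif_pos h']
  ext x
  obtain ⟨_, h1⟩ := h'.choose_spec x
  obtain ⟨_, h2⟩ := h x
  rw [← h1, h2]

lemma IsComp.add {A B : H →ₗ.[ℂ] G} {R : H →L[ℂ] H} {S T : H →L[ℂ] G} (hA : IsComp A R S)
    (hB : IsComp B R T) : IsComp (A + B) R (S + T) := fun x => by
  obtain ⟨h1, h1'⟩ := hA x
  obtain ⟨h2, h2'⟩ := hB x
  refine ⟨⟨h1, h2⟩, ?_⟩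
  rw [LinearPMap.add_apply, add_apply, ← h1', ← h2']

lemma IsComp.neg {A : H →ₗ.[ℂ] G} {R : H →L[ℂ] H} {T : H →L[ℂ] G} (hA : IsComp A R T) :
    IsComp (-A) R (-T) := fun x => by
  obtain ⟨h1, h1'⟩ := hA x
  refine ⟨h1, ?_⟩
  rw [LinearPMap.neg_apply, neg_apply, ← h1']

lemma IsComp.zero (R : H →L[ℂ] H) : IsComp (0 : H →ₗ.[ℂ] G) R 0 := fun _ =>
  ⟨Submodule.mem_top, rfl⟩

lemma IsComp.smul (S : G →L[ℂ] G) {A : H →ₗ.[ℂ] G} {R : H →L[ℂ] H} {T : H →L[ℂ] G}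
    (hA : IsComp A R T) : IsComp (S • A) R (S ∘L T) := fun x => by
  obtain ⟨h1, h1'⟩ := hA x
  refine ⟨h1, ?_⟩
  rw [LinearPMap.smul_apply, ContinuousLinearMap.comp_apply, ← h1']
  rfl

namespace TraceClassPOVM

variable (ν : TraceClassPOVM Λ H)

/-- The pair `(Φ, Ψ)` is `ν`-integrable: with `f` the density of `ν` with respect to its variation
measure, the range of `f ^ (1/2)` lies almost everywhere in the domains, `Φ f ^ (1/2)` and
`Ψ f ^ (1/2)` are almost everywhere Hilbert-Schmidt operators, and
`(Φ f ^ (1/2)) (Ψ f ^ (1/2))ᴴ` is integrable as a function with values in the trace class. -/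
structure IsIntegrablePair (Φ : Λ → H →ₗ.[ℂ] G) (Ψ : Λ → H →ₗ.[ℂ] I) : Prop where
  oMeasurable_left : OMeasurable Φ
  oMeasurable_right : OMeasurable Ψ
  range_left : ∀ᵐ l ∂ν.variation, ∀ x, ν.sqrtDensity l x ∈ (Φ l).domain
  range_right : ∀ᵐ l ∂ν.variation, ∀ x, ν.sqrtDensity l x ∈ (Ψ l).domain
  hilbertSchmidt_left : ∀ᵐ l ∂ν.variation, ∃ T : H →L[ℂ] G,
    IsComp (Φ l) (ν.sqrtDensity l) T ∧ IsHilbertSchmidt T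
  hilbertSchmidt_right : ∀ᵐ l ∂ν.variation, ∃ T : H →L[ℂ] I,
    IsComp (Ψ l) (ν.sqrtDensity l) T ∧ IsHilbertSchmidt T
  integrable : Integrable (fun l => TraceClass.ofCLM
    (comp (Φ l) (ν.sqrtDensity l) ∘L adjoint (comp (Ψ l) (ν.sqrtDensity l)))) ν.variation

/-- The integral `∫ Φ dν Ψᴴ` of a `ν`-integrable pair `(Φ, Ψ)`. -/
def pairIntegral (Φ : Λ → H →ₗ.[ℂ] G) (Ψ : Λ → H →ₗ.[ℂ] I) : TraceClass I G :=
  ∫ l, TraceClass.ofCLM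
    (comp (Φ l) (ν.sqrtDensity l) ∘L adjoint (comp (Ψ l) (ν.sqrtDensity l))) ∂ν.variation

/-- `Φ` is square `ν`-integrable. -/
def SqIntegrable (Φ : Λ → H →ₗ.[ℂ] G) : Prop := ν.IsIntegrablePair Φ Φ

variable {ν}

lemma SqIntegrable.ae_comp {Φ : Λ → H →ₗ.[ℂ] G} (hΦ : ν.SqIntegrable Φ) :
    ∀ᵐ l ∂ν.variation, IsComp (Φ l) (ν.sqrtDensity l) (comp (Φ l) (ν.sqrtDensity l)) ∧
      IsHilbertSchmidt (comp (Φ l) (ν.sqrtDensity l)) := by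
  filter_upwards [hΦ.hilbertSchmidt_left] with l hl
  obtain ⟨T, h1, h2⟩ := hl
  rw [h1.comp_eq]
  exact ⟨h1, h2⟩

lemma aestronglyMeasurable_comp {Φ : Λ → H →ₗ.[ℂ] G} (hm : OMeasurable Φ)
    (h : ∀ᵐ l ∂ν.variation,
      IsComp (Φ l) (ν.sqrtDensity l) (comp (Φ l) (ν.sqrtDensity l))) (x : H) :
    AEStronglyMeasurable (fun l => comp (Φ l) (ν.sqrtDensity l) x) ν.variation := by
  obtain ⟨Φn, hΦn, hlim⟩ := hm.exists_approx
  have hR : AEStronglyMeasurable (fun l => ν.sqrtDensity l x) ν.variation :=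
    (ContinuousLinearMap.apply ℂ H x).continuous.comp_aestronglyMeasurable
      ν.aestronglyMeasurable_sqrtDensity
  have hn : ∀ n, AEStronglyMeasurable (fun l => Φn n l (ν.sqrtDensity l x)) ν.variation := by
    intro n
    have hs : ∀ s : SimpleFunc Λ H, StronglyMeasurable fun l => Φn n l (s l) := by
      intro s
      induction s using SimpleFunc.induction' with
      | const c => exact hΦn n c
      | @pcw f g A hA hf hg =>
        classical
        have h1 : (fun l => Φn n l (f.piecewise A hA g l)) =
            fun l => if l ∈ A then Φn n l (f l) else Φn n l (g l) := by
          funext l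
          by_cases hl : l ∈ A <;> simp [hl]
        rw [h1]
        exact hf.ite hA hg
    refine (AEStronglyMeasurable.congr ?_ (f := fun l => Φn n l (hR.mk _ l)) ?_)
    · refine StronglyMeasurable.aestronglyMeasurable ?_
      refine stronglyMeasurable_of_tendsto atTop
        (fun k => hs (hR.stronglyMeasurable_mk.approx k)) (tendsto_pi_nhds.2 fun l => ?_)
      exact ((Φn n l).continuous.tendsto _).comp (hR.stronglyMeasurable_mk.tendsto_approx l)
    · filter_upwards [hR.ae_eq_mk] with l hl
      rw [← hl]
  refine aestronglyMeasurable_of_tendsto_ae atTop hn ?_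
  filter_upwards [h] with l hl
  obtain ⟨h1, h2⟩ := hl x
  rw [← h2]
  exact hlim l ⟨_, h1⟩

lemma aestronglyMeasurable_ofCLM {μ : Measure Λ} {T : Λ → H →L[ℂ] G} {S : Λ → H →L[ℂ] I}
    (hT : ∀ x, AEStronglyMeasurable (fun l => T l x) μ)
    (hS : ∀ x, AEStronglyMeasurable (fun l => S l x) μ)
    (hT' : ∀ᵐ l ∂μ, IsHilbertSchmidt (T l)) (hS' : ∀ᵐ l ∂μ, IsHilbertSchmidt (S l)) :
    AEStronglyMeasurable (fun l => TraceClass.ofCLM (T l ∘L adjoint (S l))) μ := by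
  obtain ⟨w, b, hw⟩ := exists_countable_hilbertBasis H
  have : Countable w := hw
  refine aestronglyMeasurable_of_tendsto_ae atTop
    (f := fun (s : Finset w) l => ∑ k ∈ s, TraceClass.rankOne (T l (b k)) (S l (b k))) ?_ ?_
  · intro s
    exact Finset.aestronglyMeasurable_fun_sum _ fun k _ =>
      TraceClass.aestronglyMeasurable_rankOne (hT (b k)) (hS (b k))
  · filter_upwards [hT', hS'] with l h1 h2
    exact h1.hasSum_rankOne h2 b

lemma SqIntegrable.hsNormSq_le {Φ : Λ → H →ₗ.[ℂ] G} (hΦ : ν.SqIntegrable Φ) :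
    ∀ᵐ l ∂ν.variation, hsNormSq (comp (Φ l) (ν.sqrtDensity l)) ≤ ‖TraceClass.ofCLM
      (comp (Φ l) (ν.sqrtDensity l) ∘L adjoint (comp (Φ l) (ν.sqrtDensity l)))‖ₑ := by
  filter_upwards [hΦ.ae_comp] with l hl
  refine (hsNormSq_le_traceNorm _).trans ?_
  rw [← TraceClass.traceNorm_toCLM, TraceClass.toCLM_ofCLM (traceNorm_comp_adjoint_ne_top hl.2 hl.2)]

/-- A criterion for integrability of a pair of functions. -/
lemma isIntegrablePair_of_le {Φ : Λ → H →ₗ.[ℂ] G} {Ψ : Λ → H →ₗ.[ℂ] I} (hΦ : OMeasurable Φ)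
    (hΨ : OMeasurable Ψ)
    (hT : ∀ᵐ l ∂ν.variation, IsComp (Φ l) (ν.sqrtDensity l) (comp (Φ l) (ν.sqrtDensity l)))
    (hS : ∀ᵐ l ∂ν.variation, IsComp (Ψ l) (ν.sqrtDensity l) (comp (Ψ l) (ν.sqrtDensity l)))
    {h : Λ → ℝ} (hh : Integrable h ν.variation)
    (hle : ∀ᵐ l ∂ν.variation, hsNormSq (comp (Φ l) (ν.sqrtDensity l)) +
      hsNormSq (comp (Ψ l) (ν.sqrtDensity l)) ≤ ENNReal.ofReal (h l)) :
    ν.IsIntegrablePair Φ Ψ := by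
  have hT' : ∀ᵐ l ∂ν.variation, IsHilbertSchmidt (comp (Φ l) (ν.sqrtDensity l)) :=
    hle.mono fun l hl => ne_top_of_le_ne_top ENNReal.ofReal_ne_top (le_self_add.trans hl)
  have hS' : ∀ᵐ l ∂ν.variation, IsHilbertSchmidt (comp (Ψ l) (ν.sqrtDensity l)) :=
    hle.mono fun l hl => ne_top_of_le_ne_top ENNReal.ofReal_ne_top (le_add_self.trans hl)
  refine ⟨hΦ, hΨ, hT.mono fun l hl x => (hl x).1, hS.mono fun l hl x => (hl x).1,
    (hT.and hT').mono fun l hl => ⟨_, hl⟩, (hS.and hS').mono fun l hl => ⟨_, hl⟩,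
    hh.norm.mono' ?_ ?_⟩
  · exact aestronglyMeasurable_ofCLM (aestronglyMeasurable_comp hΦ hT)
      (aestronglyMeasurable_comp hΨ hS) hT' hS'
  · filter_upwards [hT', hS', hle] with l h1 h2 h3
    have h4 := (traceNorm_comp_adjoint_le _ _).trans h3
    rw [← TraceClass.toCLM_ofCLM (traceNorm_comp_adjoint_ne_top h1 h2),
      TraceClass.traceNorm_toCLM, ← ofReal_norm] at h4
    have h5 := ENNReal.toReal_mono ENNReal.ofReal_ne_top h4
    rw [ENNReal.toReal_ofReal (norm_nonneg _), ENNReal.toReal_ofReal'] at h5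
    exact h5.trans (max_le (le_abs_self _) (abs_nonneg _))

/-- Any two square integrable functions form an integrable pair. -/
lemma SqIntegrable.isIntegrablePair {Φ : Λ → H →ₗ.[ℂ] G} {Ψ : Λ → H →ₗ.[ℂ] I}
    (hΦ : ν.SqIntegrable Φ) (hΨ : ν.SqIntegrable Ψ) : ν.IsIntegrablePair Φ Ψ := by
  refine isIntegrablePair_of_le hΦ.oMeasurable_left hΨ.oMeasurable_left
    (hΦ.ae_comp.mono fun _ h => h.1) (hΨ.ae_comp.mono fun _ h => h.1)
    (hΦ.integrable.norm.add hΨ.integrable.norm) ?_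
  filter_upwards [hΦ.hsNormSq_le, hΨ.hsNormSq_le] with l h1 h2
  rw [Pi.add_apply, ENNReal.ofReal_add (norm_nonneg _) (norm_nonneg _), ofReal_norm, ofReal_norm]
  exact add_le_add h1 h2

lemma SqIntegrable.add {Φ Ψ : Λ → H →ₗ.[ℂ] G} (hΦ : ν.SqIntegrable Φ) (hΨ : ν.SqIntegrable Ψ) :
    ν.SqIntegrable fun l => Φ l + Ψ l := by
  have hm : OMeasurable fun l => Φ l + Ψ l := by
    obtain ⟨Φn, h1, h2⟩ := hΦ.oMeasurable_left.exists_approx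
    obtain ⟨Ψn, h3, h4⟩ := hΨ.oMeasurable_left.exists_approx
    refine ⟨fun x => (hΦ.oMeasurable_left.measurableSet_domain x).inter
      (hΨ.oMeasurable_left.measurableSet_domain x), fun n l => Φn n l + Ψn n l,
      fun n x => (h1 n x).add (h3 n x), fun l x => ?_⟩
    rw [LinearPMap.add_apply]
    exact (h2 l ⟨x, x.2.1⟩).add (h4 l ⟨x, x.2.2⟩)
  have hc : ∀ᵐ l ∂ν.variation, IsComp (Φ l + Ψ l) (ν.sqrtDensity l)
      (comp (Φ l) (ν.sqrtDensity l) + comp (Ψ l) (ν.sqrtDensity l)) := by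
    filter_upwards [hΦ.ae_comp, hΨ.ae_comp] with l h1 h2 using h1.1.add h2.1
  have hc' := hc.mono fun l hl => hl.comp_eq.symm ▸ hl
  refine isIntegrablePair_of_le hm hm hc' hc'
    ((hΦ.integrable.norm.add hΨ.integrable.norm).const_mul 4) ?_
  filter_upwards [hc, hΦ.hsNormSq_le, hΨ.hsNormSq_le] with l h0 h1 h2
  rw [h0.comp_eq, Pi.add_apply, ENNReal.ofReal_mul (by norm_num),
    ENNReal.ofReal_add (norm_nonneg _) (norm_nonneg _), ofReal_norm, ofReal_norm]
  have h3 := (hsNormSq_add_le (comp (Φ l) (ν.sqrtDensity l)) (comp (Ψ l) (ν.sqrtDensity l))).trans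
    (add_le_add (mul_le_mul_right h1 2) (mul_le_mul_right h2 2))
  refine (add_le_add h3 h3).trans (le_of_eq ?_)
  rw [show ENNReal.ofReal 4 = 4 by norm_num]
  ring

lemma SqIntegrable.smul (S : G →L[ℂ] G) {Φ : Λ → H →ₗ.[ℂ] G} (hΦ : ν.SqIntegrable Φ) :
    ν.SqIntegrable fun l => S • Φ l := by
  have hm : OMeasurable fun l => S • Φ l := by
    obtain ⟨Φn, h1, h2⟩ := hΦ.oMeasurable_left.exists_approx
    refine ⟨fun x => hΦ.oMeasurable_left.measurableSet_domain x, fun n l => S ∘L Φn n l,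
      fun n x => S.continuous.comp_stronglyMeasurable (h1 n x), fun l x => ?_⟩
    exact (S.continuous.tendsto _).comp (h2 l x)
  have hc : ∀ᵐ l ∂ν.variation, IsComp (S • Φ l) (ν.sqrtDensity l)
      (S ∘L comp (Φ l) (ν.sqrtDensity l)) := by
    filter_upwards [hΦ.ae_comp] with l h1 using h1.1.smul S
  have hc' := hc.mono fun l hl => hl.comp_eq.symm ▸ hl
  refine isIntegrablePair_of_le hm hm hc' hc' (hΦ.integrable.norm.const_mul (2 * ‖S‖ ^ 2)) ?_
  filter_upwards [hc, hΦ.hsNormSq_le] with l h0 h1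
  rw [h0.comp_eq, ENNReal.ofReal_mul (by positivity), ENNReal.ofReal_mul (by norm_num),
    ENNReal.ofReal_pow (norm_nonneg _), ofReal_norm, ofReal_norm]
  have h3 := (hsNormSq_comp_le S (comp (Φ l) (ν.sqrtDensity l))).trans (mul_le_mul_right h1 _)
  refine (add_le_add h3 h3).trans (le_of_eq ?_)
  rw [show ENNReal.ofReal 2 = 2 by norm_num]
  ring

lemma SqIntegrable.neg {Φ : Λ → H →ₗ.[ℂ] G} (hΦ : ν.SqIntegrable Φ) :
    ν.SqIntegrable fun l => -Φ l := by
  have hm : OMeasurable fun l => -Φ l := by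
    obtain ⟨Φn, h1, h2⟩ := hΦ.oMeasurable_left.exists_approx
    refine ⟨fun x => hΦ.oMeasurable_left.measurableSet_domain x, fun n l => -Φn n l,
      fun n x => (h1 n x).neg, fun l x => ?_⟩
    exact (h2 l x).neg
  have hc : ∀ᵐ l ∂ν.variation, IsComp (-Φ l) (ν.sqrtDensity l)
      (-comp (Φ l) (ν.sqrtDensity l)) := by
    filter_upwards [hΦ.ae_comp] with l h1 using h1.1.neg
  have hc' := hc.mono fun l hl => hl.comp_eq.symm ▸ hl
  refine isIntegrablePair_of_le hm hm hc' hc' (hΦ.integrable.norm.const_mul 2) ?_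
  filter_upwards [hc, hΦ.hsNormSq_le] with l h0 h1
  rw [h0.comp_eq, hsNormSq_neg, ENNReal.ofReal_mul (by norm_num), ofReal_norm]
  refine (add_le_add h1 h1).trans (le_of_eq ?_)
  rw [show ENNReal.ofReal 2 = 2 by norm_num]
  ring

/-- The function `1_A T`, for a bounded operator `T`. -/
def indicatorFun (A : Set Λ) (T : H →L[ℂ] G) (l : Λ) : H →ₗ.[ℂ] G :=
  open Classical in if l ∈ A then (T : H →ₗ[ℂ] G).toPMap ⊤ else 0

lemma sqIntegrable_indicatorFun {A : Set Λ} (hA : MeasurableSet A) (T : H →L[ℂ] G) :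
    ν.SqIntegrable (indicatorFun A T) := by
  classical
  have e : ∀ l, indicatorFun A T l =
      ((if l ∈ A then T else 0 : H →L[ℂ] G) : H →ₗ[ℂ] G).toPMap ⊤ := by
    intro l
    by_cases hl : l ∈ A
    · rw [if_pos hl]
      exact if_pos hl
    · rw [if_neg hl]
      exact if_neg hl
  have hd : ∀ l, (indicatorFun A T l).domain = ⊤ := fun l => by
    rw [e]
    rfl
  have hv : ∀ l x (hx : x ∈ (indicatorFun A T l).domain),
      indicatorFun A T l ⟨x, hx⟩ = (if l ∈ A then T else 0 : H →L[ℂ] G) x := by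
    intro l
    rw [e]
    intro x hx
    rfl
  have hm : OMeasurable (indicatorFun A T) := by
    refine ⟨fun x => by simp [hd], fun _ l => if l ∈ A then T else 0, fun _ x => ?_, fun l x => ?_⟩
    · have : (fun l => (if l ∈ A then T else 0 : H →L[ℂ] G) x) =
          fun l => if l ∈ A then T x else 0 := by
        funext l
        split_ifs <;> rfl
      rw [this]
      exact stronglyMeasurable_const.ite hA stronglyMeasurable_const
    · have h1 := hv l x x.2
      rw [Subtype.coe_eta] at h1
      rw [h1]
      exact tendsto_const_nhds
  have hc : ∀ l, IsComp (indicatorFun A T l) (ν.sqrtDensity l)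
      ((if l ∈ A then T else 0) ∘L ν.sqrtDensity l) := fun l x =>
    ⟨by rw [hd]; exact Submodule.mem_top, hv l _ _⟩
  have hc' : ∀ᵐ l ∂ν.variation, IsComp (indicatorFun A T l) (ν.sqrtDensity l)
      (comp (indicatorFun A T l) (ν.sqrtDensity l)) :=
    Eventually.of_forall fun l => (hc l).comp_eq.symm ▸ hc l
  refine isIntegrablePair_of_le hm hm hc' hc'
    (ν.integrable_density.norm.const_mul (2 * ‖T‖ ^ 2)) (Eventually.of_forall fun l => ?_)
  rw [(hc l).comp_eq, ENNReal.ofReal_mul (by positivity), ENNReal.ofReal_mul (by norm_num),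
    ENNReal.ofReal_pow (norm_nonneg _), ofReal_norm, ofReal_norm]
  have h3 : hsNormSq ((if l ∈ A then T else 0) ∘L ν.sqrtDensity l) ≤
      ‖T‖ₑ ^ 2 * ‖ν.density l‖ₑ := by
    refine (hsNormSq_comp_le _ _).trans (mul_le_mul' ?_ (ν.hsNormSq_sqrtDensity_le l))
    split_ifs
    · exact le_rfl
    · refine pow_le_pow_left' (enorm_le_iff_norm_le.2 ?_) 2
      rw [norm_zero]
      exact norm_nonneg _
  refine (add_le_add h3 h3).trans (le_of_eq ?_)
  rw [show ENNReal.ofReal 2 = 2 by norm_num]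
  ring

lemma sqIntegrable_zero : ν.SqIntegrable fun _ => (0 : H →ₗ.[ℂ] G) := by
  have h := sqIntegrable_indicatorFun (ν := ν) (G := G) MeasurableSet.empty 0
  have h2 : indicatorFun (∅ : Set Λ) (0 : H →L[ℂ] G) = fun _ => (0 : H →ₗ.[ℂ] G) := by
    funext l
    exact if_neg (Set.notMem_empty l)
  rwa [h2] at h

end TraceClassPOVM

end SquareIntegrable

/-! ### The space `L²` -/

section L2

open ContinuousLinearMap (adjoint)

variable {Λ : Type*} [MeasurableSpace Λ] {H G : Type*}
  [NormedAddCommGroup H] [InnerProductSpace ℂ H] [CompleteSpace H]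
  [TopologicalSpace.SeparableSpace H]
  [NormedAddCommGroup G] [InnerProductSpace ℂ G] [CompleteSpace G]
  [TopologicalSpace.SeparableSpace G]

namespace TraceClassPOVM

variable (ν : TraceClassPOVM Λ H)

/-- The seminorm `‖Φ‖_ν = ‖∫ Φ dν Φᴴ‖₁ ^ (1/2)`. -/
def nuNorm (Φ : Λ → H →ₗ.[ℂ] G) : ℝ := √‖ν.pairIntegral Φ Φ‖

variable {ν}

lemma SqIntegrable.inner_pairIntegral {Φ Ψ : Λ → H →ₗ.[ℂ] G} (hΦ : ν.SqIntegrable Φ)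
    (hΨ : ν.SqIntegrable Ψ) (x y : G) :
    Integrable (fun l => ⟪adjoint (comp (Φ l) (ν.sqrtDensity l)) x,
      adjoint (comp (Ψ l) (ν.sqrtDensity l)) y⟫_ℂ) ν.variation ∧
    ⟪x, (ν.pairIntegral Φ Ψ).toCLM y⟫_ℂ = ∫ l, ⟪adjoint (comp (Φ l) (ν.sqrtDensity l)) x,
      adjoint (comp (Ψ l) (ν.sqrtDensity l)) y⟫_ℂ ∂ν.variation := by
  have hi := (hΦ.isIntegrablePair hΨ).integrable
  have h : ∀ᵐ l ∂ν.variation, ⟪x, (TraceClass.ofCLM (comp (Φ l) (ν.sqrtDensity l) ∘L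
      adjoint (comp (Ψ l) (ν.sqrtDensity l)))).toCLM y⟫_ℂ =
      ⟪adjoint (comp (Φ l) (ν.sqrtDensity l)) x,
        adjoint (comp (Ψ l) (ν.sqrtDensity l)) y⟫_ℂ := by
    filter_upwards [hΦ.ae_comp, hΨ.ae_comp] with l h1 h2
    rw [TraceClass.toCLM_ofCLM (traceNorm_comp_adjoint_ne_top h1.2 h2.2),
      ContinuousLinearMap.comp_apply, ContinuousLinearMap.adjoint_inner_left]
  constructor
  · exact ((TraceClass.coeff x y).integrable_comp hi).congr h
  · exact (TraceClass.inner_integral hi x y).trans (integral_congr_ae h)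

lemma pairIntegral_congr {Φ Φ' Ψ Ψ' : Λ → H →ₗ.[ℂ] G}
    (h : ∀ᵐ l ∂ν.variation, comp (Φ l) (ν.sqrtDensity l) = comp (Φ' l) (ν.sqrtDensity l))
    (h' : ∀ᵐ l ∂ν.variation, comp (Ψ l) (ν.sqrtDensity l) = comp (Ψ' l) (ν.sqrtDensity l)) :
    ν.pairIntegral Φ Ψ = ν.pairIntegral Φ' Ψ' := by
  refine integral_congr_ae ?_
  filter_upwards [h, h'] with l h1 h2
  rw [h1, h2]

lemma SqIntegrable.inner_self {Φ : Λ → H →ₗ.[ℂ] G} (hΦ : ν.SqIntegrable Φ) (x : G) :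
    Integrable (fun l => ‖adjoint (comp (Φ l) (ν.sqrtDensity l)) x‖ ^ 2) ν.variation ∧
    ⟪x, (ν.pairIntegral Φ Φ).toCLM x⟫_ℂ =
      ((∫ l, ‖adjoint (comp (Φ l) (ν.sqrtDensity l)) x‖ ^ 2 ∂ν.variation : ℝ) : ℂ) := by
  obtain ⟨h1, h2⟩ := hΦ.inner_pairIntegral hΦ x x
  constructor
  · refine h1.re.congr (Eventually.of_forall fun l => ?_)
    exact inner_self_eq_norm_sq _
  · rw [h2, ← integral_complex_ofReal]
    refine integral_congr_ae (Eventually.of_forall fun l => ?_)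
    change ⟪_, _⟫_ℂ = _
    rw [inner_self_eq_norm_sq_to_K]
    norm_cast

lemma SqIntegrable.pairIntegral_eq_zero_iff {Φ : Λ → H →ₗ.[ℂ] G} (hΦ : ν.SqIntegrable Φ) :
    ν.pairIntegral Φ Φ = 0 ↔ ∀ᵐ l ∂ν.variation, comp (Φ l) (ν.sqrtDensity l) = 0 := by
  constructor
  · intro h
    have h1 : ∀ x, ∀ᵐ l ∂ν.variation, adjoint (comp (Φ l) (ν.sqrtDensity l)) x = 0 := by
      intro x
      obtain ⟨h2, h3⟩ := hΦ.inner_self x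
      rw [h, TraceClass.toCLM_zero, zero_apply, inner_zero_right] at h3
      have h4 : ∫ l, ‖adjoint (comp (Φ l) (ν.sqrtDensity l)) x‖ ^ 2 ∂ν.variation = 0 := by
        exact_mod_cast h3.symm
      rw [integral_eq_zero_iff_of_nonneg (fun _ => by positivity) h2] at h4
      filter_upwards [h4] with l hl
      simpa using hl
    obtain ⟨s, hs, hd⟩ := TopologicalSpace.exists_countable_dense G
    have h2 : ∀ᵐ l ∂ν.variation, ∀ x ∈ s, adjoint (comp (Φ l) (ν.sqrtDensity l)) x = 0 :=
      (ae_ball_iff hs).2 fun x _ => h1 x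
    filter_upwards [h2] with l hl
    have h3 : adjoint (comp (Φ l) (ν.sqrtDensity l)) = 0 := by
      refine ContinuousLinearMap.ext fun x => ?_
      have := Continuous.ext_on hd (adjoint (comp (Φ l) (ν.sqrtDensity l))).continuous
        (continuous_const (y := (0 : H))) hl
      exact congrFun this x
    rw [← ContinuousLinearMap.adjoint_adjoint (comp (Φ l) (ν.sqrtDensity l)), h3, map_zero]
  · intro h
    refine (integral_congr_ae (g := fun _ => 0) ?_).trans (integral_zero _ _)
    filter_upwards [h] with l hl
    rw [hl, ContinuousLinearMap.zero_comp]
    exact TraceClass.ofCLM_toCLM 0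

lemma ae_comp_add {Φ Ψ : Λ → H →ₗ.[ℂ] G} (hΦ : ν.SqIntegrable Φ) (hΨ : ν.SqIntegrable Ψ) :
    ∀ᵐ l ∂ν.variation, comp (Φ l + Ψ l) (ν.sqrtDensity l) =
      comp (Φ l) (ν.sqrtDensity l) + comp (Ψ l) (ν.sqrtDensity l) := by
  filter_upwards [hΦ.ae_comp, hΨ.ae_comp] with l h1 h2 using (h1.1.add h2.1).comp_eq

lemma ae_comp_neg {Φ : Λ → H →ₗ.[ℂ] G} (hΦ : ν.SqIntegrable Φ) :
    ∀ᵐ l ∂ν.variation, comp (-Φ l) (ν.sqrtDensity l) = -comp (Φ l) (ν.sqrtDensity l) := by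
  filter_upwards [hΦ.ae_comp] with l h1 using h1.1.neg.comp_eq

lemma ae_comp_smul (S : G →L[ℂ] G) {Φ : Λ → H →ₗ.[ℂ] G} (hΦ : ν.SqIntegrable Φ) :
    ∀ᵐ l ∂ν.variation, comp (S • Φ l) (ν.sqrtDensity l) =
      S ∘L comp (Φ l) (ν.sqrtDensity l) := by
  filter_upwards [hΦ.ae_comp] with l h1 using (h1.1.smul S).comp_eq

lemma SqIntegrable.sub {Φ Ψ : Λ → H →ₗ.[ℂ] G} (hΦ : ν.SqIntegrable Φ) (hΨ : ν.SqIntegrable Ψ) :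
    ν.SqIntegrable fun l => Φ l - Ψ l := by
  have h := hΦ.add hΨ.neg
  simpa only [← sub_eq_add_neg] using h

lemma nuNorm_sub_eq_zero_iff {Φ Ψ : Λ → H →ₗ.[ℂ] G} (hΦ : ν.SqIntegrable Φ)
    (hΨ : ν.SqIntegrable Ψ) : ν.nuNorm (fun l => Φ l - Ψ l) = 0 ↔
      ∀ᵐ l ∂ν.variation, comp (Φ l) (ν.sqrtDensity l) = comp (Ψ l) (ν.sqrtDensity l) := by
  rw [nuNorm, Real.sqrt_eq_zero (norm_nonneg _), norm_eq_zero,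
    (hΦ.sub hΨ).pairIntegral_eq_zero_iff]
  refine eventually_congr ?_
  filter_upwards [ae_comp_add hΦ hΨ.neg, ae_comp_neg hΨ] with l h1 h2
  rw [sub_eq_add_neg, h1, h2, ← sub_eq_add_neg, sub_eq_zero]

end TraceClassPOVM

open TraceClassPOVM

variable (ν : TraceClassPOVM Λ H)

/-- The square `ν`-integrable functions with values in the operators from `H` to `G`. -/
def SqFun (G : Type*) [NormedAddCommGroup G] [InnerProductSpace ℂ G]
    [CompleteSpace G] [TopologicalSpace.SeparableSpace G] : Type _ :=
  {Φ : Λ → H →ₗ.[ℂ] G // ν.SqIntegrable Φ}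

/-- Two square integrable functions are identified if `‖Φ - Ψ‖_ν = 0`. -/
instance SqFun.setoid (G : Type*) [NormedAddCommGroup G] [InnerProductSpace ℂ G]
    [CompleteSpace G] [TopologicalSpace.SeparableSpace G] :
    Setoid (SqFun ν G) where
  r Φ Ψ := ν.nuNorm (fun l => Φ.1 l - Ψ.1 l) = 0
  iseqv :=
    { refl := fun Φ => (nuNorm_sub_eq_zero_iff Φ.2 Φ.2).2 (Eventually.of_forall fun _ => rfl)
      symm := fun {Φ Ψ} h => (nuNorm_sub_eq_zero_iff Ψ.2 Φ.2).2
        (((nuNorm_sub_eq_zero_iff Φ.2 Ψ.2).1 h).mono fun _ hl => hl.symm)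
      trans := fun {Φ Ψ Θ} h h' => (nuNorm_sub_eq_zero_iff Φ.2 Θ.2).2
        (((nuNorm_sub_eq_zero_iff Φ.2 Ψ.2).1 h).mp
          (((nuNorm_sub_eq_zero_iff Ψ.2 Θ.2).1 h').mono fun _ hl hl' => hl'.trans hl)) }

/-- The space `L²(Λ, 𝒪(H, G), ν)` of classes of square `ν`-integrable functions. -/
def L2 (G : Type*) [NormedAddCommGroup G] [InnerProductSpace ℂ G]
    [CompleteSpace G] [TopologicalSpace.SeparableSpace G] : Type _ :=
  Quotient (SqFun.setoid ν G)

variable {ν}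

lemma SqFun.equiv_iff {Φ Ψ : SqFun ν G} : Φ ≈ Ψ ↔
    ∀ᵐ l ∂ν.variation, comp (Φ.1 l) (ν.sqrtDensity l) = comp (Ψ.1 l) (ν.sqrtDensity l) :=
  nuNorm_sub_eq_zero_iff Φ.2 Ψ.2

namespace L2

/-- The class of a square integrable function. -/
def mk (Φ : Λ → H →ₗ.[ℂ] G) (h : ν.SqIntegrable Φ) : L2 ν G :=
  Quotient.mk (SqFun.setoid ν G) ⟨Φ, h⟩

lemma mk_eq_mk {Φ Ψ : Λ → H →ₗ.[ℂ] G} {hΦ : ν.SqIntegrable Φ} {hΨ : ν.SqIntegrable Ψ} :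
    mk Φ hΦ = mk Ψ hΨ ↔
    ∀ᵐ l ∂ν.variation, comp (Φ l) (ν.sqrtDensity l) = comp (Ψ l) (ν.sqrtDensity l) :=
  Quotient.eq.trans SqFun.equiv_iff

lemma exists_mk (x : L2 ν G) : ∃ Φ, ∃ h : ν.SqIntegrable Φ, x = mk Φ h :=
  Quotient.inductionOn x fun Φ => ⟨Φ.1, Φ.2, rfl⟩

instance : Zero (L2 ν G) := ⟨mk (fun _ => 0) sqIntegrable_zero⟩

instance : Add (L2 ν G) :=
  ⟨Quotient.map₂ (fun Φ Ψ => ⟨fun l => Φ.1 l + Ψ.1 l, Φ.2.add Ψ.2⟩) (by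
    intro Φ Φ' h Ψ Ψ' h'
    refine SqFun.equiv_iff.2 ?_
    filter_upwards [SqFun.equiv_iff.1 h, SqFun.equiv_iff.1 h', ae_comp_add Φ.2 Ψ.2,
      ae_comp_add Φ'.2 Ψ'.2] with l h1 h2 h3 h4
    rw [h3, h4, h1, h2])⟩

instance : Neg (L2 ν G) :=
  ⟨Quotient.map (fun Φ => ⟨fun l => -Φ.1 l, Φ.2.neg⟩) (by
    intro Φ Φ' h
    refine SqFun.equiv_iff.2 ?_
    filter_upwards [SqFun.equiv_iff.1 h, ae_comp_neg Φ.2, ae_comp_neg Φ'.2] with l h1 h2 h3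
    rw [h2, h3, h1])⟩

instance : SMul (G →L[ℂ] G) (L2 ν G) :=
  ⟨fun S => Quotient.map (fun Φ => ⟨fun l => S • Φ.1 l, Φ.2.smul S⟩) (by
    intro Φ Φ' h
    refine SqFun.equiv_iff.2 ?_
    filter_upwards [SqFun.equiv_iff.1 h, ae_comp_smul S Φ.2, ae_comp_smul S Φ'.2] with l h1 h2 h3
    rw [h2, h3, h1])⟩

lemma zero_def : (0 : L2 ν G) = mk (fun _ => 0) sqIntegrable_zero := rfl

lemma mk_add {Φ Ψ : Λ → H →ₗ.[ℂ] G} (hΦ : ν.SqIntegrable Φ) (hΨ : ν.SqIntegrable Ψ) :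
    mk Φ hΦ + mk Ψ hΨ = mk (fun l => Φ l + Ψ l) (hΦ.add hΨ) := rfl

lemma neg_mk {Φ : Λ → H →ₗ.[ℂ] G} (hΦ : ν.SqIntegrable Φ) :
    -mk Φ hΦ = mk (fun l => -Φ l) hΦ.neg := rfl

lemma smul_mk (S : G →L[ℂ] G) {Φ : Λ → H →ₗ.[ℂ] G} (hΦ : ν.SqIntegrable Φ) :
    S • mk Φ hΦ = mk (fun l => S • Φ l) (hΦ.smul S) := rfl

lemma comp_zero (R : H →L[ℂ] H) : comp (0 : H →ₗ.[ℂ] G) R = 0 := (IsComp.zero R).comp_eq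

instance : AddGroup (L2 ν G) :=
  AddGroup.ofLeftAxioms
    (by
      intro x y z
      obtain ⟨Φ, hΦ, rfl⟩ := exists_mk x
      obtain ⟨Ψ, hΨ, rfl⟩ := exists_mk y
      obtain ⟨Θ, hΘ, rfl⟩ := exists_mk z
      simp only [mk_add, add_assoc])
    (by
      intro x
      obtain ⟨Φ, hΦ, rfl⟩ := exists_mk x
      simp only [zero_def, mk_add, zero_add])
    (by
      intro x
      obtain ⟨Φ, hΦ, rfl⟩ := exists_mk x
      rw [neg_mk, mk_add, zero_def, mk_eq_mk]
      filter_upwards [ae_comp_add hΦ.neg hΦ, ae_comp_neg hΦ] with l h1 h2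
      rw [h1, h2, neg_add_cancel, comp_zero])

instance : AddCommGroup (L2 ν G) where
  add_comm x y := by
    obtain ⟨Φ, hΦ, rfl⟩ := exists_mk x
    obtain ⟨Ψ, hΨ, rfl⟩ := exists_mk y
    simp only [mk_add, add_comm]

/-- The module structure `S • Φ = S Φ`. -/
instance : Module (G →L[ℂ] G) (L2 ν G) where
  one_smul x := by
    obtain ⟨Φ, hΦ, rfl⟩ := exists_mk x
    rw [smul_mk, mk_eq_mk]
    filter_upwards [ae_comp_smul 1 hΦ] with l h1
    rw [h1]
    rfl
  mul_smul S T x := by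
    obtain ⟨Φ, hΦ, rfl⟩ := exists_mk x
    rw [smul_mk, smul_mk, smul_mk, mk_eq_mk]
    filter_upwards [ae_comp_smul (S * T) hΦ, ae_comp_smul T hΦ, ae_comp_smul S (hΦ.smul T)]
      with l h1 h2 h3
    rw [h1, h3, h2]
    rfl
  smul_zero S := by
    rw [zero_def, smul_mk, mk_eq_mk]
    filter_upwards [ae_comp_smul (ν := ν) (G := G) S sqIntegrable_zero] with l h1
    rw [h1, comp_zero, ContinuousLinearMap.comp_zero]
  smul_add S x y := by
    obtain ⟨Φ, hΦ, rfl⟩ := exists_mk x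
    obtain ⟨Ψ, hΨ, rfl⟩ := exists_mk y
    rw [mk_add, smul_mk, smul_mk, smul_mk, mk_add, mk_eq_mk]
    filter_upwards [ae_comp_smul S (hΦ.add hΨ), ae_comp_add hΦ hΨ, ae_comp_smul S hΦ,
      ae_comp_smul S hΨ, ae_comp_add (hΦ.smul S) (hΨ.smul S)] with l h1 h2 h3 h4 h5
    rw [h1, h5, h2, h3, h4, ContinuousLinearMap.comp_add]
  add_smul S T x := by
    obtain ⟨Φ, hΦ, rfl⟩ := exists_mk x
    rw [smul_mk, smul_mk, smul_mk, mk_add, mk_eq_mk]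
    filter_upwards [ae_comp_smul (S + T) hΦ, ae_comp_smul S hΦ, ae_comp_smul T hΦ,
      ae_comp_add (hΦ.smul S) (hΦ.smul T)] with l h1 h2 h3 h4
    rw [h1, h4, h2, h3, ContinuousLinearMap.add_comp]
  zero_smul x := by
    obtain ⟨Φ, hΦ, rfl⟩ := exists_mk x
    rw [smul_mk, zero_def, mk_eq_mk]
    filter_upwards [ae_comp_smul 0 hΦ] with l h1
    rw [h1, comp_zero, ContinuousLinearMap.zero_comp]

/-- The Gramian `[Φ, Ψ]_ν = ∫ Φ dν Ψᴴ`. -/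
def gram : L2 ν G → L2 ν G → TraceClass G G :=
  Quotient.lift₂ (fun Φ Ψ => ν.pairIntegral Φ.1 Ψ.1) fun _ _ _ _ h h' =>
    pairIntegral_congr (SqFun.equiv_iff.1 h) (SqFun.equiv_iff.1 h')

lemma gram_mk {Φ Ψ : Λ → H →ₗ.[ℂ] G} (hΦ : ν.SqIntegrable Φ) (hΨ : ν.SqIntegrable Ψ) :
    gram (mk Φ hΦ) (mk Ψ hΨ) = ν.pairIntegral Φ Ψ := rfl

lemma isGramian_gram : IsGramian (gram : L2 ν G → L2 ν G → TraceClass G G) where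
  self_isPositive x := by
    obtain ⟨Φ, hΦ, rfl⟩ := exists_mk x
    refine isPositive_of_inner _ fun y => ?_
    rw [gram_mk, (hΦ.inner_self y).2]
    exact_mod_cast integral_nonneg fun _ => by positivity
  self_eq_zero x := by
    obtain ⟨Φ, hΦ, rfl⟩ := exists_mk x
    rw [gram_mk, hΦ.pairIntegral_eq_zero_iff, zero_def, mk_eq_mk]
    simp only [comp_zero]
  add_smul_left x y z T := by
    obtain ⟨Φ, hΦ, rfl⟩ := exists_mk x
    obtain ⟨Ψ, hΨ, rfl⟩ := exists_mk y
    obtain ⟨Θ, hΘ, rfl⟩ := exists_mk z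
    rw [smul_mk, mk_add, gram_mk, gram_mk, gram_mk]
    refine ContinuousLinearMap.ext fun v => ext_inner_left ℂ fun u => ?_
    rw [((hΦ.add (hΨ.smul T)).inner_pairIntegral hΘ u v).2, add_apply, inner_add_right,
      ContinuousLinearMap.comp_apply, ← ContinuousLinearMap.adjoint_inner_left T,
      (hΦ.inner_pairIntegral hΘ u v).2, (hΨ.inner_pairIntegral hΘ _ v).2,
      ← integral_add (hΦ.inner_pairIntegral hΘ u v).1 (hΨ.inner_pairIntegral hΘ _ v).1]
    refine integral_congr_ae ?_
    filter_upwards [ae_comp_add hΦ (hΨ.smul T), ae_comp_smul T hΨ] with l h1 h2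
    rw [h1, h2, map_add, add_apply, inner_add_left, ContinuousLinearMap.adjoint_comp]
    rfl
  adjoint_eq x y := by
    obtain ⟨Φ, hΦ, rfl⟩ := exists_mk x
    obtain ⟨Ψ, hΨ, rfl⟩ := exists_mk y
    rw [gram_mk, gram_mk]
    refine ContinuousLinearMap.ext fun v => ext_inner_left ℂ fun u => ?_
    rw [ContinuousLinearMap.adjoint_inner_right, ← inner_conj_symm _ v,
      (hΦ.inner_pairIntegral hΨ v u).2, (hΨ.inner_pairIntegral hΦ u v).2, ← integral_conj]
    simp only [inner_conj_symm]

instance : NormalPreHilbertModule G (L2 ν G) where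
  gram := gram
  isGramian := isGramian_gram

variable (ν) in
/-- The class of `1_A T`, for a measurable set `A` and a bounded operator `T`. -/
def indicator (A : Set Λ) (hA : MeasurableSet A) (T : H →L[ℂ] G) : L2 ν G :=
  mk (indicatorFun A T) (sqIntegrable_indicatorFun hA T)

end L2

end L2

end GramianIntegral

end

open GramianIntegral

/-! The integral is the closure of the correspondence `1_A T ↔ T W(A)`. Additivity and
Gramian-orthogonality of `W` give `[W(A), W(B)] = ν_W(A ∩ B)` (`cov_eq_intensity`), so the Gramians
of two such generators agree on both sides, each being `S ν_W(A ∩ B) Tᴴ`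
(`inner_rankOne_smul_graph`). What remains is to show that this correspondence extends to all of
`L²` and reaches the whole closed span.

To work in genuine Hilbert spaces, fix a countable Hilbert basis `b` of `H`, write `f` for the
density of `ν`, and send `Φ` to its coordinates `(l, k) ↦ Φ(l) f(l)^(1/2) b_k` in the Bochner space
`L²(Λ × ι, G)` (`L2.toLp`). On both sides a Gramian coefficient is a scalar product, `⟪x, [u, v] y⟫
= ⟪(x ⊗ y) • v, u⟫` (`inner_rankOne_smul_toLp`, `inner_rankOne_smul_eq_cov`). Hence the Gramian
determines the norm, its square being the trace of the Gramian. Conversely, an isometric linear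
relation stable under the module action preserves Gramians, by polarization. The closure of the span
of the generating pairs is therefore the graph of an isometry between the two closed spans.

The image of `L²` is exactly the closed span of the coordinates of indicators, for two reasons.
Completeness (`L2.exists_toLp_eq`): a limit of coordinates of functions with bounded values is the
coordinate family of a pointwise limit of bounded operators, defined wherever the sequence
converges; such limits may be unbounded, which is why the values are operators with a domain.
Density (`L2.eq_zero_of_gram_indicator`): orthogonality to all indicators gives `(Φ f^(1/2)) f^(1/2)
= 0` a.e., and then `Φ f^(1/2) = 0`, since this operator also vanishes on the kernel of `f^(1/2)`
(`IsComp.eq_zero`).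

All this requires a true density of `ν` for its variation (`exists_isDensity`). It is built from
scalar Radon-Nikodym derivatives of the matrix entries: almost everywhere these form a positive
matrix with finite trace, whose finite sections converge in trace norm (`exists_tendsto_ofMatrix`).
-/

namespace GramianIntegral

/-! ### Schatten norms in a Hilbert basis, and the trace of positive operators. -/

section TraceNorm

open ContinuousLinearMap (adjoint)

variable {H G I : Type*}
  [NormedAddCommGroup H] [InnerProductSpace ℂ H] [CompleteSpace H]
  [NormedAddCommGroup G] [InnerProductSpace ℂ G] [CompleteSpace G]
  [NormedAddCommGroup I] [InnerProductSpace ℂ I] [CompleteSpace I]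

/-- Parseval's identity in `[0, ∞]`. -/
lemma enorm_sq_eq_tsum {ι : Type*} (b : HilbertBasis ι ℂ H) (x : H) :
    ‖x‖ₑ ^ 2 = ∑' k, ‖⟪b k, x⟫_ℂ‖ₑ ^ 2 := by
  have h : HasSum (fun k => ‖⟪b k, x⟫_ℂ‖ ^ 2) (‖x‖ ^ 2) := by
    have h1 := Complex.reCLM.hasSum (b.hasSum_inner_mul_inner x x)
    have h2 : Complex.reCLM ⟪x, x⟫_ℂ = ‖x‖ ^ 2 := inner_self_eq_norm_sq (𝕜 := ℂ) x
    rw [h2] at h1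
    refine h1.congr_fun fun k => ?_
    rw [← inner_conj_symm x (b k), Complex.reCLM_apply, ← Complex.normSq_eq_norm_sq,
      ← Complex.normSq_eq_conj_mul_self]
    rfl
  have h3 := ENNReal.ofReal_tsum_of_nonneg (fun k => by positivity) h.summable
  rw [h.tsum_eq] at h3
  simpa only [ENNReal.ofReal_pow (norm_nonneg _), ofReal_norm] using h3

lemma sum_enorm_inner_sq_le {n : ℕ} {e : Fin n → H} (he : Orthonormal ℂ e) (x : H) :
    ∑ i, ‖⟪e i, x⟫_ℂ‖ₑ ^ 2 ≤ ‖x‖ₑ ^ 2 := by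
  have h := ENNReal.ofReal_le_ofReal (he.sum_inner_products_le (s := Finset.univ) x)
  rw [ENNReal.ofReal_sum_of_nonneg fun _ _ => by positivity] at h
  simpa only [ENNReal.ofReal_pow (norm_nonneg _), ofReal_norm] using h

/-- Bounded operators with the same matrix in a Hilbert basis agree. -/
lemma clm_ext_basis {ι κ : Type*} (b : HilbertBasis ι ℂ H) (c : HilbertBasis κ ℂ G)
    {S T : H →L[ℂ] G} (h : ∀ j k, ⟪c j, S (b k)⟫_ℂ = ⟪c j, T (b k)⟫_ℂ) : S = T := by
  refine ContinuousLinearMap.ext_on (s := Set.range b) (dense_iff_closure_eq.2 ?_) ?_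
  · rw [← Submodule.topologicalClosure_coe, b.dense_span]
    rfl
  · rintro _ ⟨k, rfl⟩
    refine c.repr.injective (lp.ext (funext fun j => ?_))
    simpa only [HilbertBasis.repr_apply_apply] using h j k

lemma hsNormSq_adjoint (T : H →L[ℂ] G) : hsNormSq (adjoint T) = hsNormSq T := by
  refine le_antisymm (hsNormSq_adjoint_le T) ?_
  simpa using hsNormSq_adjoint_le (adjoint T)

/-- For the upper bound, pass to the adjoint, expand each `Tᴴ g_i` along `b` by Parseval, exchange
the sums and apply Bessel's inequality to the family `g`. -/
lemma hsNormSq_eq_tsum (T : H →L[ℂ] G) {ι : Type*} (b : HilbertBasis ι ℂ H) :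
    hsNormSq T = ∑' k, ‖T (b k)‖ₑ ^ 2 := by
  refine le_antisymm ?_ ?_
  · rw [← hsNormSq_adjoint]
    refine hsNormSq_le_iff.2 fun n g hg => ?_
    calc ∑ i, ‖adjoint T (g i)‖ₑ ^ 2 = ∑ i, ∑' k, ‖⟪g i, T (b k)⟫_ℂ‖ₑ ^ 2 := by
          refine Finset.sum_congr rfl fun i _ => ?_
          rw [enorm_sq_eq_tsum b]
          refine tsum_congr fun k => ?_
          rw [ContinuousLinearMap.adjoint_inner_right, ← ofReal_norm, norm_inner_symm, ofReal_norm]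
      _ = ∑' k, ∑ i, ‖⟪g i, T (b k)⟫_ℂ‖ₑ ^ 2 :=
          (Summable.tsum_finsetSum fun _ _ => ENNReal.summable).symm
      _ ≤ ∑' k, ‖T (b k)‖ₑ ^ 2 := ENNReal.tsum_le_tsum fun k => sum_enorm_inner_sq_le hg _
  · rw [ENNReal.tsum_eq_iSup_sum]
    exact iSup_le fun s => sum_le_hsNormSq T b.orthonormal s

/-- The Cauchy-Schwarz inequality for the Schatten norms. -/
lemma traceNorm_comp_adjoint_le_mul (T : H →L[ℂ] G) (S : H →L[ℂ] I) :
    traceNorm (T ∘L adjoint S) ≤ hsNormSq T ^ (1 / 2 : ℝ) * hsNormSq S ^ (1 / 2 : ℝ) := by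
  refine traceNorm_le_iff.2 fun n e g he hg => ?_
  calc ∑ i, ‖⟪g i, (T ∘L adjoint S) (e i)⟫_ℂ‖ₑ
      ≤ ∑ i, ‖adjoint T (g i)‖ₑ * ‖adjoint S (e i)‖ₑ := by
        refine Finset.sum_le_sum fun i _ => ?_
        rw [ContinuousLinearMap.comp_apply, ← ContinuousLinearMap.adjoint_inner_left,
          ← ofReal_norm, ← ofReal_norm, ← ofReal_norm, ← ENNReal.ofReal_mul (norm_nonneg _)]
        exact ENNReal.ofReal_le_ofReal (norm_inner_le_norm _ _)
    _ ≤ (∑ i, ‖adjoint T (g i)‖ₑ ^ (2 : ℝ)) ^ (1 / 2 : ℝ) *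
        (∑ i, ‖adjoint S (e i)‖ₑ ^ (2 : ℝ)) ^ (1 / 2 : ℝ) :=
        ENNReal.inner_le_Lp_mul_Lq _ _ _ Real.HolderConjugate.two_two
    _ ≤ _ := by
        simp only [ENNReal.rpow_two]
        gcongr
        · exact (sum_le_hsNormSq _ hg _).trans (hsNormSq_adjoint_le T)
        · exact (sum_le_hsNormSq _ he _).trans (hsNormSq_adjoint_le S)

lemma traceNorm_comp_adjoint_self (T : H →L[ℂ] G) : traceNorm (T ∘L adjoint T) = hsNormSq T := by
  refine le_antisymm ?_ (hsNormSq_le_traceNorm T)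
  refine (traceNorm_comp_adjoint_le_mul T T).trans (le_of_eq ?_)
  rw [← ENNReal.rpow_add_of_nonneg _ _ (by norm_num) (by norm_num)]
  norm_num

lemma exists_comp_adjoint_eq {S : H →L[ℂ] H} (hS : S.IsPositive) :
    ∃ R : H →L[ℂ] H, R ∘L adjoint R = S ∧ adjoint R = R := by
  have h0 : 0 ≤ S := (ContinuousLinearMap.nonneg_iff_isPositive _).2 hS
  have h1 : adjoint (CFC.sqrt S) = CFC.sqrt S :=
    (IsSelfAdjoint.of_nonneg (CFC.sqrt_nonneg _)).star_eq
  refine ⟨CFC.sqrt S, ?_, h1⟩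
  rw [h1]
  exact CFC.sqrt_mul_sqrt_self _ h0

/-- The trace norm of a positive operator is its trace. -/
lemma traceNorm_eq_tsum_of_isPositive {S : H →L[ℂ] H} (hS : S.IsPositive) {ι : Type*}
    (b : HilbertBasis ι ℂ H) : traceNorm S = ∑' k, ENNReal.ofReal (⟪b k, S (b k)⟫_ℂ).re := by
  obtain ⟨R, hR, hR'⟩ := exists_comp_adjoint_eq hS
  rw [← hR, traceNorm_comp_adjoint_self, hsNormSq_eq_tsum R b]
  refine tsum_congr fun k => ?_
  rw [ContinuousLinearMap.comp_apply, hR', ← ContinuousLinearMap.adjoint_inner_left, hR',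
    ← ofReal_norm, ← ENNReal.ofReal_pow (norm_nonneg _)]
  congr 1
  exact (inner_self_eq_norm_sq (𝕜 := ℂ) _).symm

/-- On the positive cone the norm is the trace, which is linear. This additivity is what makes the
variation of a positive operator measure finite. -/
lemma traceNorm_add_of_isPositive {S T : H →L[ℂ] H} (hS : S.IsPositive) (hT : T.IsPositive) :
    traceNorm (S + T) = traceNorm S + traceNorm T := by
  obtain ⟨w, b, _⟩ := exists_hilbertBasis ℂ H
  rw [traceNorm_eq_tsum_of_isPositive hS b, traceNorm_eq_tsum_of_isPositive hT b,
    traceNorm_eq_tsum_of_isPositive (hS.add hT) b, ← ENNReal.tsum_add]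
  refine tsum_congr fun k => ?_
  rw [add_apply, inner_add_right, Complex.add_re, ENNReal.ofReal_add]
  · exact hS.re_inner_nonneg_right _
  · exact hT.re_inner_nonneg_right _

namespace TraceClass

lemma enorm_add_of_isPositive {S T : TraceClass H H} (hS : S.toCLM.IsPositive)
    (hT : T.toCLM.IsPositive) : ‖S + T‖ₑ = ‖S‖ₑ + ‖T‖ₑ := by
  rw [← traceNorm_toCLM, ← traceNorm_toCLM, ← traceNorm_toCLM, toCLM_add,
    traceNorm_add_of_isPositive hS hT]

lemma isPositive_sum {ι : Type*} (s : Finset ι) {S : ι → TraceClass H H}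
    (hS : ∀ i ∈ s, (S i).toCLM.IsPositive) : (∑ i ∈ s, S i).toCLM.IsPositive := by
  classical
  induction s using Finset.induction_on with
  | empty => exact ContinuousLinearMap.isPositive_zero
  | insert i s hi ih =>
    rw [Finset.sum_insert hi, toCLM_add]
    exact (hS i (Finset.mem_insert_self _ _)).add
      (ih fun j hj => hS j (Finset.mem_insert_of_mem hj))

lemma enorm_sum_of_isPositive {ι : Type*} (s : Finset ι) {S : ι → TraceClass H H}
    (hS : ∀ i ∈ s, (S i).toCLM.IsPositive) : ‖∑ i ∈ s, S i‖ₑ = ∑ i ∈ s, ‖S i‖ₑ := by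
  classical
  induction s using Finset.induction_on with
  | empty => simp
  | insert i s hi ih =>
    have h : ∀ j ∈ s, (S j).toCLM.IsPositive := fun j hj => hS j (Finset.mem_insert_of_mem hj)
    rw [Finset.sum_insert hi, Finset.sum_insert hi,
      enorm_add_of_isPositive (hS i (Finset.mem_insert_self _ _)) (isPositive_sum s h), ih h]

/-- Trace-class operators with the same matrix in a Hilbert basis agree. -/
lemma ext_basis {ι κ : Type*} (b : HilbertBasis ι ℂ H) (c : HilbertBasis κ ℂ G)
    {S T : TraceClass H G} (h : ∀ j k, coeff (c j) (b k) S = coeff (c j) (b k) T) : S = T :=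
  toCLM_injective (clm_ext_basis b c h)

end TraceClass

end TraceNorm

/-! ### Finiteness of the variation, and scalar Radon-Nikodym derivatives. -/

section Variation

variable {Λ : Type*} [MeasurableSpace Λ] {H : Type*}
  [NormedAddCommGroup H] [InnerProductSpace ℂ H] [CompleteSpace H]
  [TopologicalSpace.SeparableSpace H]

namespace TraceClassPOVM

/-- Additivity of the norm on positive operators turns the sum over a finite disjoint family into
the norm of the measure of its union; adding the positive value on the complement can only increase
it. -/
lemma variation_univ_le (ν : TraceClassPOVM Λ H) :
    ν.variation Set.univ ≤ ‖ν.toVectorMeasure Set.univ‖ₑ := by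
  by_contra! h
  obtain ⟨P, -, hd, hm, hlt⟩ := VectorMeasure.exists_lt_sum_of_lt_variation _ MeasurableSet.univ h
  refine hlt.not_ge ?_
  have h1 : ν.toVectorMeasure (⋃ p ∈ P, p) = ∑ p ∈ P, ν.toVectorMeasure p :=
    VectorMeasure.of_biUnion_finset hd hm
  have h2 : MeasurableSet (⋃ p ∈ P, p) := P.measurableSet_biUnion hm
  have h3 := VectorMeasure.of_add_of_sdiff (v := ν.toVectorMeasure) h2 MeasurableSet.univ
    (Set.subset_univ _)
  rw [← h3, TraceClass.enorm_add_of_isPositive (ν.isPositive _) (ν.isPositive _), h1,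
    TraceClass.enorm_sum_of_isPositive P fun p _ => ν.isPositive p]
  exact le_self_add

instance (ν : TraceClassPOVM Λ H) : IsFiniteMeasure ν.variation :=
  ⟨ν.variation_univ_le.trans_lt enorm_lt_top⟩

/-- The real and imaginary parts of `ℓ ∘ ν` are signed measures absolutely continuous with respect
to the variation, so the scalar Radon-Nikodym theorem applies to each. -/
lemma exists_integral_eq (ν : TraceClassPOVM Λ H) (ℓ : TraceClass H H →L[ℂ] ℂ) :
    ∃ g : Λ → ℂ, Integrable g ν.variation ∧
      ∀ A, MeasurableSet A → ∫ l in A, g l ∂ν.variation = ℓ (ν.toVectorMeasure A) := by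
  have key : ∀ ℓ' : TraceClass H H →L[ℝ] ℝ, ∃ g : Λ → ℝ, Integrable g ν.variation ∧
      ∀ A, MeasurableSet A → ∫ l in A, g l ∂ν.variation = ℓ' (ν.toVectorMeasure A) := by
    intro ℓ'
    let s : SignedMeasure Λ :=
      ν.toVectorMeasure.mapRange (ℓ' : TraceClass H H →+ ℝ) ℓ'.continuous
    have hs : s ≪ᵥ ν.variation.toENNRealVectorMeasure := by
      intro A hA
      have h1 := ν.toVectorMeasure.absolutelyContinuous hA
      change ℓ' (ν.toVectorMeasure A) = 0
      rw [h1, map_zero]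
    have h2 := (s.absolutelyContinuous_iff_withDensityᵥ_rnDeriv_eq ν.variation).1 hs
    refine ⟨s.rnDeriv ν.variation, SignedMeasure.integrable_rnDeriv _ _, fun A hA => ?_⟩
    rw [← withDensityᵥ_apply (SignedMeasure.integrable_rnDeriv _ _) hA, h2]
    rfl
  obtain ⟨g, hg, hg'⟩ := key (Complex.reCLM ∘L ℓ.restrictScalars ℝ)
  obtain ⟨k, hk, hk'⟩ := key (Complex.imCLM ∘L ℓ.restrictScalars ℝ)
  refine ⟨fun l => (g l : ℂ) + (k l : ℂ) * Complex.I,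
    hg.ofReal.add (hk.ofReal.mul_const _), fun A hA => ?_⟩
  have h1 : Integrable (fun l => (g l : ℂ)) (ν.variation.restrict A) := hg.ofReal.restrict
  have h2 : Integrable (fun l => (k l : ℂ)) (ν.variation.restrict A) := hk.ofReal.restrict
  rw [integral_add h1 (h2.mul_const _), integral_mul_const, integral_complex_ofReal, integral_complex_ofReal, hg' A hA, hk' A hA]
  exact Complex.re_add_im _

end TraceClassPOVM

end Variation


/-! ### Trace-class operators defined by positive infinite matrices. -/

section OfMatrix

open ContinuousLinearMap (adjoint)

variable {H : Type*} [NormedAddCommGroup H] [InnerProductSpace ℂ H] [CompleteSpace H]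
  {ι : Type*} (b : HilbertBasis ι ℂ H) (a : ι → ι → ℂ)

namespace TraceClass

/-- The finite rank operator whose matrix in the basis `b` is the restriction of `a` to `s`. -/
noncomputable def ofMatrix (s : Finset ι) : TraceClass H H :=
  ∑ j ∈ s, ∑ k ∈ s, a j k • rankOne (b j) (b k)

lemma inner_ofMatrix (s : Finset ι) (x y : H) : ⟪x, (ofMatrix b a s).toCLM y⟫_ℂ =
    ∑ j ∈ s, ∑ k ∈ s, a j k * (⟪x, b j⟫_ℂ * ⟪b k, y⟫_ℂ) := by
  rw [← coeff_apply, ofMatrix]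
  simp only [map_sum, map_smul, coeff_apply, toCLM_rankOne, InnerProductSpace.rankOne_apply,
    inner_smul_right, smul_eq_mul]
  refine Finset.sum_congr rfl fun j _ => Finset.sum_congr rfl fun k _ => ?_
  ring

lemma inner_ofMatrix_basis [DecidableEq ι] (s : Finset ι) (j k : ι) :
    ⟪b j, (ofMatrix b a s).toCLM (b k)⟫_ℂ = if j ∈ s ∧ k ∈ s then a j k else 0 := by
  have h := orthonormal_iff_ite.1 b.orthonormal
  rw [inner_ofMatrix]
  simp only [h, mul_ite, mul_one, mul_zero, Finset.sum_ite_eq', ite_and]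
  by_cases hj : j ∈ s <;> by_cases hk : k ∈ s <;> simp [hj, hk]

variable {b a}

lemma enorm_ofMatrix {s : Finset ι} (h : (ofMatrix b a s).toCLM.IsPositive) :
    ‖ofMatrix b a s‖ₑ = ∑ k ∈ s, ENNReal.ofReal (a k k).re := by
  classical
  rw [← traceNorm_toCLM, traceNorm_eq_tsum_of_isPositive h b, tsum_eq_sum (s := s)]
  · refine Finset.sum_congr rfl fun k hk => ?_
    rw [inner_ofMatrix_basis, if_pos ⟨hk, hk⟩]
  · intro k hk
    rw [inner_ofMatrix_basis, if_neg fun h => hk h.1]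
    simp

/-- Factor the larger section as `R Rᴴ` with `R` self-adjoint, so that its entries are `⟪R b_j, R
b_k⟫`. With `U u` sending `b_k` to `R b_k` for `k ∈ u` and to `0` otherwise, the section over `u ⊆
t` is `(U u)ᴴ (U u)`. The difference of the two sections then splits as `(U (t \ s))ᴴ (U t) + (U s)ᴴ
(U (t \ s))`, and Cauchy-Schwarz bounds each product. The bound `c` controls the whole trace and `d`
its part outside `s`. -/
lemma enorm_ofMatrix_sub_le {s t : Finset ι} (hst : s ⊆ t)
    (h : (ofMatrix b a t).toCLM.IsPositive) {c d : ℝ≥0∞}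
    (hc : ∑ k ∈ t, ENNReal.ofReal (a k k).re ≤ c)
    (hd : ∀ u : Finset ι, Disjoint u s → u ⊆ t → ∑ k ∈ u, ENNReal.ofReal (a k k).re ≤ d) :
    ‖ofMatrix b a t - ofMatrix b a s‖ₑ ≤ 2 * (c ^ (1 / 2 : ℝ) * d ^ (1 / 2 : ℝ)) := by
  classical
  obtain ⟨R, hR, hR'⟩ := exists_comp_adjoint_eq h
  have hr : ∀ j ∈ t, ∀ k ∈ t, ⟪R (b j), R (b k)⟫_ℂ = a j k := by
    intro j hj k hk
    have h1 := inner_ofMatrix_basis b a t j k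
    rw [if_pos ⟨hj, hk⟩, ← hR, ContinuousLinearMap.comp_apply,
      ← ContinuousLinearMap.adjoint_inner_left, hR'] at h1
    exact h1
  let U : Finset ι → H →L[ℂ] H := fun u =>
    ∑ j ∈ u, InnerProductSpace.rankOne ℂ (R (b j)) (b j)
  have hU : ∀ u k, U u (b k) = if k ∈ u then R (b k) else 0 := by
    intro u k
    simp only [U, sum_apply, InnerProductSpace.rankOne_apply,
      orthonormal_iff_ite.1 b.orthonormal, ite_smul, one_smul, zero_smul, Finset.sum_ite_eq']
  have hsq : ∀ u ⊆ t, (ofMatrix b a u).toCLM = adjoint (U u) ∘L U u := by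
    intro u hu
    refine clm_ext_basis b b fun j k => ?_
    rw [inner_ofMatrix_basis, ContinuousLinearMap.comp_apply,
      ContinuousLinearMap.adjoint_inner_right, hU, hU]
    by_cases hj : j ∈ u
    · by_cases hk : k ∈ u
      · rw [if_pos hj, if_pos hk, if_pos ⟨hj, hk⟩, hr j (hu hj) k (hu hk)]
      · simp [hk]
    · simp [hj]
  have hhs : ∀ u ⊆ t, hsNormSq (adjoint (U u)) = ∑ k ∈ u, ENNReal.ofReal (a k k).re := by
    intro u hu
    rw [hsNormSq_adjoint, hsNormSq_eq_tsum _ b, tsum_eq_sum (s := u)]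
    · refine Finset.sum_congr rfl fun k hk => ?_
      rw [hU, if_pos hk, ← hr k (hu hk) k (hu hk), ← ofReal_norm,
        ← ENNReal.ofReal_pow (norm_nonneg _)]
      congr 1
      exact (inner_self_eq_norm_sq (𝕜 := ℂ) _).symm
    · intro k hk
      rw [hU, if_neg hk]
      simp
  have hUst : U t = U s + U (t \ s) := by
    rw [add_comm]
    exact (Finset.sum_sdiff hst).symm
  have hdec : (ofMatrix b a t - ofMatrix b a s).toCLM =
      adjoint (U (t \ s)) ∘L U t + adjoint (U s) ∘L U (t \ s) := by
    rw [toCLM_sub, hsq t subset_rfl, hsq s hst, hUst, map_add, ContinuousLinearMap.add_comp,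
      ContinuousLinearMap.comp_add, ContinuousLinearMap.comp_add]
    abel
  have hb : ∀ u ⊆ t, ∀ v ⊆ t, traceNorm (adjoint (U u) ∘L U v) ≤
      (∑ k ∈ u, ENNReal.ofReal (a k k).re) ^ (1 / 2 : ℝ) *
        (∑ k ∈ v, ENNReal.ofReal (a k k).re) ^ (1 / 2 : ℝ) := by
    intro u hu v hv
    have h1 := traceNorm_comp_adjoint_le_mul (adjoint (U u)) (adjoint (U v))
    rwa [ContinuousLinearMap.adjoint_adjoint, hhs u hu, hhs v hv] at h1
  rw [← traceNorm_toCLM, hdec, two_mul]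
  have hd' := hd (t \ s) Finset.sdiff_disjoint Finset.sdiff_subset
  have hs' : ∑ k ∈ s, ENNReal.ofReal (a k k).re ≤ c := (Finset.sum_le_sum_of_subset hst).trans hc
  refine (traceNorm_add_le _ _).trans (add_le_add ?_ ?_)
  · refine (hb _ Finset.sdiff_subset _ subset_rfl).trans ?_
    rw [mul_comm]
    gcongr
  · refine (hb _ hst _ Finset.sdiff_subset).trans ?_
    gcongr

lemma isPositive_of_tendsto {κ : Type*} {l : Filter κ} [l.NeBot] {F : κ → TraceClass H H}
    {T : TraceClass H H} (h : Tendsto F l (𝓝 T)) (hF : ∀ i, (F i).toCLM.IsPositive) :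
    T.toCLM.IsPositive := by
  refine isPositive_of_inner _ fun x => ?_
  refine ge_of_tendsto' (((coeff x x).continuous.tendsto T).comp h) fun i => ?_
  exact (hF i).inner_nonneg_right x

/-- A positive matrix with finite trace defines a trace-class operator. -/
lemma exists_tendsto_ofMatrix (h : ∀ s, (ofMatrix b a s).toCLM.IsPositive)
    (ha : ∑' k, ENNReal.ofReal (a k k).re ≠ ∞) :
    ∃ F : TraceClass H H, Tendsto (ofMatrix b a) atTop (𝓝 F) ∧ F.toCLM.IsPositive ∧
      ‖F‖ₑ ≤ ∑' k, ENNReal.ofReal (a k k).re := by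
  classical
  set c := ∑' k, ENNReal.ofReal (a k k).re with hc
  have hcauchy : CauchySeq (ofMatrix b a) := by
    rw [EMetric.cauchySeq_iff_le_tendsto_0]
    -- The inner factor `2` comes from the bound on the difference of two nested sections, the outer
    -- one from comparing two sections through the smaller one `s`. The tail of the trace outside
    -- `s` tends to `0`.
    refine ⟨fun s => 2 * (2 * (c ^ (1 / 2 : ℝ) *
      (∑' k : {k // k ∉ s}, ENNReal.ofReal (a k k).re) ^ (1 / 2 : ℝ))), ?_, ?_⟩
    · intro t u s hst hsu
      have key : ∀ t : Finset ι, s ≤ t → edist (ofMatrix b a t) (ofMatrix b a s) ≤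
          2 * (c ^ (1 / 2 : ℝ) *
            (∑' k : {k // k ∉ s}, ENNReal.ofReal (a k k).re) ^ (1 / 2 : ℝ)) := by
        intro t hst
        rw [edist_eq_enorm_sub]
        refine enorm_ofMatrix_sub_le hst (h t) (ENNReal.sum_le_tsum t) fun u hu _ => ?_
        rw [← Finset.sum_coe_sort, ← tsum_fintype (L := .unconditional _)]
        exact ENNReal.tsum_comp_le_tsum_of_injective
          (f := fun k : u => (⟨k, Finset.disjoint_left.1 hu k.2⟩ : {k // k ∉ s}))
          (fun x y hxy => Subtype.ext (Subtype.mk.inj hxy))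
          (fun k : {k // k ∉ s} => ENNReal.ofReal (a k k).re)
      refine (edist_triangle_right _ _ (ofMatrix b a s)).trans ?_
      exact (add_le_add (key t hst) (key u hsu)).trans_eq (two_mul _).symm
    · have h1 := ENNReal.tendsto_tsum_compl_atTop_zero ha
      have h2 := ((ENNReal.continuous_rpow_const (y := (1 / 2 : ℝ))).tendsto _).comp h1
      have hc' : c ^ (1 / 2 : ℝ) ≠ ∞ := ENNReal.rpow_ne_top_of_nonneg (by norm_num) ha
      have h3 := ENNReal.Tendsto.const_mul (a := c ^ (1 / 2 : ℝ)) h2 (Or.inr hc')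
      have h4 := ENNReal.Tendsto.const_mul (a := 2) h3 (Or.inr (by simp))
      have h5 := ENNReal.Tendsto.const_mul (a := 2) h4 (Or.inr (by simp))
      simpa using h5
  obtain ⟨F, hF⟩ := cauchySeq_tendsto_of_complete hcauchy
  refine ⟨F, hF, isPositive_of_tendsto hF h, ?_⟩
  refine le_of_tendsto' ((continuous_enorm.tendsto F).comp hF) fun s => ?_
  rw [Function.comp_apply, enorm_ofMatrix (h s)]
  exact ENNReal.sum_le_tsum s

end TraceClass

end OfMatrix

/-! ### Existence of the operator density. -/

section Density

variable {Λ : Type*} [MeasurableSpace Λ]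

lemma ae_nonneg_of_forall_setIntegral_nonneg_complex {μ : Measure Λ} {g : Λ → ℂ}
    (hg : Integrable g μ) (h : ∀ A, MeasurableSet A → 0 ≤ ∫ l in A, g l ∂μ) :
    ∀ᵐ l ∂μ, 0 ≤ g l := by
  have h1 : 0 ≤ᵐ[μ] fun l => (g l).re := by
    refine ae_nonneg_of_forall_setIntegral_nonneg hg.re fun A hA _ => ?_
    have h2 := Complex.reCLM.integral_comp_comm (hg.integrableOn (s := A))
    exact (Complex.nonneg_iff.1 (h A hA)).1.trans_eq h2.symm
  have h1' : (fun l => (g l).im) =ᵐ[μ] 0 := by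
    refine hg.im.ae_eq_zero_of_forall_setIntegral_eq_zero fun A hA _ => ?_
    have h2 := Complex.imCLM.integral_comp_comm (hg.integrableOn (s := A))
    exact h2.trans (Complex.nonneg_iff.1 (h A hA)).2.symm
  filter_upwards [h1, h1'] with l h2 h3
  exact Complex.nonneg_iff.2 ⟨h2, h3.symm⟩

variable {H : Type*}
  [NormedAddCommGroup H] [InnerProductSpace ℂ H] [CompleteSpace H]
  [TopologicalSpace.SeparableSpace H]

namespace TraceClassPOVM

open TraceClass

/-- A trace-class positive operator valued measure has a density with respect to its variation. -/
lemma exists_isDensity (ν : TraceClassPOVM Λ H) : ∃ f, ν.IsDensity f := by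
  classical
  obtain ⟨w, b, hw⟩ := exists_countable_hilbertBasis H
  have : Countable w := hw
  choose a ha ha' using fun j k => ν.exists_integral_eq (coeff (b j) (b k))
  -- Integrated over `A`, the quadratic form of the section at `x` is that of `ν(A)` at the
  -- projection of `x` onto the span of the `b_j`, `j ∈ t`, so it is nonnegative. The exceptional
  -- null sets are united over the countably many `t` and a countable dense set of `x`; continuity
  -- gives the remaining `x`.
  have hpos : ∀ᵐ l ∂ν.variation, ∀ t, (ofMatrix b (fun j k => a j k l) t).toCLM.IsPositive := by
    refine ae_all_iff.2 fun t => ?_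
    have h1 : ∀ x : H, ∀ᵐ l ∂ν.variation,
        0 ≤ ⟪x, (ofMatrix b (fun j k => a j k l) t).toCLM x⟫_ℂ := by
      intro x
      simp only [inner_ofMatrix]
      have hi : ∀ j k, Integrable (fun l => a j k l * (⟪x, b j⟫_ℂ * ⟪b k, x⟫_ℂ)) ν.variation :=
        fun j k => (ha j k).mul_const _
      refine ae_nonneg_of_forall_setIntegral_nonneg_complex
        (integrable_finsetSum _ fun j _ => integrable_finsetSum _ fun k _ => hi j k)
        fun A hA => ?_
      have h2 : ∫ l in A, ∑ j ∈ t, ∑ k ∈ t, a j k l * (⟪x, b j⟫_ℂ * ⟪b k, x⟫_ℂ) ∂ν.variation =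
          ⟪∑ j ∈ t, ⟪b j, x⟫_ℂ • b j, (ν.toVectorMeasure A).toCLM
            (∑ k ∈ t, ⟪b k, x⟫_ℂ • b k)⟫_ℂ := by
        rw [integral_finsetSum _ fun j _ =>
          (integrable_finsetSum t fun k _ => hi j k).integrableOn, sum_inner]
        refine Finset.sum_congr rfl fun j _ => ?_
        rw [integral_finsetSum _ fun k _ => (hi j k).integrableOn, map_sum, inner_sum]
        refine Finset.sum_congr rfl fun k _ => ?_
        rw [integral_mul_const, ha' j k A hA, coeff_apply, map_smul, inner_smul_left,
          inner_smul_right, inner_conj_symm]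
        ring
      rw [h2]
      exact (ν.isPositive A).inner_nonneg_right _
    obtain ⟨D, hD, hDd⟩ := TopologicalSpace.exists_countable_dense H
    filter_upwards [(ae_ball_iff hD).2 fun x _ => h1 x] with l hl
    refine isPositive_of_inner _ fun x => ?_
    have hcl : IsClosed {x : H | 0 ≤ ⟪x, (ofMatrix b (fun j k => a j k l) t).toCLM x⟫_ℂ} :=
      isClosed_le continuous_const (by fun_prop)
    exact hcl.closure_subset_iff.2 hl (hDd x)
  have hdiag : ∀ k, ∀ᵐ l ∂ν.variation, 0 ≤ a k k l := fun k =>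
    ae_nonneg_of_forall_setIntegral_nonneg_complex (ha k k) fun A hA => by
      rw [ha' k k A hA]
      exact (ν.isPositive A).inner_nonneg_right _
  have hmeas : ∀ k, AEMeasurable (fun l => ENNReal.ofReal (a k k l).re) ν.variation := fun k =>
    (ha k k).re.aemeasurable.ennreal_ofReal
  -- The integral of the pointwise trace is the trace of `ν(Λ)`. Its finiteness gives both a finite
  -- trace a.e. and an integrable bound on the norm of the density.
  have htr : ∫⁻ l, ∑' k, ENNReal.ofReal (a k k l).re ∂ν.variation ≠ ∞ := by
    rw [lintegral_tsum hmeas]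
    have h1 : ∀ k, ∫⁻ l, ENNReal.ofReal (a k k l).re ∂ν.variation =
        ENNReal.ofReal (⟪b k, (ν.toVectorMeasure Set.univ).toCLM (b k)⟫_ℂ).re := by
      intro k
      have h2 := ofReal_integral_eq_lintegral_ofReal (ha k k).re
        ((hdiag k).mono fun l hl => (Complex.nonneg_iff.1 hl).1)
      refine h2.symm.trans ?_
      congr 1
      rw [← coeff_apply, ← ha' k k _ MeasurableSet.univ, Measure.restrict_univ]
      exact Complex.reCLM.integral_comp_comm (ha k k)
    simp only [h1]
    rw [← traceNorm_eq_tsum_of_isPositive (ν.isPositive _) b, traceNorm_toCLM]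
    exact enorm_ne_top
  have hfin := ae_lt_top' (AEMeasurable.tsum hmeas) htr
  -- `IsDensity` requires positivity at every point, so the value `0` is taken where the matrix is
  -- not positive or its trace is infinite.
  have hex : ∀ l, ∃ F : TraceClass H H, F.toCLM.IsPositive ∧
      ((∀ t, (ofMatrix b (fun j k => a j k l) t).toCLM.IsPositive) →
        ∑' k, ENNReal.ofReal (a k k l).re < ∞ →
        Tendsto (ofMatrix b fun j k => a j k l) atTop (𝓝 F) ∧
          ‖F‖ₑ ≤ ∑' k, ENNReal.ofReal (a k k l).re) := by
    intro l
    by_cases h : (∀ t, (ofMatrix b (fun j k => a j k l) t).toCLM.IsPositive) ∧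
        ∑' k, ENNReal.ofReal (a k k l).re < ∞
    · obtain ⟨F, h1, h2, h3⟩ := exists_tendsto_ofMatrix h.1 h.2.ne
      exact ⟨F, h2, fun _ _ => ⟨h1, h3⟩⟩
    · exact ⟨0, ContinuousLinearMap.isPositive_zero, fun h1 h2 => absurd ⟨h1, h2⟩ h⟩
  choose f hf hf' using hex
  have hlim : ∀ᵐ l ∂ν.variation, Tendsto (ofMatrix b fun j k => a j k l) atTop (𝓝 (f l)) ∧
      ‖f l‖ₑ ≤ ∑' k, ENNReal.ofReal (a k k l).re := by
    filter_upwards [hpos, hfin] with l h1 h2 using hf' l h1 h2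
  have hint : Integrable f ν.variation := by
    refine ⟨aestronglyMeasurable_of_tendsto_ae atTop
      (f := fun (t : Finset w) l => ofMatrix b (fun j k => a j k l) t) (fun t => ?_)
      (hlim.mono fun l hl => hl.1), ?_⟩
    · exact Finset.aestronglyMeasurable_fun_sum _ fun j _ =>
        Finset.aestronglyMeasurable_fun_sum _ fun k _ => (ha j k).1.smul_const _
    · exact (lintegral_mono_ae (hlim.mono fun l hl => hl.2)).trans_lt htr.lt_top
  refine ⟨f, hint, hf, fun A hA => ext_basis b b fun j k => ?_⟩
  rw [← (coeff (b j) (b k)).integral_comp_comm hint.integrableOn, ← ha' j k A hA]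
  refine integral_congr_ae (ae_restrict_of_ae ?_)
  filter_upwards [hlim] with l hl
  refine tendsto_nhds_unique (tendsto_const_nhds.congr' ?_)
    (((coeff (b j) (b k)).continuous.tendsto (f l)).comp hl.1)
  -- The entry `(j, k)` of a section is constant as soon as the section contains both indices.
  filter_upwards [eventually_ge_atTop {j, k}] with t ht
  rw [Function.comp_apply, coeff_apply, inner_ofMatrix_basis,
    if_pos ⟨ht (by simp), ht (by simp)⟩]

/-- The default value `0` in the definition of `density` is never used. -/
lemma isDensity_density (ν : TraceClassPOVM Λ H) : ν.IsDensity ν.density := by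
  unfold density
  rw [dif_pos ν.exists_isDensity]
  exact ν.exists_isDensity.choose_spec

end TraceClassPOVM

end Density


/-! ### Gramian coefficients in vector-valued `L²` spaces as scalar products. -/

section LpRankOne

variable {X : Type*} [MeasurableSpace X] {m : Measure X} {G : Type*}
  [NormedAddCommGroup G] [InnerProductSpace ℂ G] [CompleteSpace G]

/-- The right-hand side is the coefficient at `(x, y)` of the Gramian `∫ F ⊗ K`. Acting by rank-one
operators thus recovers the whole Gramian from the scalar product. -/
lemma inner_rankOne_smul (x y : G) (F K : Lp G 2 m) :
    ⟪InnerProductSpace.rankOne ℂ x y • K, F⟫_ℂ =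
      ∫ t, ⟪x, F t⟫_ℂ * (starRingEnd ℂ) ⟪y, K t⟫_ℂ ∂m := by
  rw [L2.inner_def]
  refine integral_congr_ae ?_
  filter_upwards [Lp.coeFn_smul (InnerProductSpace.rankOne ℂ x y) K] with t ht
  rw [ht]
  change ⟪⟪y, K t⟫_ℂ • x, F t⟫_ℂ = _
  rw [inner_smul_left, mul_comm]

lemma integrable_inner_mul_conj (x y : G) (F K : Lp G 2 m) :
    Integrable (fun t => ⟪x, F t⟫_ℂ * (starRingEnd ℂ) ⟪y, K t⟫_ℂ) m := by
  refine (L2.integrable_inner (𝕜 := ℂ) (InnerProductSpace.rankOne ℂ x y • K) F).congr ?_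
  filter_upwards [Lp.coeFn_smul (InnerProductSpace.rankOne ℂ x y) K] with t ht
  rw [ht]
  change ⟪⟪y, K t⟫_ℂ • x, F t⟫_ℂ = _
  rw [inner_smul_left, mul_comm]

lemma enorm_Lp_two_sq (F : Lp G 2 m) : ‖F‖ₑ ^ 2 = ∫⁻ t, ‖F t‖ₑ ^ 2 ∂m := by
  rw [Lp.enorm_def, eLpNorm_eq_lintegral_rpow_enorm_toReal (by simp) (by simp), ← ENNReal.rpow_two,
    ← ENNReal.rpow_mul]
  simp

/-- The squared norm is the trace of the Gramian: Parseval in `G` under the integral, then exchange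
of the sum and the integral of nonnegative terms. -/
lemma enorm_sq_eq_tsum_rankOne [TopologicalSpace.SeparableSpace G] {ι : Type*}
    [Countable ι] (g : HilbertBasis ι ℂ G) (F : Lp G 2 m) : ‖F‖ₑ ^ 2 =
      ∑' i, ENNReal.ofReal (⟪InnerProductSpace.rankOne ℂ (g i) (g i) • F, F⟫_ℂ).re := by
  have h : ∀ i, AEMeasurable (fun t => ‖⟪g i, F t⟫_ℂ‖ₑ ^ 2) m := fun i =>
    (aestronglyMeasurable_const.inner (Lp.aestronglyMeasurable F)).enorm.pow_const 2
  rw [enorm_Lp_two_sq]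
  simp only [enorm_sq_eq_tsum g]
  rw [lintegral_tsum h]
  refine tsum_congr fun i => ?_
  have h1 : ∀ t, ⟪g i, F t⟫_ℂ * (starRingEnd ℂ) ⟪g i, F t⟫_ℂ = ((‖⟪g i, F t⟫_ℂ‖ ^ 2 : ℝ) : ℂ) :=
    fun t => by rw [RCLike.mul_conj]; norm_cast
  have h2 := integrable_inner_mul_conj (g i) (g i) F F
  rw [inner_rankOne_smul]
  simp only [h1] at h2 ⊢
  rw [integral_complex_ofReal, Complex.ofReal_re, ofReal_integral_eq_lintegral_ofReal]
  · simp only [ENNReal.ofReal_pow (norm_nonneg _), ofReal_norm]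
  · exact h2.re
  · exact Eventually.of_forall fun t => by positivity

/-- The norm of an element of `L²` is determined by its Gramian. -/
lemma norm_eq_of_inner_rankOne_smul [TopologicalSpace.SeparableSpace G]
    {Y : Type*} [MeasurableSpace Y] {n : Measure Y} {F : Lp G 2 m} {K : Lp G 2 n}
    (h : ∀ x : G, ⟪InnerProductSpace.rankOne ℂ x x • F, F⟫_ℂ =
      ⟪InnerProductSpace.rankOne ℂ x x • K, K⟫_ℂ) : ‖F‖ = ‖K‖ := by
  obtain ⟨w, g, hw⟩ := exists_countable_hilbertBasis G
  have : Countable w := hw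
  have h1 : ‖F‖ₑ ^ 2 = ‖K‖ₑ ^ 2 := by
    rw [enorm_sq_eq_tsum_rankOne g, enorm_sq_eq_tsum_rankOne g]
    simp only [h]
  have h2 := congrArg ENNReal.toReal h1
  simp only [ENNReal.toReal_pow, toReal_enorm] at h2
  exact (sq_eq_sq₀ (norm_nonneg _) (norm_nonneg _)).1 h2

end LpRankOne

/-! ### Products with the counting measure on a countable set. -/

section ProdCount

variable {Λ ι : Type*} [MeasurableSpace Λ] [Countable ι] [MeasurableSpace ι]
  [MeasurableSingletonClass ι] {μ : Measure Λ} [SFinite μ]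

lemma ae_prod_count_iff {p : Λ × ι → Prop} :
    (∀ᵐ z ∂μ.prod Measure.count, p z) ↔ ∀ᵐ l ∂μ, ∀ k, p (l, k) := by
  constructor
  · intro h
    filter_upwards [Measure.ae_ae_of_ae_prod h] with l hl
    exact Measure.ae_count_iff.1 hl
  · intro h
    filter_upwards [Measure.quasiMeasurePreserving_fst.ae h] with z hz using hz z.2

lemma aestronglyMeasurable_prod_count {G : Type*} [NormedAddCommGroup G]
    [TopologicalSpace.SeparableSpace G] {u : Λ → ι → G}
    (hu : ∀ k, AEStronglyMeasurable (fun l => u l k) μ) :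
    AEStronglyMeasurable (fun z : Λ × ι => u z.1 z.2) (μ.prod Measure.count) := by
  -- Each slice gets its own measurable version; countability of the index set makes the glued
  -- function measurable and the union of the exceptional sets null.
  refine ⟨fun z => (hu z.2).mk _ z.1, ?_, ?_⟩
  · borelize G
    have := UniformSpace.secondCountable_of_separable G
    exact (measurable_from_prod_countable_left fun k =>
      (hu k).stronglyMeasurable_mk.measurable).stronglyMeasurable
  · refine ae_prod_count_iff.2 (ae_all_iff.2 fun k => (hu k).ae_eq_mk)

lemma lintegral_prod_count {f : Λ × ι → ℝ≥0∞} (hf : AEMeasurable f (μ.prod Measure.count)) :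
    ∫⁻ z, f z ∂μ.prod Measure.count = ∫⁻ l, ∑' k, f (l, k) ∂μ := by
  rw [lintegral_prod _ hf]
  simp only [lintegral_count]

lemma integral_prod_count {f : Λ × ι → ℂ} (hf : Integrable f (μ.prod Measure.count)) :
    ∫ z, f z ∂μ.prod Measure.count = ∫ l, ∑' k, f (l, k) ∂μ := by
  rw [integral_prod _ hf]
  refine integral_congr_ae ?_
  filter_upwards [hf.prod_right_ae] with l hl
  rw [integral_countable hl]
  simp [measureReal_def]

end ProdCount


/-! ### Embedding of the operator-valued `L²` space into a Bochner space by coordinates. -/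

section Coordinates

open ContinuousLinearMap (adjoint)
open TraceClassPOVM

variable {Λ : Type*} [MeasurableSpace Λ] {H G : Type*}
  [NormedAddCommGroup H] [InnerProductSpace ℂ H] [CompleteSpace H]
  [TopologicalSpace.SeparableSpace H]
  [NormedAddCommGroup G] [InnerProductSpace ℂ G] [CompleteSpace G]
  [TopologicalSpace.SeparableSpace G]
  {ν : TraceClassPOVM Λ H}

namespace TraceClassPOVM

lemma adjoint_sqrtDensity (l : Λ) : adjoint (ν.sqrtDensity l) = ν.sqrtDensity l :=
  (IsSelfAdjoint.of_nonneg (CFC.sqrt_nonneg _)).star_eq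

open Classical in
lemma comp_indicatorFun (A : Set Λ) (T : H →L[ℂ] G) (l : Λ) :
    comp (indicatorFun A T l) (ν.sqrtDensity l) =
      (if l ∈ A then T else 0) ∘L ν.sqrtDensity l := by
  refine IsComp.comp_eq fun x => ?_
  by_cases h : l ∈ A
  · rw [show indicatorFun A T l = (T : H →ₗ[ℂ] G).toPMap ⊤ from if_pos h, if_pos h]
    exact ⟨Submodule.mem_top, rfl⟩
  · rw [show indicatorFun A T l = 0 from if_neg h, if_neg h]
    exact ⟨Submodule.mem_top, rfl⟩

end TraceClassPOVM

/-- Since `T = A R` with `A` linear, `T` vanishes on the kernel of `R`. It also vanishes on the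
range of `R`, and for self-adjoint `R` the kernel and the closed range span `H`. Concretely, `R Tᴴ =
(T R)ᴴ = 0` puts `Tᴴ y` in the kernel of `R`, whence `T Tᴴ y = 0` and `Tᴴ y = 0`. -/
lemma IsComp.eq_zero {A : H →ₗ.[ℂ] G} {R : H →L[ℂ] H} {T : H →L[ℂ] G} (h : IsComp A R T)
    (hR : adjoint R = R) (hT : T ∘L R = 0) : T = 0 := by
  have hker : ∀ x, R x = 0 → T x = 0 := by
    intro x hx
    obtain ⟨h1, h2⟩ := h x
    rw [← h2]
    have h3 : (⟨R x, h1⟩ : A.domain) = 0 := Subtype.ext hx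
    rw [h3]
    exact A.map_zero
  have hadj : adjoint T = 0 := by
    refine ContinuousLinearMap.ext fun y => ?_
    have h1 : R (adjoint T y) = 0 := by
      have h2 := congrArg (fun S : H →L[ℂ] G => adjoint S y) hT
      simpa [ContinuousLinearMap.adjoint_comp, hR] using h2
    have h2 := hker _ h1
    have h3 : ⟪adjoint T y, adjoint T y⟫_ℂ = 0 := by
      rw [ContinuousLinearMap.adjoint_inner_left, h2, inner_zero_right]
    exact inner_self_eq_zero.1 h3
  rw [← ContinuousLinearMap.adjoint_adjoint T, hadj, map_zero]

namespace L2

/-- The integrand does not depend on `A` and is integrable on all of `Λ`, so letting `A` vary tests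
one fixed function on every measurable set. -/
lemma inner_gram_mk_indicator {Φ : Λ → H →ₗ.[ℂ] G} (hΦ : ν.SqIntegrable Φ) {A : Set Λ}
    (hA : MeasurableSet A) (T : H →L[ℂ] G) (x y : G) :
    Integrable (fun l => ⟪x, comp (Φ l) (ν.sqrtDensity l) (ν.sqrtDensity l (adjoint T y))⟫_ℂ)
      ν.variation ∧
    ⟪x, (gram (mk Φ hΦ) (indicator ν A hA T)).toCLM y⟫_ℂ =
      ∫ l in A, ⟪x, comp (Φ l) (ν.sqrtDensity l) (ν.sqrtDensity l (adjoint T y))⟫_ℂ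
        ∂ν.variation := by
  classical
  constructor
  · refine (hΦ.inner_pairIntegral (sqIntegrable_indicatorFun MeasurableSet.univ T) x y).1.congr
      (Eventually.of_forall fun l => ?_)
    simp only [comp_indicatorFun, Set.mem_univ, if_true, ContinuousLinearMap.adjoint_comp,
      adjoint_sqrtDensity, ContinuousLinearMap.comp_apply, ContinuousLinearMap.adjoint_inner_left]
  · rw [indicator, gram_mk, (hΦ.inner_pairIntegral (sqIntegrable_indicatorFun hA T) x y).2,
      ← integral_indicator hA]
    refine integral_congr_ae (Eventually.of_forall fun l => ?_)
    simp only [comp_indicatorFun, ContinuousLinearMap.adjoint_comp, adjoint_sqrtDensity,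
      ContinuousLinearMap.comp_apply, ContinuousLinearMap.adjoint_inner_left, Set.indicator]
    split_ifs <;> simp

/-- An element which is Gramian-orthogonal to all indicators vanishes. -/
lemma eq_zero_of_gram_indicator {z : L2 ν G}
    (h : ∀ A (hA : MeasurableSet A) T, gram z (indicator ν A hA T) = 0) : z = 0 := by
  obtain ⟨Φ, hΦ, rfl⟩ := exists_mk z
  have h1 : ∀ (x : G) (y : H), ∀ᵐ l ∂ν.variation,
      ⟪x, comp (Φ l) (ν.sqrtDensity l) (ν.sqrtDensity l y)⟫_ℂ = 0 := by
    intro x y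
    rcases eq_or_ne x 0 with rfl | hx
    · simp
    -- The scaling is chosen so that `Tᴴ x = y`; hence any pair `(x, y)` with `x ≠ 0` can be tested.
    let T : H →L[ℂ] G := InnerProductSpace.rankOne ℂ (((‖x‖ ^ 2 : ℝ) : ℂ)⁻¹ • x) y
    have hT : adjoint T x = y := by
      simp only [T, InnerProductSpace.adjoint_rankOne, InnerProductSpace.rankOne_apply,
        inner_smul_left, inner_self_eq_norm_sq_to_K]
      simp [hx]
    have h2 := inner_gram_mk_indicator hΦ MeasurableSet.univ T x x
    rw [hT] at h2
    refine h2.1.ae_eq_zero_of_forall_setIntegral_eq_zero fun A hA _ => ?_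
    have h3 := (inner_gram_mk_indicator hΦ hA T x x).2
    rw [hT, h A hA T, TraceClass.toCLM_zero, zero_apply, inner_zero_right] at h3
    exact h3.symm
  obtain ⟨w, b, hw⟩ := exists_countable_hilbertBasis H
  obtain ⟨w', c, hw'⟩ := exists_countable_hilbertBasis G
  have : Countable w := hw
  have : Countable w' := hw'
  -- Countable bases of both spaces leave a single null set, outside which `(Φ f^(1/2)) f^(1/2)` is
  -- the zero operator.
  have h2 := ae_all_iff.2 fun j => ae_all_iff.2 fun k => h1 (c j) (b k)
  rw [zero_def, mk_eq_mk]
  filter_upwards [h2, hΦ.ae_comp] with l hl hc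
  rw [comp_zero]
  refine hc.1.eq_zero (adjoint_sqrtDensity l) (clm_ext_basis b c fun j k => ?_)
  rw [zero_apply, inner_zero_right]
  exact hl j k

/-- The Gramian of two indicators. -/
lemma inner_gram_indicator {A B : Set Λ} (hA : MeasurableSet A) (hB : MeasurableSet B)
    (S T : H →L[ℂ] G) (x y : G) :
    ⟪x, (gram (indicator ν A hA S) (indicator ν B hB T)).toCLM y⟫_ℂ =
      ⟪adjoint S x, (ν.toVectorMeasure (A ∩ B)).toCLM (adjoint T y)⟫_ℂ := by
  classical
  have h1 := (inner_gram_mk_indicator (sqIntegrable_indicatorFun (ν := ν) hA S) hB T x y).2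
  refine h1.trans ?_
  have hd := ν.isDensity_density
  rw [hd.eq_integral _ (hA.inter hB), TraceClass.inner_integral hd.integrable.integrableOn,
    Set.inter_comm, ← setIntegral_indicator hA]
  refine integral_congr_ae (Eventually.of_forall fun l => ?_)
  have h2 : ν.sqrtDensity l (ν.sqrtDensity l (adjoint T y)) =
      (ν.density l).toCLM (adjoint T y) := by
    rw [← ν.sqrtDensity_comp_adjoint, adjoint_sqrtDensity]
    rfl
  simp only [comp_indicatorFun, ContinuousLinearMap.comp_apply, h2, Set.indicator,
    ContinuousLinearMap.adjoint_inner_left]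
  split_ifs <;> simp

variable {ι : Type*} [Countable ι] [MeasurableSpace ι] [MeasurableSingletonClass ι]
  (b : HilbertBasis ι ℂ H)

/-- Summed over the basis, the squared coordinates give the squared Hilbert-Schmidt norm of `Φ
f^(1/2)`, which is at most the trace norm of `(Φ f^(1/2)) (Φ f^(1/2))ᴴ`, an integrable function. -/
lemma memLp_coord {Φ : Λ → H →ₗ.[ℂ] G} (hΦ : ν.SqIntegrable Φ) :
    MemLp (fun z : Λ × ι => comp (Φ z.1) (ν.sqrtDensity z.1) (b z.2)) 2
      (ν.variation.prod Measure.count) := by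
  have hm := aestronglyMeasurable_prod_count fun k => aestronglyMeasurable_comp
    hΦ.oMeasurable_left (hΦ.ae_comp.mono fun _ h => h.1) (b k)
  refine ⟨hm, ?_⟩
  rw [eLpNorm_lt_top_iff_lintegral_rpow_enorm_lt_top (by simp) (by simp)]
  simp only [ENNReal.toReal_ofNat, ENNReal.rpow_two]
  rw [lintegral_prod_count (hm.enorm.pow_const 2)]
  refine (lintegral_mono_ae ?_).trans_lt hΦ.integrable.2
  filter_upwards [hΦ.hsNormSq_le] with l hl
  rwa [← hsNormSq_eq_tsum _ b]

/-- The coordinates of an element of `L²(Λ, 𝒪(H, G), ν)` with respect to the basis `b`. -/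
noncomputable def toLp :
    L2 ν G →ₗ[G →L[ℂ] G] Lp G 2 (ν.variation.prod (Measure.count : Measure ι)) where
  toFun := Quotient.lift (fun Φ => (memLp_coord b Φ.2).toLp _) (by
    intro Φ Ψ h
    refine (MemLp.toLp_eq_toLp_iff _ _).2 (ae_prod_count_iff.2 ?_)
    filter_upwards [SqFun.equiv_iff.1 h] with l hl k
    rw [hl])
  map_add' x y := by
    obtain ⟨Φ, hΦ, rfl⟩ := exists_mk x
    obtain ⟨Ψ, hΨ, rfl⟩ := exists_mk y
    refine Eq.trans ?_ (MemLp.toLp_add (memLp_coord b hΦ) (memLp_coord b hΨ))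
    refine (MemLp.toLp_eq_toLp_iff _ _).2 (ae_prod_count_iff.2 ?_)
    filter_upwards [ae_comp_add hΦ hΨ] with l hl k
    simp only [hl, add_apply, Pi.add_apply]
  map_smul' S x := by
    obtain ⟨Φ, hΦ, rfl⟩ := exists_mk x
    refine Eq.trans ?_ (MemLp.toLp_const_smul S (memLp_coord b hΦ))
    refine (MemLp.toLp_eq_toLp_iff _ _).2 (ae_prod_count_iff.2 ?_)
    filter_upwards [ae_comp_smul S hΦ] with l hl k
    simp only [hl, Pi.smul_apply]
    rfl

lemma coeFn_toLp_mk {Φ : Λ → H →ₗ.[ℂ] G} (hΦ : ν.SqIntegrable Φ) :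
    ∀ᵐ l ∂ν.variation, ∀ k, toLp b (mk Φ hΦ) (l, k) = comp (Φ l) (ν.sqrtDensity l) (b k) :=
  ae_prod_count_iff.1 (MemLp.coeFn_toLp (memLp_coord b hΦ))

/-- Parseval in `H` sums the coordinates to `⟪(Φ f^(1/2))ᴴ x, (Ψ f^(1/2))ᴴ y⟫`. Hence taking
coordinates preserves Gramians. -/
lemma inner_rankOne_smul_toLp (x y : G) (u v : L2 ν G) :
    ⟪InnerProductSpace.rankOne ℂ x y • toLp b v, toLp b u⟫_ℂ = ⟪x, (gram u v).toCLM y⟫_ℂ := by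
  obtain ⟨Φ, hΦ, rfl⟩ := exists_mk u
  obtain ⟨Ψ, hΨ, rfl⟩ := exists_mk v
  rw [gram_mk, (hΦ.inner_pairIntegral hΨ x y).2, inner_rankOne_smul,
    integral_prod_count (integrable_inner_mul_conj x y _ _)]
  refine integral_congr_ae ?_
  filter_upwards [coeFn_toLp_mk b hΦ, coeFn_toLp_mk b hΨ] with l h1 h2
  rw [← (b.hasSum_inner_mul_inner _ _).tsum_eq]
  refine tsum_congr fun k => ?_
  rw [h1, h2, ContinuousLinearMap.adjoint_inner_left, ContinuousLinearMap.adjoint_inner_right,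
    inner_conj_symm]

lemma toLp_injective : Function.Injective (toLp b : L2 ν G → _) := by
  rw [injective_iff_map_eq_zero]
  intro z hz
  refine (isGramian_gram.self_eq_zero z).1 (TraceClass.toCLM_injective ?_)
  refine ContinuousLinearMap.ext fun y => ext_inner_left ℂ fun x => ?_
  rw [← inner_rankOne_smul_toLp b, hz, inner_zero_right, TraceClass.toCLM_zero, zero_apply,
    inner_zero_right]

lemma smul_indicator {A : Set Λ} (hA : MeasurableSet A) (S : G →L[ℂ] G) (T : H →L[ℂ] G) :
    S • indicator ν A hA T = indicator ν A hA (S ∘L T) := by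
  classical
  rw [indicator, smul_mk, indicator, mk_eq_mk]
  filter_upwards [ae_comp_smul S (sqIntegrable_indicatorFun (ν := ν) hA T)] with l hl
  rw [hl, comp_indicatorFun, comp_indicatorFun, ← ContinuousLinearMap.comp_assoc]
  split_ifs <;> simp

/-- If `toLp b z` is orthogonal to the indicators, then `z = 0`. -/
lemma eq_zero_of_inner_toLp_indicator {z : L2 ν G}
    (h : ∀ A (hA : MeasurableSet A) T, ⟪toLp b (indicator ν A hA T), toLp b z⟫_ℂ = 0) :
    z = 0 := by
  refine eq_zero_of_gram_indicator fun A hA T => TraceClass.toCLM_injective ?_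
  refine ContinuousLinearMap.ext fun y => ext_inner_left ℂ fun x => ?_
  -- The rank-one action maps indicators to indicators, so scalar orthogonality to all of them
  -- already gives Gramian-orthogonality.
  rw [← inner_rankOne_smul_toLp b, ← map_smul, smul_indicator, h, TraceClass.toCLM_zero,
    zero_apply, inner_zero_right]

end L2

end Coordinates


/-! ### Completeness: limits of functions with bounded values. -/

section Closedness

open ContinuousLinearMap (adjoint)
open TraceClassPOVM

section Limits

variable {H G : Type*}
  [NormedAddCommGroup H] [InnerProductSpace ℂ H]
  [NormedAddCommGroup G] [InnerProductSpace ℂ G]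

/-- The pointwise limit of a sequence of bounded operators, on the subspace of all vectors at
which it converges. -/
noncomputable def limitPMap (τ : ℕ → H →L[ℂ] G) : H →ₗ.[ℂ] G where
  domain :=
    { carrier := {x | ∃ y, Tendsto (fun n => τ n x) atTop (𝓝 y)}
      zero_mem' := ⟨0, by simp⟩
      add_mem' := fun {x x'} ⟨y, hy⟩ ⟨y', hy'⟩ => ⟨y + y', by simpa using hy.add hy'⟩
      smul_mem' := fun c x ⟨y, hy⟩ => ⟨c • y, by simpa using hy.const_smul c⟩ }
  toFun :=
    { toFun := fun x => x.2.choose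
      map_add' := fun x y => tendsto_nhds_unique (x + y).2.choose_spec <| by
        simpa using x.2.choose_spec.add y.2.choose_spec
      map_smul' := fun c x => tendsto_nhds_unique (c • x).2.choose_spec <| by
        simpa using x.2.choose_spec.const_smul c }

lemma tendsto_limitPMap (τ : ℕ → H →L[ℂ] G) (x : (limitPMap τ).domain) :
    Tendsto (fun n => τ n x) atTop (𝓝 (limitPMap τ x)) :=
  x.2.choose_spec

lemma isComp_limitPMap {τ : ℕ → H →L[ℂ] G} {R : H →L[ℂ] H} {T : H →L[ℂ] G}
    (h : ∀ x, Tendsto (fun n => τ n (R x)) atTop (𝓝 (T x))) : IsComp (limitPMap τ) R T :=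
  fun x => ⟨⟨_, h x⟩, tendsto_nhds_unique (tendsto_limitPMap τ ⟨R x, _, h x⟩) (h x)⟩

/-- Taking the full set of convergence as domain makes the measurability of domains that of the
convergence set of a sequence of measurable functions into a complete space. -/
lemma oMeasurable_limitPMap {Λ : Type*} [MeasurableSpace Λ] [CompleteSpace G]
    {τ : ℕ → Λ → H →L[ℂ] G} (hτ : ∀ n x, StronglyMeasurable fun l => τ n l x) :
    OMeasurable fun l => limitPMap fun n => τ n l :=
  ⟨fun x => StronglyMeasurable.measurableSet_exists_tendsto fun n => hτ n x,
    τ, hτ, fun l x => tendsto_limitPMap (fun n => τ n l) x⟩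

lemma enorm_sq_le_hsNormSq (T : H →L[ℂ] G) : ‖T‖ₑ ^ 2 ≤ hsNormSq T := by
  by_cases htop : hsNormSq T = ∞
  · simp [htop]
  have h1 : ‖T‖ ≤ √(hsNormSq T).toReal := by
    refine T.opNorm_le_of_unit_norm (Real.sqrt_nonneg _) fun x hx => ?_
    have h2 := sum_le_hsNormSq T (e := fun _ : Fin 1 => x)
      ⟨fun _ => hx, fun i j hij => absurd (Subsingleton.elim i j) hij⟩ Finset.univ
    have h3 := ENNReal.toReal_mono htop h2
    refine Real.le_sqrt_of_sq_le ?_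
    simpa using h3
  rw [← ofReal_norm, ← ENNReal.ofReal_pow (norm_nonneg _), ← ENNReal.ofReal_toReal htop]
  exact ENNReal.ofReal_le_ofReal ((Real.le_sqrt (norm_nonneg _) ENNReal.toReal_nonneg).1 h1)

end Limits

variable {H G : Type*}
  [NormedAddCommGroup H] [InnerProductSpace ℂ H] [CompleteSpace H]
  [NormedAddCommGroup G] [InnerProductSpace ℂ G] [CompleteSpace G]

/-- Operators whose coordinates converge in square sum converge in norm. -/
lemma exists_tendsto_of_tendsto_coord {ι : Type*} (b : HilbertBasis ι ℂ H) {T : ℕ → H →L[ℂ] G}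
    {y : ι → G} (h : Tendsto (fun n => ∑' k, ‖y k - T n (b k)‖ₑ ^ 2) atTop (𝓝 0)) :
    ∃ S : H →L[ℂ] G, Tendsto T atTop (𝓝 S) ∧ ∀ k, S (b k) = y k := by
  have hle : ∀ n m, ‖T n - T m‖ₑ ^ 2 ≤
      2 * ∑' k, ‖y k - T n (b k)‖ₑ ^ 2 + 2 * ∑' k, ‖y k - T m (b k)‖ₑ ^ 2 := by
    intro n m
    refine (enorm_sq_le_hsNormSq _).trans ?_
    rw [hsNormSq_eq_tsum _ b, ← ENNReal.tsum_mul_left, ← ENNReal.tsum_mul_left, ← ENNReal.tsum_add]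
    refine ENNReal.tsum_le_tsum fun k => ?_
    have h1 : ‖(T n - T m) (b k)‖ ^ 2 ≤
        2 * ‖y k - T n (b k)‖ ^ 2 + 2 * ‖y k - T m (b k)‖ ^ 2 := by
      have h2 : (T n - T m) (b k) = (y k - T m (b k)) - (y k - T n (b k)) := by
        rw [sub_apply]
        abel
      have h3 := norm_sub_le (y k - T m (b k)) (y k - T n (b k))
      rw [← h2] at h3
      nlinarith [norm_nonneg ((T n - T m) (b k)),
        sq_nonneg (‖y k - T n (b k)‖ - ‖y k - T m (b k)‖)]
    have h4 := ENNReal.ofReal_le_ofReal h1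
    rw [ENNReal.ofReal_add (by positivity) (by positivity), ENNReal.ofReal_mul (by norm_num),
      ENNReal.ofReal_mul (by norm_num), ENNReal.ofReal_pow (norm_nonneg _),
      ENNReal.ofReal_pow (norm_nonneg _), ENNReal.ofReal_pow (norm_nonneg _)] at h4
    simpa [ofReal_norm] using h4
  have hcauchy : CauchySeq T := by
    refine EMetric.cauchySeq_iff.2 fun ε hε => ?_
    obtain ⟨N, hN⟩ := eventually_atTop.1
      -- `hle` bounds the squared distance by two terms with a factor `2` each, so `ε ^ 2 / 4` for
      -- each tail adds up to `ε ^ 2`.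
      ((tendsto_order.1 h).2 (ε ^ 2 / 4) (ENNReal.div_pos (by positivity) (by simp)))
    refine ⟨N, fun n hn m hm => ?_⟩
    rw [edist_eq_enorm_sub]
    refine lt_of_not_ge fun hge => ((hle n m).trans_lt ?_).not_ge (pow_le_pow_left' hge 2)
    refine (ENNReal.add_lt_add ((ENNReal.mul_lt_mul_iff_right (by simp) (by simp)).2 (hN n hn))
      ((ENNReal.mul_lt_mul_iff_right (by simp) (by simp)).2 (hN m hm))).trans_eq ?_
    rw [← two_mul, ← mul_assoc, show (2 * 2 : ℝ≥0∞) = 4 by norm_num,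
      ENNReal.mul_div_cancel (by simp) (by simp)]
  obtain ⟨S, hS⟩ := cauchySeq_tendsto_of_complete hcauchy
  refine ⟨S, hS, fun k => ?_⟩
  have h1 : Tendsto (fun n => T n (b k)) atTop (𝓝 (S (b k))) :=
    ((ContinuousLinearMap.apply ℂ G (b k)).continuous.tendsto S).comp hS
  have h2 : Tendsto (fun n => ‖y k - T n (b k)‖ₑ ^ 2) atTop (𝓝 0) :=
    tendsto_of_tendsto_of_tendsto_of_le_of_le tendsto_const_nhds h (fun _ => zero_le)
      fun n => ENNReal.le_tsum (f := fun k => ‖y k - T n (b k)‖ₑ ^ 2) k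
  have h3 : Tendsto (fun n => ‖y k - T n (b k)‖ₑ ^ 2) atTop (𝓝 (‖y k - S (b k)‖ₑ ^ 2)) :=
    ((ENNReal.continuous_pow 2).tendsto _).comp
      ((continuous_enorm.tendsto _).comp (tendsto_const_nhds.sub h1))
  have h4 := tendsto_nhds_unique h3 h2
  rw [pow_eq_zero_iff two_ne_zero, enorm_eq_zero, sub_eq_zero] at h4
  exact h4.symm

variable {Λ : Type*} [MeasurableSpace Λ] [TopologicalSpace.SeparableSpace H]
  [TopologicalSpace.SeparableSpace G] {ν : TraceClassPOVM Λ H}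
  {ι : Type*} [Countable ι] [MeasurableSpace ι] [MeasurableSingletonClass ι]
  (b : HilbertBasis ι ℂ H)

namespace L2

variable (ν G) in
/-- The coordinates of the functions with values in the bounded operators. -/
def boundedCoord : Submodule ℂ (Lp G 2 (ν.variation.prod (Measure.count : Measure ι))) where
  carrier := {y | ∃ τ : Λ → H →L[ℂ] G, (∀ x, StronglyMeasurable fun l => τ l x) ∧
    ∀ᵐ l ∂ν.variation, ∀ k, y (l, k) = τ l (ν.sqrtDensity l (b k))}
  zero_mem' := by
    refine ⟨0, fun x => stronglyMeasurable_zero, ?_⟩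
    filter_upwards [ae_prod_count_iff.1 (Lp.coeFn_zero G 2
      (ν.variation.prod (Measure.count : Measure ι)))] with l hl k
    rw [hl]
    rfl
  add_mem' := by
    rintro y y' ⟨τ, h1, h2⟩ ⟨τ', h1', h2'⟩
    refine ⟨τ + τ', fun x => (h1 x).add (h1' x), ?_⟩
    filter_upwards [ae_prod_count_iff.1 (Lp.coeFn_add y y'), h2, h2'] with l hl h3 h4 k
    rw [hl, Pi.add_apply, h3, h4]
    rfl
  smul_mem' := by
    rintro c y ⟨τ, h1, h2⟩
    refine ⟨c • τ, fun x => (h1 x).const_smul c, ?_⟩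
    filter_upwards [ae_prod_count_iff.1 (Lp.coeFn_smul c y), h2] with l hl h3 k
    rw [hl, Pi.smul_apply, h3]
    rfl

lemma toLp_indicator_mem_boundedCoord {A : Set Λ} (hA : MeasurableSet A) (T : H →L[ℂ] G) :
    toLp b (indicator ν A hA T) ∈ boundedCoord G ν b := by
  classical
  refine ⟨fun l => if l ∈ A then T else 0, fun x => ?_, ?_⟩
  · have : (fun l => (if l ∈ A then T else 0 : H →L[ℂ] G) x) =
        fun l => if l ∈ A then T x else 0 := by
      funext l
      split_ifs <;> rfl
    rw [this]
    exact stronglyMeasurable_const.ite hA stronglyMeasurable_const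
  · filter_upwards [coeFn_toLp_mk b (sqIntegrable_indicatorFun (ν := ν) hA T)] with l hl k
    refine (hl k).trans ?_
    rw [comp_indicatorFun]
    rfl

/-- The limits of functions with values in the bounded operators belong to
`L²(Λ, 𝒪(H, G), ν)`. -/
lemma exists_toLp_eq {y : Lp G 2 (ν.variation.prod (Measure.count : Measure ι))}
    (hy : y ∈ (boundedCoord G ν b).topologicalClosure) : ∃ z, toLp b z = y := by
  -- The geometric rate makes the squared errors summable, so the coordinates converge in square sum
  -- at almost every point without extracting a subsequence.
  have hex : ∀ n : ℕ, ∃ p ∈ boundedCoord G ν b, ‖y - p‖ₑ ^ 2 ≤ (2⁻¹ : ℝ≥0∞) ^ n := by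
    intro n
    have hpos : (0 : ℝ≥0∞) < (2⁻¹ : ℝ≥0∞) ^ n := ENNReal.pow_pos (by simp) n
    have hcont : Continuous fun p => ‖y - p‖ₑ ^ 2 :=
      (ENNReal.continuous_pow 2).comp (continuous_enorm.comp (continuous_const.sub continuous_id))
    obtain ⟨p, hp, hp'⟩ := mem_closure_iff.1 hy {p | ‖y - p‖ₑ ^ 2 < (2⁻¹ : ℝ≥0∞) ^ n}
      (isOpen_lt hcont continuous_const) (by simpa using hpos)
    exact ⟨p, hp', le_of_lt hp⟩
  choose p hp hpy using hex
  choose τ hτ hτp using hp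
  have hmeas : ∀ q : Lp G 2 (ν.variation.prod (Measure.count : Measure ι)),
      AEMeasurable (fun z => ‖q z‖ₑ ^ 2) (ν.variation.prod Measure.count) := fun q =>
    (Lp.aestronglyMeasurable q).enorm.pow_const 2
  have hmeas' : ∀ q : Lp G 2 (ν.variation.prod (Measure.count : Measure ι)),
      AEMeasurable (fun l => ∑' k, ‖q (l, k)‖ₑ ^ 2) ν.variation := by
    intro q
    have h1 := (hmeas q).lintegral_prod_right'
    simpa only [lintegral_count] using h1
  have hint : ∀ q : Lp G 2 (ν.variation.prod (Measure.count : Measure ι)),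
      ∫⁻ l, ∑' k, ‖q (l, k)‖ₑ ^ 2 ∂ν.variation = ‖q‖ₑ ^ 2 := fun q => by
    rw [enorm_Lp_two_sq, lintegral_prod_count (hmeas q)]
  have hsum : ∀ᵐ l ∂ν.variation, ∑' n, ∑' k, ‖(y - p n) (l, k)‖ₑ ^ 2 < ∞ := by
    refine ae_lt_top' (AEMeasurable.tsum fun n => hmeas' (y - p n)) ?_
    rw [lintegral_tsum fun n => hmeas' (y - p n)]
    simp only [hint]
    refine ne_top_of_le_ne_top ?_ (ENNReal.tsum_le_tsum hpy)
    rw [ENNReal.tsum_geometric]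
    simp
  have hfin : ∀ᵐ l ∂ν.variation, ∑' k, ‖y (l, k)‖ₑ ^ 2 < ∞ := by
    refine ae_lt_top' (hmeas' y) ?_
    rw [hint]
    simp
  -- Only the products `τ n l ∘L ν.sqrtDensity l` are known to converge in norm, for almost every
  -- `l`. The `τ n l` themselves may diverge off the range of `ν.sqrtDensity l`, hence a limit with
  -- a domain.
  let Φ : Λ → H →ₗ.[ℂ] G := fun l => limitPMap fun n => τ n l
  have hΦm : OMeasurable Φ := oMeasurable_limitPMap hτ
  have hcomp : ∀ᵐ l ∂ν.variation, IsComp (Φ l) (ν.sqrtDensity l) (comp (Φ l) (ν.sqrtDensity l)) ∧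
      ∀ k, comp (Φ l) (ν.sqrtDensity l) (b k) = y (l, k) := by
    filter_upwards [hsum, ae_all_iff.2 hτp,
      ae_all_iff.2 fun n => ae_prod_count_iff.1 (Lp.coeFn_sub y (p n))] with l h1 h2 h3
    have h4 : Tendsto (fun n => ∑' k, ‖y (l, k) - (τ n l ∘L ν.sqrtDensity l) (b k)‖ₑ ^ 2)
        atTop (𝓝 0) := by
      refine (ENNReal.tendsto_atTop_zero_of_tsum_ne_top h1.ne).congr fun n => ?_
      refine tsum_congr fun k => ?_
      rw [h3, Pi.sub_apply, h2]
      rfl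
    obtain ⟨S, hS, hS'⟩ := exists_tendsto_of_tendsto_coord b h4
    have h5 : IsComp (Φ l) (ν.sqrtDensity l) S := isComp_limitPMap fun x =>
      ((ContinuousLinearMap.apply ℂ G x).continuous.tendsto S).comp hS
    rw [h5.comp_eq]
    exact ⟨h5, hS'⟩
  have hhs : ∀ᵐ l ∂ν.variation,
      hsNormSq (comp (Φ l) (ν.sqrtDensity l)) = ∑' k, ‖y (l, k)‖ₑ ^ 2 := by
    filter_upwards [hcomp] with l hl
    rw [hsNormSq_eq_tsum _ b]
    simp only [hl.2]
  have hΦ : ν.SqIntegrable Φ := by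
    have hi : Integrable (fun l => (∑' k, ‖y (l, k)‖ₑ ^ 2).toReal) ν.variation :=
      integrable_toReal_of_lintegral_ne_top (hmeas' y) (by rw [hint]; simp)
    refine isIntegrablePair_of_le hΦm hΦm (hcomp.mono fun l hl => hl.1)
      (hcomp.mono fun l hl => hl.1) (hi.const_mul 2) ?_
    filter_upwards [hhs, hfin] with l h1 h2
    rw [h1, ENNReal.ofReal_mul (by norm_num), ENNReal.ofReal_toReal h2.ne, ← two_mul]
    simp
  refine ⟨mk Φ hΦ, Lp.ext (ae_prod_count_iff.2 ?_)⟩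
  filter_upwards [coeFn_toLp_mk b hΦ, hcomp] with l h1 h2 k
  rw [h1, h2.2]

end L2

end Closedness


/-! ### Isometric linear relations and their closures. -/

section Graph

variable {E F : Type*}

/-- Lift an approximating sequence of `x` to `Γ`; equality of norms on differences makes the second
coordinates Cauchy. The companion lemma exchanges the factors and yields surjectivity. -/
lemma exists_mem_closure_of_norm_eq [NormedAddCommGroup E] [NormedSpace ℂ E]
    [NormedAddCommGroup F] [NormedSpace ℂ F] [CompleteSpace F] {Γ : Submodule ℂ (E × F)}
    (h : ∀ p ∈ Γ, ‖p.1‖ = ‖p.2‖) {x : E}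
    (hx : x ∈ (Γ.map (LinearMap.fst ℂ E F)).topologicalClosure) :
    ∃ y, (x, y) ∈ Γ.topologicalClosure := by
  obtain ⟨u, hu, hux⟩ := mem_closure_iff_seq_limit.1 hx
  choose p hp hpu using hu
  have h1 : Tendsto (fun n => (p n).1) atTop (𝓝 x) := hux.congr fun n => (hpu n).symm
  have h2 : CauchySeq fun n => (p n).2 := by
    refine Metric.cauchySeq_iff.2 fun ε hε => ?_
    obtain ⟨N, hN⟩ := Metric.cauchySeq_iff.1 h1.cauchySeq ε hε
    refine ⟨N, fun m hm n hn => ?_⟩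
    have h3 := hN m hm n hn
    rw [dist_eq_norm] at h3 ⊢
    exact (h _ (Γ.sub_mem (hp m) (hp n))).symm.trans_lt h3
  obtain ⟨y, hy⟩ := cauchySeq_tendsto_of_complete h2
  exact ⟨y, mem_closure_of_tendsto (h1.prodMk_nhds hy) (Eventually.of_forall hp)⟩

lemma exists_mem_closure_of_norm_eq' [NormedAddCommGroup E] [NormedSpace ℂ E] [CompleteSpace E]
    [NormedAddCommGroup F] [NormedSpace ℂ F] {Γ : Submodule ℂ (E × F)}
    (h : ∀ p ∈ Γ, ‖p.1‖ = ‖p.2‖) {y : F}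
    (hy : y ∈ (Γ.map (LinearMap.snd ℂ E F)).topologicalClosure) :
    ∃ x, (x, y) ∈ Γ.topologicalClosure := by
  obtain ⟨u, hu, huy⟩ := mem_closure_iff_seq_limit.1 hy
  choose p hp hpu using hu
  have h1 : Tendsto (fun n => (p n).2) atTop (𝓝 y) := huy.congr fun n => (hpu n).symm
  have h2 : CauchySeq fun n => (p n).1 := by
    refine Metric.cauchySeq_iff.2 fun ε hε => ?_
    obtain ⟨N, hN⟩ := Metric.cauchySeq_iff.1 h1.cauchySeq ε hε
    refine ⟨N, fun m hm n hn => ?_⟩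
    have h3 := hN m hm n hn
    rw [dist_eq_norm] at h3 ⊢
    exact (h _ (Γ.sub_mem (hp m) (hp n))).trans_lt h3
  obtain ⟨x, hx⟩ := cauchySeq_tendsto_of_complete h2
  exact ⟨x, mem_closure_of_tendsto (hx.prodMk_nhds h1) (Eventually.of_forall hp)⟩

lemma norm_eq_of_mem_closure [NormedAddCommGroup E] [NormedSpace ℂ E]
    [NormedAddCommGroup F] [NormedSpace ℂ F] {Γ : Submodule ℂ (E × F)}
    (h : ∀ p ∈ Γ, ‖p.1‖ = ‖p.2‖) : ∀ p ∈ Γ.topologicalClosure, ‖p.1‖ = ‖p.2‖ := by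
  have hcl : IsClosed {p : E × F | ‖p.1‖ = ‖p.2‖} := isClosed_eq (by fun_prop) (by fun_prop)
  exact hcl.closure_subset_iff.2 h

/-- Polarization: the four combinations of `p` and `q` remain in the subspace `Γ`. -/
lemma inner_eq_of_norm_eq [NormedAddCommGroup E] [InnerProductSpace ℂ E]
    [NormedAddCommGroup F] [InnerProductSpace ℂ F] {Γ : Submodule ℂ (E × F)}
    (h : ∀ p ∈ Γ, ‖p.1‖ = ‖p.2‖) {p q : E × F} (hp : p ∈ Γ) (hq : q ∈ Γ) :
    ⟪p.1, q.1⟫_ℂ = ⟪p.2, q.2⟫_ℂ := by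
  have h1 := h _ (Γ.add_mem hp hq)
  have h2 := h _ (Γ.sub_mem hp hq)
  have h3 := h _ (Γ.add_mem hp (Γ.smul_mem Complex.I hq))
  have h4 := h _ (Γ.sub_mem hp (Γ.smul_mem Complex.I hq))
  simp only [Prod.fst_add, Prod.snd_add, Prod.fst_sub, Prod.snd_sub, Prod.smul_fst,
    Prod.smul_snd] at h1 h2 h3 h4
  rw [inner_eq_sum_norm_sq_div_four p.1, inner_eq_sum_norm_sq_div_four p.2]
  simp only [RCLike.I_to_complex, h1, h2, h3, h4]

end Graph

/-! ### Centered random variables inside `L²(Ω, H)`. -/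

section CenteredSpace

open ContinuousLinearMap (adjoint)

variable {Ω : Type*} [MeasurableSpace Ω] {P : Measure Ω} [IsProbabilityMeasure P] {H G : Type*}
  [NormedAddCommGroup H] [InnerProductSpace ℂ H] [CompleteSpace H]
  [NormedAddCommGroup G] [InnerProductSpace ℂ G] [CompleteSpace G]

namespace Centered

/-- The expectation is continuous on `L²` of a probability space, and the set is its zero locus. -/
lemma isClosed_coe : IsClosed (Centered P H : Set (Lp H 2 P)) := by
  have hadd : ∀ X Y : Lp H 2 P, ∫ ω, (X + Y) ω ∂P = ∫ ω, X ω ∂P + ∫ ω, Y ω ∂P := by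
    intro X Y
    rw [integral_congr_ae (Lp.coeFn_add X Y)]
    exact integral_add ((Lp.memLp X).integrable (by norm_num))
      ((Lp.memLp Y).integrable (by norm_num))
  let F : Lp H 2 P →+ H := AddMonoidHom.mk' (fun X => ∫ ω, X ω ∂P) hadd
  have hF : Continuous F := by
    refine AddMonoidHomClass.continuous_of_bound F 1 fun X => ?_
    have h1 : ‖F X‖ₑ ≤ ‖X‖ₑ := by
      refine (enorm_integral_le_lintegral_enorm _).trans ?_
      rw [← eLpNorm_one_eq_lintegral_enorm, Lp.enorm_def]
      exact eLpNorm_le_eLpNorm_of_exponent_le (by norm_num) (Lp.aestronglyMeasurable X)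
    rw [one_mul]
    exact enorm_le_iff_norm_le.1 h1
  exact isClosed_singleton.preimage hF (t := {0})

lemma inner_rankOne_smul_eq_cov (x y : H) (X Y : Centered P H) :
    ⟪InnerProductSpace.rankOne ℂ x y • Y.1, X.1⟫_ℂ = ⟪x, (cov X Y).toCLM y⟫_ℂ := by
  rw [inner_rankOne_smul, inner_cov]

lemma inner_cov_map (S T : H →L[ℂ] G) (X Y : Centered P H) (x y : G) :
    ⟪x, (cov (map S X) (map T Y)).toCLM y⟫_ℂ = ⟪adjoint S x, (cov X Y).toCLM (adjoint T y)⟫_ℂ := by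
  rw [inner_cov, inner_cov]
  refine integral_congr_ae ?_
  filter_upwards [S.coeFn_compLp X.1, T.coeFn_compLp Y.1] with ω h1 h2
  have h1' : (map S X).1 ω = S (X.1 ω) := h1
  have h2' : (map T Y).1 ω = T (Y.1 ω) := h2
  rw [h1', h2', ContinuousLinearMap.adjoint_inner_left, ContinuousLinearMap.adjoint_inner_left]

lemma smul_map (S : G →L[ℂ] G) (T : H →L[ℂ] G) (X : Centered P H) :
    S • map T X = map (S ∘L T) X := by
  refine Subtype.ext (Lp.ext ?_)
  filter_upwards [Lp.coeFn_smul S (T.compLp X.1), T.coeFn_compLp X.1,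
    (S ∘L T).coeFn_compLp X.1] with ω h1 h2 h3
  refine h1.trans (Eq.trans ?_ h3.symm)
  rw [Pi.smul_apply, h2]
  rfl

end Centered

end CenteredSpace

/-! ### The closed graph of the stochastic integral. -/

section Isometry

open ContinuousLinearMap (adjoint)

variable {Λ Ω : Type*} [MeasurableSpace Λ] [MeasurableSpace Ω] {P : Measure Ω}
  [IsProbabilityMeasure P] {H G : Type*}
  [NormedAddCommGroup H] [InnerProductSpace ℂ H] [CompleteSpace H]
  [TopologicalSpace.SeparableSpace H]
  [NormedAddCommGroup G] [InnerProductSpace ℂ G] [CompleteSpace G]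
  [TopologicalSpace.SeparableSpace G]
  {ι : Type*} [Countable ι] [MeasurableSpace ι] [MeasurableSingletonClass ι]

namespace RandomCAGOS

variable (W : RandomCAGOS Λ P H)

/-- Split `A` into `A ∩ B` and `A \ B`: the second part is orthogonal to `W B`, and the first pairs
with `W B` as with itself. -/
lemma cov_eq_intensity {A B : Set Λ} (hA : MeasurableSet A) (hB : MeasurableSet B) :
    Centered.cov (W A) (W B) = W.intensity.toVectorMeasure (A ∩ B) := by
  have h1 : W.toVectorMeasure A = W.toVectorMeasure (A ∩ B) + W.toVectorMeasure (A \ B) := by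
    rw [← VectorMeasure.of_union (Set.disjoint_sdiff_inter.symm) (hA.inter hB) (hA.diff hB),
      Set.inter_union_sdiff]
  have h2 : Centered.cov (W (A \ B)) (W B) = 0 :=
    W.gram_eq_zero _ _ (hA.diff hB) hB Set.disjoint_sdiff_left
  rw [h1, Centered.cov_add_left, h2, add_zero,
    W.cov_eq_of_subset (hA.inter hB) hB Set.inter_subset_right]
  rfl

variable (G) (b : HilbertBasis ι ℂ H)

/-- The span of the pairs consisting of the coordinates of `1_A T` and of `T (W A)`. -/
noncomputable def graph : Submodule ℂ
    (Lp G 2 (W.intensity.variation.prod (Measure.count : Measure ι)) × Lp G 2 P) :=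
  Submodule.span ℂ {p | ∃ (A : Set Λ) (hA : MeasurableSet A) (T : H →L[ℂ] G),
    p = (L2.toLp b (L2.indicator W.intensity A hA T), (Centered.map T (W A)).1)}

variable {G}

/-- Both sides are sesquilinear, so generators suffice. For these, both are `⟪Sᴴ x, ν(A ∩ B) Tᴴ y⟫`,
with `ν` the intensity of `W`. -/
lemma inner_rankOne_smul_graph (x y : G) {p q} (hp : p ∈ W.graph G b) (hq : q ∈ W.graph G b) :
    ⟪InnerProductSpace.rankOne ℂ x y • q.1, p.1⟫_ℂ =
      ⟪InnerProductSpace.rankOne ℂ x y • q.2, p.2⟫_ℂ := by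
  induction hp using Submodule.span_induction with
  | mem p hp =>
    induction hq using Submodule.span_induction with
    | mem q hq =>
      obtain ⟨A, hA, S, rfl⟩ := hp
      obtain ⟨B, hB, T, rfl⟩ := hq
      rw [L2.inner_rankOne_smul_toLp, Centered.inner_rankOne_smul_eq_cov, Centered.inner_cov_map,
        L2.inner_gram_indicator, W.cov_eq_intensity hA hB]
    | zero => simp only [Prod.fst_zero, Prod.snd_zero, smul_zero, inner_zero_left]
    | add q q' _ _ h h' => simp only [Prod.fst_add, Prod.snd_add, smul_add, inner_add_left, h, h']
    | smul c q _ h =>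
      simp only [Prod.smul_fst, Prod.smul_snd]
      rw [smul_comm, inner_smul_left, h, smul_comm _ c q.2, inner_smul_left]
  | zero => simp only [Prod.fst_zero, Prod.snd_zero, inner_zero_right]
  | add p p' _ _ h h' => simp only [Prod.fst_add, Prod.snd_add, inner_add_right, h, h']
  | smul c p _ h => simp only [Prod.smul_fst, Prod.smul_snd, inner_smul_right, h]

lemma norm_eq_of_mem_graph : ∀ p ∈ W.graph G b, ‖p.1‖ = ‖p.2‖ := fun _ hp =>
  norm_eq_of_inner_rankOne_smul fun x => W.inner_rankOne_smul_graph b x x hp hp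

lemma norm_eq_of_mem_closure_graph :
    ∀ p ∈ (W.graph G b).topologicalClosure, ‖p.1‖ = ‖p.2‖ :=
  norm_eq_of_mem_closure (W.norm_eq_of_mem_graph b)

/-- The pair `(0, y - y')` lies in the closed relation, whose two coordinates have equal norms. The
relation is thus the graph of a function. -/
lemma eq_of_mem_closure_graph {x} {y y' : Lp G 2 P}
    (h : (x, y) ∈ (W.graph G b).topologicalClosure)
    (h' : (x, y') ∈ (W.graph G b).topologicalClosure) : y = y' := by
  have h1 := W.norm_eq_of_mem_closure_graph b _ (Submodule.sub_mem _ h h')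
  simp only [Prod.mk_sub_mk, sub_self, norm_zero] at h1
  exact sub_eq_zero.1 (norm_eq_zero.1 h1.symm)

/-- Generators are permuted, as `S • 1_A T = 1_A (S T)` and `S (T W(A)) = (S T) W(A)`. This
stability gives the module-linearity of the integral and lets equality of norms be upgraded to
equality of Gramians. -/
lemma smul_mem_closure_graph (S : G →L[ℂ] G) {p}
    (hp : p ∈ (W.graph G b).topologicalClosure) :
    (S • p.1, S • p.2) ∈ (W.graph G b).topologicalClosure := by
  refine map_mem_closure (f := fun p : Lp G 2 _ × Lp G 2 P => (S • p.1, S • p.2))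
    (((continuous_const_smul S).comp continuous_fst).prodMk
      ((continuous_const_smul S).comp continuous_snd)) hp fun p hp => ?_
  change (S • p.1, S • p.2) ∈ W.graph G b
  induction hp using Submodule.span_induction with
  | mem p hp =>
    obtain ⟨A, hA, T, rfl⟩ := hp
    refine Submodule.subset_span ⟨A, hA, S ∘L T, ?_⟩
    rw [← L2.smul_indicator, map_smul, ← Centered.smul_map]
    rfl
  | zero => simp only [Prod.fst_zero, Prod.snd_zero, smul_zero]; exact Submodule.zero_mem _
  | add p q _ _ h h' =>
    simp only [Prod.fst_add, Prod.snd_add, smul_add]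
    exact Submodule.add_mem _ h h'
  | smul c p _ h =>
    simp only [Prod.smul_fst, Prod.smul_snd]
    rw [smul_comm, smul_comm _ c p.2]
    exact Submodule.smul_mem _ c h

lemma exists_toLp_of_mem_closure {x}
    (hx : x ∈ ((W.graph G b).map (LinearMap.fst ℂ _ _)).topologicalClosure) :
    ∃ z, L2.toLp b z = x := by
  refine L2.exists_toLp_eq b (Submodule.topologicalClosure_mono ?_ hx)
  refine (Submodule.map_span_le _ _ _).2 ?_
  rintro _ ⟨A, hA, T, rfl⟩
  exact L2.toLp_indicator_mem_boundedCoord b hA T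

/-- Density of the indicators. The orthogonal projection of `toLp b z` on their closed span is, by
completeness, some `toLp b u`; then `z - u` is orthogonal to every indicator and vanishes. -/
lemma toLp_mem_closure (z : L2 W.intensity G) :
    L2.toLp b z ∈ ((W.graph G b).map (LinearMap.fst ℂ _ _)).topologicalClosure := by
  set K := ((W.graph G b).map (LinearMap.fst ℂ _ _)).topologicalClosure with hK
  have : CompleteSpace K := (Submodule.isClosed_topologicalClosure _).completeSpace_coe
  obtain ⟨y, hy, y', hy', hyy⟩ := K.exists_add_mem_mem_orthogonal (L2.toLp b z)
  obtain ⟨u, hu⟩ := W.exists_toLp_of_mem_closure b hy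
  have h1 : z - u = 0 := by
    refine L2.eq_zero_of_inner_toLp_indicator b fun A hA T => ?_
    rw [map_sub, hyy, hu, add_sub_cancel_left]
    refine hy' _ (Submodule.le_topologicalClosure _ ⟨_, Submodule.subset_span ⟨A, hA, T, rfl⟩, rfl⟩)
  rw [sub_eq_zero.1 h1, hu]
  exact hy

/-- The closure defining `W.range` is taken in the centered variables, that of the graph in all of
`L²`; they correspond because the centered variables carry the induced topology. -/
lemma mem_range_iff (X : Centered P G) : X ∈ W.range G ↔
    X.1 ∈ ((W.graph G b).map (LinearMap.snd ℂ _ _)).topologicalClosure := by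
  let f : Centered P G →ₗ[ℂ] Lp G 2 P :=
    { toFun := fun X => X.1
      map_add' := fun _ _ => rfl
      map_smul' := fun _ _ => rfl }
  have h1 : (W.graph G b).map (LinearMap.snd ℂ _ _) =
      (Submodule.span ℂ {X : Centered P G | ∃ (T : H →L[ℂ] G) (A : Set Λ), MeasurableSet A ∧
        X = Centered.map T (W A)}).map f := by
    rw [graph, Submodule.map_span, Submodule.map_span]
    congr 1
    ext Y
    constructor
    · rintro ⟨_, ⟨A, hA, T, rfl⟩, rfl⟩
      exact ⟨_, ⟨T, A, hA, rfl⟩, rfl⟩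
    · rintro ⟨_, ⟨T, A, hA, rfl⟩, rfl⟩
      exact ⟨_, ⟨A, hA, T, rfl⟩, rfl⟩
  rw [h1]
  change X ∈ closure _ ↔ X.1 ∈ closure (f '' _)
  rw [Topology.IsInducing.subtypeVal.closure_eq_preimage_closure_image]
  rfl

lemma snd_mem_closure_of_mem {p} (hp : p ∈ (W.graph G b).topologicalClosure) :
    p.2 ∈ ((W.graph G b).map (LinearMap.snd ℂ _ _)).topologicalClosure :=
  map_mem_closure (f := Prod.snd) continuous_snd hp fun q hq => ⟨q, hq, rfl⟩

lemma fst_mem_closure_of_mem {p} (hp : p ∈ (W.graph G b).topologicalClosure) :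
    p.1 ∈ ((W.graph G b).map (LinearMap.fst ℂ _ _)).topologicalClosure :=
  map_mem_closure (f := Prod.fst) continuous_fst hp fun q hq => ⟨q, hq, rfl⟩

lemma snd_mem_centered {p} (hp : p ∈ (W.graph G b).topologicalClosure) : p.2 ∈ Centered P G := by
  refine Centered.isClosed_coe.closure_subset_iff.2 ?_ (W.snd_mem_closure_of_mem b hp)
  rintro _ ⟨q, hq, rfl⟩
  induction hq using Submodule.span_induction with
  | mem q hq =>
    obtain ⟨A, hA, T, rfl⟩ := hq
    exact (Centered.map T (W A)).2
  | zero => exact (Centered P G).zero_mem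
  | add q q' _ _ h h' => exact (Centered P G).add_mem h h'
  | smul c q _ h => exact (Centered P G).smul_of_tower_mem c h

/-- The stochastic integral with respect to `W`. -/
lemma exists_integral : ∃ I : L2 W.intensity G →ₗ[G →L[ℂ] G] Centered P G,
    ∀ z, (L2.toLp b z, (I z).1) ∈ (W.graph G b).topologicalClosure := by
  choose f hf using fun z => exists_mem_closure_of_norm_eq (Γ := W.graph G b)
    (W.norm_eq_of_mem_graph b) (W.toLp_mem_closure (G := G) b z)
  refine ⟨{ toFun := fun z => ⟨f z, W.snd_mem_centered b (hf z)⟩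
            map_add' := fun z z' => Subtype.ext ?_
            map_smul' := fun S z => Subtype.ext ?_ }, hf⟩
  · refine W.eq_of_mem_closure_graph b (hf _) ?_
    rw [map_add]
    exact Submodule.add_mem _ (hf z) (hf z')
  · refine W.eq_of_mem_closure_graph b (hf _) ?_
    rw [map_smul]
    exact W.smul_mem_closure_graph b S (hf z)

-- Applying a rank-one operator to one pair stays in the closed graph, so polarization equates the
-- scalar products that are the Gramian coefficients on the two sides.
variable {b W} in
lemma isGramianIsometric_of_graph {I : L2 W.intensity G →ₗ[G →L[ℂ] G] Centered P G}
    (hI : ∀ z, (L2.toLp b z, (I z).1) ∈ (W.graph G b).topologicalClosure) :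
    IsGramianIsometric I := by
  intro z u
  refine TraceClass.toCLM_injective (ContinuousLinearMap.ext fun y => ext_inner_left ℂ fun x => ?_)
  change ⟪x, (Centered.cov (I z) (I u)).toCLM y⟫_ℂ = ⟪x, (L2.gram z u).toCLM y⟫_ℂ
  rw [← L2.inner_rankOne_smul_toLp b, ← Centered.inner_rankOne_smul_eq_cov]
  exact (inner_eq_of_norm_eq (Γ := (W.graph G b).topologicalClosure) (W.norm_eq_of_mem_closure_graph b)
    (W.smul_mem_closure_graph b _ (hI u)) (hI z)).symm

lemma norm_eq_of_isGramianIsometric {J : L2 W.intensity G →ₗ[G →L[ℂ] G] Centered P G}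
    (hJ : IsGramianIsometric J) (z : L2 W.intensity G) : ‖L2.toLp b z‖ = ‖(J z).1‖ := by
  refine norm_eq_of_inner_rankOne_smul fun x => ?_
  rw [L2.inner_rankOne_smul_toLp, Centered.inner_rankOne_smul_eq_cov]
  exact congrArg (fun S : TraceClass G G => ⟪x, S.toCLM x⟫_ℂ) (hJ z z).symm

/-- This carries uniqueness. By linearity the prescribed values put every element of `W.graph G b`
on the graph of `J`; as `J` preserves norms, approximating `toLp b z` by the span of indicators
approximates `J z` equally well. -/
lemma graph_of_isGramianIsometric {J : L2 W.intensity G →ₗ[G →L[ℂ] G] Centered P G}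
    (hJ : IsGramianIsometric J) (hJ' : ∀ (A : Set Λ) (hA : MeasurableSet A) (T : H →L[ℂ] G),
      J (L2.indicator W.intensity A hA T) = Centered.map T (W A)) (z : L2 W.intensity G) :
    (L2.toLp b z, (J z).1) ∈ (W.graph G b).topologicalClosure := by
  have h1 : ∀ p ∈ W.graph G b, ∃ u, p = (L2.toLp b u, (J u).1) := by
    intro p hp
    induction hp using Submodule.span_induction with
    | mem p hp =>
      obtain ⟨A, hA, T, rfl⟩ := hp
      exact ⟨L2.indicator W.intensity A hA T, by rw [hJ' A hA T]⟩
    | zero => exact ⟨0, by rw [map_zero, map_zero]; rfl⟩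
    | add p q _ _ h h' =>
      obtain ⟨u, rfl⟩ := h
      obtain ⟨v, rfl⟩ := h'
      exact ⟨u + v, by rw [map_add, map_add]; rfl⟩
    | smul c p _ h =>
      obtain ⟨u, rfl⟩ := h
      -- `J` is linear over the bounded operators, so a complex scalar acts as a multiple of the
      -- identity operator.
      refine ⟨(c • (1 : G →L[ℂ] G)) • u, ?_⟩
      rw [map_smul, map_smul, smul_assoc, one_smul, smul_assoc, one_smul]
      rfl
  refine Metric.mem_closure_iff.2 fun ε hε => ?_
  obtain ⟨_, ⟨p, hp, rfl⟩, hd⟩ := Metric.mem_closure_iff.1 (W.toLp_mem_closure b z) ε hε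
  obtain ⟨u, rfl⟩ := h1 p hp
  refine ⟨_, hp, ?_⟩
  have h2 : dist (J z).1 (J u).1 = dist (L2.toLp b z) (L2.toLp b u) := by
    rw [dist_eq_norm, dist_eq_norm, ← map_sub, W.norm_eq_of_isGramianIsometric b hJ, map_sub]
    rfl
  rw [Prod.dist_eq, h2, max_self]
  exact hd

end RandomCAGOS

end Isometry

end GramianIntegral

/-! ### Existence, uniqueness and range of the integral. -/

theorem mainTheorem11 {Λ Ω : Type*} [MeasurableSpace Λ] [MeasurableSpace Ω]
    (P : Measure Ω) [IsProbabilityMeasure P]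
    {H₀ G₀ : Type*}
    [NormedAddCommGroup H₀] [InnerProductSpace ℂ H₀] [CompleteSpace H₀]
    [TopologicalSpace.SeparableSpace H₀]
    [NormedAddCommGroup G₀] [InnerProductSpace ℂ G₀] [CompleteSpace G₀]
    [TopologicalSpace.SeparableSpace G₀]
    (W : RandomCAGOS Λ P H₀) :
    ∃ I : L2 W.intensity G₀ →ₗ[G₀ →L[ℂ] G₀] Centered P G₀,
      (IsGramianIsometric I ∧
        ∀ (A : Set Λ) (hA : MeasurableSet A) (T : H₀ →L[ℂ] G₀),
          I (L2.indicator W.intensity A hA T) = Centered.map T (W A)) ∧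
      (∀ J : L2 W.intensity G₀ →ₗ[G₀ →L[ℂ] G₀] Centered P G₀,
        (IsGramianIsometric J ∧
          ∀ (A : Set Λ) (hA : MeasurableSet A) (T : H₀ →L[ℂ] G₀),
            J (L2.indicator W.intensity A hA T) = Centered.map T (W A)) → J = I) ∧
      ∃ U : L2 W.intensity G₀ ≃ₗ[G₀ →L[ℂ] G₀] W.range G₀,
        IsGramianIsometric U.toLinearMap ∧ ∀ Φ, (U Φ : Centered P G₀) = I Φ := by
  obtain ⟨w, b, hw⟩ := exists_countable_hilbertBasis H₀
  have : Countable w := hw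
  let _ : MeasurableSpace w := ⊤
  have : MeasurableSingletonClass w := ⟨fun _ => trivial⟩
  obtain ⟨I, hI⟩ := W.exists_integral (G := G₀) b
  have hiso : IsGramianIsometric I := RandomCAGOS.isGramianIsometric_of_graph hI
  refine ⟨I, ⟨hiso, fun A hA T => Subtype.ext ?_⟩, ?_, ?_⟩
  · exact W.eq_of_mem_closure_graph b (hI _)
      (Submodule.le_topologicalClosure _ (Submodule.subset_span ⟨A, hA, T, rfl⟩))
  · rintro J ⟨hJ, hJ'⟩
    exact LinearMap.ext fun z => Subtype.ext
      (W.eq_of_mem_closure_graph b (W.graph_of_isGramianIsometric b hJ hJ' z) (hI z))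
  · have hmem : ∀ z, I z ∈ W.range G₀ := fun z =>
      (W.mem_range_iff b _).2 (W.snd_mem_closure_of_mem b (hI z))
    have hinj : Function.Injective (I.codRestrict (W.range G₀) hmem) := by
      rw [injective_iff_map_eq_zero]
      intro z hz
      refine L2.toLp_injective b ?_
      have h1 : I z = 0 := congrArg Subtype.val hz
      rw [map_zero, ← norm_eq_zero, W.norm_eq_of_isGramianIsometric b hiso, h1]
      exact norm_zero
    have hsurj : Function.Surjective (I.codRestrict (W.range G₀) hmem) := by
      rintro ⟨X, hX⟩
      -- Surjectivity reads the closed graph backwards: `X` has a partner `x` in the closed span of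
      -- the indicator coordinates, and completeness makes `x` the coordinates of some `z`.
      obtain ⟨x, hx⟩ := exists_mem_closure_of_norm_eq' (Γ := W.graph G₀ b)
        (W.norm_eq_of_mem_graph b) ((W.mem_range_iff b X).1 hX)
      obtain ⟨z, rfl⟩ := W.exists_toLp_of_mem_closure b (W.fst_mem_closure_of_mem b hx)
      exact ⟨z, Subtype.ext (Subtype.ext (W.eq_of_mem_closure_graph b (hI z) hx))⟩
    exact ⟨LinearEquiv.ofBijective _ ⟨hinj, hsurj⟩, hiso, fun _ => rfl⟩
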